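/- Let $R=\mathbb{Z}[t_{i,j}\,;\, i,j=0,1,2,\dots]$, let $I\subset R$ be the ideal generated by the $t_{i,j}$ with $0\le i\le j$, and put $\hat R:=\hat R_I\hat\otimes_{\mathbb{Z}}\mathbb{Q}=\varprojlim_K (R/I^K)\otimes_{\mathbb{Z}}\mathbb{Q}$. For integers $n,m\ge 0$ and $l_1\le\dots\le l_n$ in $\mathbb{Z}$ consider the differential operator $$D=(x\partial_x-l_1)\cdots(x\partial_x-l_n)+\sum_{0\le j\le m,\;0\le i}t_{i,j}x^i\partial_x^j .$$ For a prime $p$ let $Det_p(D)\in R/pR$ be the determinant of the operator induced by $D$ modulo $p$ on $V/V^{(p)}$, where $V$ and $V^{(p)}$ are the completed spans $(R/pR)[[x]]$ of $1,x,x^2,\dots$ and $x^p(R/pR)[[x]]$ of $x^p,x^{p+1},\dots$. Let $B(\varepsilon)=(b_{ij}(\varepsilon))_{i,j\in\mathbb{Z}}$, $b_{ij}(\varepsilon)\in R[\varepsilon]$, be the matrix of $D$ in the basis $x^{i+\varepsilon}$, i.e. $Dx^{j+\varepsilon}=\sum_i b_{ij}(\varepsilon)x^{i+\varepsilon}$,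 and let $B_{-M,N}(\varepsilon)=(b_{ij}(\varepsilon))_{-M\le i,j\le N}$. A Weierstrass polynomial of $q(\varepsilon)\in\hat R[[\varepsilon]]$ is a monic polynomial of degree $n$ in $\varepsilon$ over $\hat R$, whose coefficients at $1,\varepsilon,\dots,\varepsilon^{n-1}$ are zero modulo $I$, and such that $q(\varepsilon)$ is its product with an invertible element of $\hat R[[\varepsilon]]$. We say that $L\in\hat R$ lifts the $p$-determinants of $D$ if there is a real $C>0$ such that for every prime $p$ one has $Det_p(D)=L$ modulo $p$ and $I^{\lceil Cp\rceil}$; that is, modulo $I^{\lceil Cp\rceil}$ the element $L$ is of the form $a/s$ with $a\in R$ and an integer $s$ prime to $p$, and $a\equiv s\,Det_p(D)$ in $(R/pR)/I^{\lceil Cp\rceil}(R/pR)$. **Theorem 4.** For all large $M,N$ the series $\det B_{-M,N}(\varepsilon)$ has a unique Weierstrass polynomial $w_{-M,N}(\varepsilon)$, the $I$-adic limit $w(\varepsilon)=\lim_{M,N\to\infty}w_{-M,N}(\varepsilon)$ exists, there is exactly one $L(D)\in\hat R$ that lifts the $p$-determinants of $D$, and $$L(D)=(-1)^n w(0).$$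 Equivalently, let $$\overline R=\hat R[\varepsilon_1,\dots,\varepsilon_n]/\Big(\text{coefficients at }\varepsilon^j,\ 0\le j<n,\text{ of } w(\varepsilon)-\prod_{k=1}^n(\varepsilon-\varepsilon_k)\Big),$$ a ring extension of $\hat R$ in which $w(\varepsilon)=\prod_{k=1}^n(\varepsilon-\varepsilon_k)$; then $L(D)=\varepsilon_1\cdots\varepsilon_n$ in $\overline R$. -/

import Mathlib

open Polynomial PowerSeries

namespace PDet

noncomputable section

/-! ### The parameter ring, the ideal of small parameters, and the completion -/

/-- The polynomial ring `A[t_{ij}]` in the variables `t_{ij}`, `i, j = 0, 1, 2, …`.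
`Par ℤ` is the ring `R = ℤ[t_{ij}]`, `Par (ZMod p)` is `R / pR`, and `Par ℚ` is `R ⊗ ℚ`. -/
abbrev Par (A : Type) [CommRing A] : Type := MvPolynomial (ℕ × ℕ) A

/-- The parameter `t_{ij}`. -/
abbrev t (A : Type) [CommRing A] (i j : ℕ) : Par A := MvPolynomial.X (i, j)

/-- The ideal `I` generated by the small parameters `t_{ij}`, `i ≤ j`. -/
def smallIdeal (A : Type) [CommRing A] : Ideal (Par A) :=
  Ideal.span {f | ∃ i j : ℕ, i ≤ j ∧ f = t A i j}

/-- The ring obtained from the `I`-adic completion of `R` by the completed tensor product with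
`ℚ`, that is, the inverse limit of the rings `(R / I ^ K) ⊗ ℚ = (R ⊗ ℚ) / (I ⊗ ℚ) ^ K`. -/
abbrev Rhat : Type := AdicCompletion (smallIdeal ℚ) (Par ℚ)

/-- The reduction of an element of `Rhat` modulo the `K`-th power of `I`. -/
abbrev red (K : ℕ) : Rhat →ₐ[Par ℚ] Par ℚ ⧸ smallIdeal ℚ ^ K :=
  AdicCompletion.evalₐ (smallIdeal ℚ) K

/-- The canonical map from `R` to `Rhat`. -/
def toRhat : Par ℤ →+* Rhat :=
  (algebraMap (Par ℚ) Rhat).comp (MvPolynomial.map (Int.castRingHom ℚ))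

/-- The (completed) ideal of `Rhat` generated by `I`: the elements that vanish modulo `I`. -/
def hatIdeal : Ideal Rhat := RingHom.ker (red 1)

/-! ### The differential operator -/

/-- The element `(x∂ - l₁) ⋯ (x∂ - lₙ) + ∑_{0 ≤ j ≤ m} T_j ∂ ^ j` of a ring `E` of operators, for
given operators `x` (multiplication by the coordinate), `∂`, and `T_j` (multiplication by `T_j(x)`);
the integers `l_k` act as scalars. -/
def diffOp {E : Type} [Ring E] {n : ℕ} (x d : E) (T : ℕ → E) (m : ℕ) (l : Fin n → ℤ) : E :=
  (List.ofFn fun k => x * d - (l k : E)).prod + ∑ j ∈ Finset.range (m + 1), T j * d ^ j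

/-! ### The `p`-determinant -/

/-- The reduction of `D` modulo `p`, acting on the completion `(R/pR)⟦x⟧` of the span of
`1, x, x², …`; here `T_j(x) = ∑_{i ≥ 0} t_{ij} x ^ i`. -/
def opModP (p : ℕ) {n : ℕ} (m : ℕ) (l : Fin n → ℤ) :
    Module.End (Par (ZMod p)) (PowerSeries (Par (ZMod p))) :=
  diffOp (LinearMap.mulLeft _ PowerSeries.X) (PowerSeries.derivative (Par (ZMod p))).toLinearMap
    (fun j => LinearMap.mulLeft _ (PowerSeries.mk fun i => t (ZMod p) i j)) m l

/-- The completion `x ^ p (R/pR)⟦x⟧` of the span of `x ^ p, x ^ (p + 1), …`. -/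
def tailSubmodule (p : ℕ) : Submodule (Par (ZMod p)) (PowerSeries (Par (ZMod p))) :=
  (Ideal.span {(PowerSeries.X : PowerSeries (Par (ZMod p))) ^ p}).restrictScalars (Par (ZMod p))

theorem mem_tail_mul {p : ℕ} (g f : PowerSeries (Par (ZMod p))) (hf : f ∈ tailSubmodule p) :
    g * f ∈ tailSubmodule p :=
  Ideal.mul_mem_left _ g hf

theorem mem_tail_derivative {p : ℕ} (f : PowerSeries (Par (ZMod p)))
    (hf : f ∈ tailSubmodule p) :
    (PowerSeries.derivative (Par (ZMod p))).toLinearMap f ∈ tailSubmodule p := by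
  have hf' : f ∈ Ideal.span {(PowerSeries.X : PowerSeries (Par (ZMod p))) ^ p} := hf
  obtain ⟨g, rfl⟩ := Ideal.mem_span_singleton'.1 hf'
  have hp : ((p : ℕ) : PowerSeries (Par (ZMod p))) = 0 := by
    rw [← map_natCast (PowerSeries.C (R := Par (ZMod p))), CharP.cast_eq_zero (Par (ZMod p)) p,
      map_zero]
  have h : PowerSeries.derivative (Par (ZMod p)) ((PowerSeries.X : PowerSeries (Par (ZMod p))) ^ p)
      = 0 := by
    rw [PowerSeries.derivative_pow, hp]; simp
  change PowerSeries.derivative (Par (ZMod p)) (g * PowerSeries.X ^ p) ∈ _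
  rw [Derivation.leibniz, h, smul_zero, zero_add, smul_eq_mul, mul_comm]
  exact mem_tail_mul _ _ (Ideal.mem_span_singleton_self _)

/-- The span of `x ^ p, x ^ (p + 1), …` is invariant under `D` modulo `p`. -/
theorem tail_invariant (p : ℕ) {n : ℕ} (m : ℕ) (l : Fin n → ℤ) :
    tailSubmodule p ≤ (tailSubmodule p).comap (opModP p m l) := by
  intro f hf
  have hprod : ∀ L : List (Module.End (Par (ZMod p)) (PowerSeries (Par (ZMod p)))),
      (∀ A ∈ L, ∀ g ∈ tailSubmodule p, A g ∈ tailSubmodule p) →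
        ∀ g ∈ tailSubmodule p, L.prod g ∈ tailSubmodule p := by
    intro L
    induction L with
    | nil => intro _ g hg; simpa using hg
    | cons A L ih =>
      intro hA g hg
      rw [List.prod_cons, Module.End.mul_apply]
      exact hA A (by simp) _ (ih (fun B hB => hA B (by simp [hB])) g hg)
  have hpow : ∀ (j : ℕ), ∀ g ∈ tailSubmodule p,
      ((PowerSeries.derivative (Par (ZMod p))).toLinearMap ^ j) g ∈ tailSubmodule p := by
    intro j
    induction j with
    | zero => intro g hg; simpa using hg
    | succ j ih =>
      intro g hg
      rw [pow_succ', Module.End.mul_apply]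
      exact mem_tail_derivative _ (ih g hg)
  rw [Submodule.mem_comap, opModP, diffOp, LinearMap.add_apply, LinearMap.sum_apply]
  refine Submodule.add_mem _ (hprod _ ?_ f hf) (Submodule.sum_mem _ fun j _ => ?_)
  · intro A hA g hg
    obtain ⟨k, rfl⟩ := (List.mem_ofFn' _ _).1 hA
    rw [LinearMap.sub_apply, Module.End.mul_apply, Module.End.intCast_apply]
    exact Submodule.sub_mem _ (mem_tail_mul _ _ (mem_tail_derivative _ hg))
      (zsmul_mem hg _)
  · exact mem_tail_mul _ _ (hpow j f hf)

/-- The `p`-determinant `Det_p(D)`, an element of `R/pR`: the determinant of the operator that `D`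
modulo `p` induces on the quotient, free with basis `1, x, …, x ^ (p - 1)`, of the span of
`1, x, x², …` by the span of `x ^ p, x ^ (p + 1), …`. -/
def pDet (p : ℕ) {n : ℕ} (m : ℕ) (l : Fin n → ℤ) : Par (ZMod p) :=
  LinearMap.det ((tailSubmodule p).mapQ (tailSubmodule p) (opModP p m l) (tail_invariant p m l))

/-- `L = d` modulo `p` and `I ^ K`, for `L` in `Rhat` and `d` in `R/pR`: modulo `I ^ K`, the element
`L` can be written as `a / s` with `a` in `R` and an integer `s` prime to `p`, and the reduction of
`a / s` modulo `p` is equal to `d` modulo `I ^ K`. -/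
def CongrMod (p K : ℕ) (L : Rhat) (d : Par (ZMod p)) : Prop :=
  ∃ (s : ℤ) (a : Par ℤ), ¬ (p : ℤ) ∣ s ∧ red K (s • L) = red K (toRhat a) ∧
    MvPolynomial.map (Int.castRingHom (ZMod p)) a - s • d ∈ smallIdeal (ZMod p) ^ K

/-- `L` is a lift of the `p`-determinants of `D`: there is a real constant `C > 0` such that
`Det_p(D) = L` modulo `p` and `I ^ ⌈C p⌉` for all primes `p`. -/
def IsUniversalSeries {n : ℕ} (m : ℕ) (l : Fin n → ℤ) (L : Rhat) : Prop :=
  ∃ C : ℝ, 0 < C ∧ ∀ p : ℕ, p.Prime → CongrMod p ⌈C * p⌉₊ L (pDet p m l)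

/-! ### The matrix of `D` in the twisted basis -/

/-- Multiplication by a Laurent series, as an `S`-linear operator on `S((x))`. -/
def laurentMul {S : Type} [CommRing S] (f : LaurentSeries S) : Module.End S (LaurentSeries S) where
  toFun g := f * g
  map_add' g h := mul_add f g h
  map_smul' c g := by
    simp only [RingHom.id_apply, ← HahnSeries.C_mul_eq_smul]
    exact mul_left_comm _ _ _

/-- The operator `∂` on `x ^ ε · S((x))`, written as an operator on `S((x))`:
it is `x ^ (-ε) ∘ ∂ ∘ x ^ ε = ∂ + ε x⁻¹`. -/
def twistedDerivative {S : Type} [CommRing S] (ε : S) : Module.End S (LaurentSeries S) :=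
  LaurentSeries.derivative S + laurentMul (HahnSeries.single (-1 : ℤ) ε)

/-- The operator `(x∂ - l₁) ⋯ (x∂ - lₙ) + ∑_{0 ≤ j ≤ m, 0 ≤ i} c_{ij} x ^ i ∂ ^ j` on the space
`x ^ ε · S((x))`, the completion of the span of the `x ^ (i + ε)`, written as an operator
on `S((x))`. -/
def twistedOp {S : Type} [CommRing S] (ε : S) (c : ℕ → ℕ → S) {n : ℕ} (m : ℕ) (l : Fin n → ℤ) :
    Module.End S (LaurentSeries S) :=
  diffOp (laurentMul (HahnSeries.single (1 : ℤ) 1)) (twistedDerivative ε)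
    (fun j => laurentMul (HahnSeries.ofPowerSeries ℤ S (PowerSeries.mk fun i => c i j))) m l

/-- The entry `b_{ij}(ε)` in `R[ε]`: the coefficient of `D x ^ (j + ε)` at `x ^ (i + ε)`, where `ε`
is the variable of the polynomial ring `R[ε]`. -/
def bEntry {n : ℕ} (m : ℕ) (l : Fin n → ℤ) (i j : ℤ) : (Par ℤ)[X] :=
  (twistedOp Polynomial.X (fun a b => Polynomial.C (t ℤ a b)) m l (HahnSeries.single j 1)).coeff i

/-- The determinant of the finite submatrix `B_{-M,N}(ε) = (b_{ij}(ε))`, `-M ≤ i, j ≤ N`. -/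
def detB {n : ℕ} (m : ℕ) (l : Fin n → ℤ) (M N : ℕ) : (Par ℤ)[X] :=
  Matrix.det (Matrix.of fun i j : Finset.Icc (-(M : ℤ)) (N : ℤ) => bEntry m l i j)

/-- The same determinant as a power series in `ε` over `Rhat`. -/
def detBhat {n : ℕ} (m : ℕ) (l : Fin n → ℤ) (M N : ℕ) : PowerSeries Rhat :=
  (((detB m l M N).map toRhat : Rhat[X]) : PowerSeries Rhat)

/-- `w` is a Weierstrass polynomial of degree `n` of the power series `q`: it is monic of degree
`n`, its other coefficients vanish modulo `I`, and `q` is the product of `w` and an invertible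
power series. -/
def IsWeierstrassPolynomial (n : ℕ) (q : PowerSeries Rhat) (w : Rhat[X]) : Prop :=
  w.Monic ∧ w.natDegree = n ∧ (∀ i < n, w.coeff i ∈ hatIdeal) ∧
    ∃ u : PowerSeries Rhat, IsUnit u ∧ q = (w : PowerSeries Rhat) * u

/-- `w` is the `I`-adic limit of the polynomials `W M N` as `M` and `N` tend to infinity: for every
`K`, all coefficients of `W M N` and `w` agree modulo `I ^ K` once `M` and `N` are large. -/
def IsAdicLimit (W : ℕ → ℕ → Rhat[X]) (w : Rhat[X]) : Prop :=
  ∀ K : ℕ, ∃ M₀ : ℕ, ∀ M N : ℕ, M₀ ≤ M → M₀ ≤ N →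
    ∀ i : ℕ, red K ((W M N).coeff i) = red K (w.coeff i)

/-! ### The universal ring in which a polynomial splits -/

/-- The ideal of `A[ε₁, …, εₙ]` generated by the coefficients at `ε ^ j`, `j < n`, of
`w(ε) - ∏ k, (ε - ε_k)`. -/
def splittingIdeal {A : Type} [CommRing A] (n : ℕ) (w : A[X]) : Ideal (MvPolynomial (Fin n) A) :=
  Ideal.span {c | ∃ j < n, c = (w.map (MvPolynomial.C : A →+* MvPolynomial (Fin n) A) -
    ∏ k : Fin n, (Polynomial.X - Polynomial.C (MvPolynomial.X k))).coeff j}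

/-- The universal extension of `A` in which the monic polynomial `w` of degree `n` is a product of
`n` linear factors. -/
abbrev SplittingRing {A : Type} [CommRing A] (n : ℕ) (w : A[X]) : Type :=
  MvPolynomial (Fin n) A ⧸ splittingIdeal n w

/-- The roots `ε₁, …, εₙ` of `w` in the universal extension. -/
def root {A : Type} [CommRing A] (n : ℕ) (w : A[X]) (k : Fin n) : SplittingRing n w :=
  Ideal.Quotient.mk (splittingIdeal n w) (MvPolynomial.X k)

end

end PDet

namespace PDet
noncomputable section

/-! ### Logarithmic derivatives of determinants -/

/-! Rescale the small parameters by `Y ^ (m + 1)`. Congruences modulo `I ^ K` become congruences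
modulo `Y ^ ((m + 1) * K)` (`mem_smallIdeal_pow_iff`). Conjugation by the diagonal matrix of the
powers `Y ^ i` then turns `B(ε)` into the diagonal matrix with entries `∏ (ε + i - l_k)` plus a
perturbation divisible by `Y`, in which a shift by `d` costs at least `|d| / (m + 1)` powers of `Y`
(`polyScale_detOver`).

Determinants are compared through their logarithmic derivatives in `Y`, which are traces of powers
of the perturbation divided by the diagonal (`derivative_det_one_add`); the coefficients are Laurent
series in `ε`. In a Weierstrass factorization the polynomial contributes only negative powers of `ε`
and the invertible factor only nonnegative ones, so the polar part of the logarithmic derivative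
determines the Weierstrass polynomial (`coeff_eq_of_isFactor`). Poles arise only in rows near the
exponents `l_k`, and walks of bounded weight through these rows stay in a bounded window. Hence, to
a given order, all large windows have the same Weierstrass polynomial
(`coeff_eq_of_isFactor_windowDet`), and the limit `w` exists.

Modulo `p` the matrix can be wrapped around the circle `ZMod p`; at `ε = 0` its determinant is the
rescaled `Det_p(D)` modulo `Y ^ p` (`X_pow_dvd_cyclicDet_sub`). To moderate order, the logarithmic
derivative of the wrapped determinant is a rational function of `ε` that is invariant under `ε ↦ ε +
1`, has poles only in the prime field and vanishes at infinity. Such a function is determined by its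
polar part at `0` (`eq_zero_of_regular_of_periodic`), which by locality is that of `w`. The product
of the translates `w(ε + j)` has the same properties, so the two agree (`coeff_cyclicDet_eq`). At `ε
= 0` this gives `Det_p(D) = ∏_j w(j) = ∏_k (ε_k - ε_k ^ p)` up to signs that cancel for odd `p` and
do not matter for `p = 2`; since the roots are nilpotent modulo `I ^ K`, only `∏ ε_k = (-1) ^ n
w(0)` remains (`prod_eval_zmod`).

A factorization over the integers localized at `p` maps both to the rational numbers and to `ZMod
p`, which links `w` to the computation modulo `p` (`IsPrep.exists_congr_pDet`). The lift is unique
because a rational number whose numerator is divisible by infinitely many primes is zero. -/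

theorem derivation_prod {A B : Type*} [CommRing A] [CommRing B] [Algebra A B]
    (δ : Derivation A B B) {ι : Type*} [DecidableEq ι] (s : Finset ι) (f : ι → B) :
    δ (∏ i ∈ s, f i) = ∑ i ∈ s, δ (f i) * ∏ j ∈ s.erase i, f j := by
  induction s using Finset.induction_on with
  | empty => simp
  | insert a s ha ih =>
    rw [Finset.prod_insert ha, Derivation.leibniz, Finset.sum_insert ha, Finset.erase_insert ha, ih,
      smul_eq_mul, smul_eq_mul, add_comm, mul_comm (δ (f a)), Finset.mul_sum, mul_comm]
    congr 1
    refine Finset.sum_congr rfl fun i hi => ?_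
    have hia : a ≠ i := fun h => ha (h ▸ hi)
    rw [Finset.erase_insert_of_ne hia, Finset.prod_insert (by simp [ha])]
    ring

/-- Jacobi's formula for a derivation. -/
theorem derivation_det {A B : Type*} [CommRing A] [CommRing B] [Algebra A B]
    (δ : Derivation A B B) {ι : Type*} [Fintype ι] [DecidableEq ι] (M : Matrix ι ι B) :
    δ M.det = (M.adjugate * M.map δ).trace := by
  have h1 : ∀ i, (M.adjugate * M.map δ) i i = (M.updateCol i fun k => δ (M k i)).det := by
    intro i
    rw [← Matrix.cramer_apply, Matrix.cramer_eq_adjugate_mulVec]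
    rfl
  simp only [Matrix.trace, Matrix.diag_apply, h1]
  simp only [Matrix.det_apply, map_sum, Derivation.map_smul_of_tower, derivation_prod]
  rw [Finset.sum_comm]
  refine Finset.sum_congr rfl fun σ _ => ?_
  rw [← Finset.smul_sum]
  congr 1
  refine Finset.sum_congr rfl fun i _ => ?_
  rw [← Finset.mul_prod_erase Finset.univ _ (Finset.mem_univ i)]
  simp only [Matrix.updateCol_self]
  congr 1
  refine Finset.prod_congr rfl fun j hj => ?_
  rw [Matrix.updateCol_ne (Finset.ne_of_mem_erase hj)]

theorem derivation_map_mul {A B : Type*} [CommRing A] [CommRing B] [Algebra A B]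
    (δ : Derivation A B B) {ι : Type*} [Fintype ι] (M N : Matrix ι ι B) :
    (M * N).map δ = M.map δ * N + M * N.map δ := by
  ext i j
  simp only [Matrix.map_apply, Matrix.mul_apply, map_sum, Derivation.leibniz, Matrix.add_apply,
    ← Finset.sum_add_distrib, smul_eq_mul]
  refine Finset.sum_congr rfl fun k _ => by ring

/-- The Leibniz rule gives `r + 1` terms, one for each factor, and cyclicity of the trace makes them
equal. -/
theorem derivation_trace_pow {A B : Type*} [CommRing A] [CommRing B] [Algebra A B]
    (δ : Derivation A B B) {ι : Type*} [Fintype ι] [DecidableEq ι] (M : Matrix ι ι B) (r : ℕ) :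
    δ (M ^ (r + 1)).trace = (r + 1 : ℕ) * (M ^ r * M.map δ).trace := by
  have htr : ∀ N : Matrix ι ι B, δ N.trace = (N.map δ).trace := by
    intro N; simp [Matrix.trace]
  -- The extra factor `K` absorbs the last factor `M` in the induction on `r`.
  have key : ∀ (r : ℕ) (K : Matrix ι ι B),
      ((M ^ r).map δ * K).trace = ∑ a ∈ Finset.range r, (M ^ a * M.map δ * (M ^ (r - 1 - a) * K)).trace := by
    intro r
    induction r with
    | zero =>
      intro K
      have : ((1 : Matrix ι ι B).map δ) = 0 := by
        ext i j
        by_cases h : i = j <;> simp [h]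
      simp [this]
    | succ r ih =>
      intro K
      rw [pow_succ, derivation_map_mul, Matrix.add_mul, Matrix.trace_add, Finset.sum_range_succ,
        Matrix.mul_assoc, ih]
      congr 1
      · refine Finset.sum_congr rfl fun a ha => ?_
        have : r + 1 - 1 - a = (r - 1 - a) + 1 := by have := Finset.mem_range.1 ha; omega
        rw [this, pow_succ, Matrix.mul_assoc (M ^ (r - 1 - a))]
      · simp
  rw [htr, ← Matrix.mul_one ((M ^ (r + 1)).map δ), key]
  have : ∀ a ∈ Finset.range (r + 1),
      (M ^ a * M.map δ * (M ^ (r + 1 - 1 - a) * 1)).trace = (M ^ r * M.map δ).trace := by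
    intro a ha
    have : r = (r - a) + a := by have := Finset.mem_range.1 ha; omega
    rw [Matrix.mul_one, Matrix.trace_mul_comm, ← Matrix.mul_assoc, ← pow_add]
    congr 3
    omega
  rw [Finset.sum_congr rfl this]
  simp

variable {k : Type*} [Field k] {G₀ : Type*} [CommRing G₀] [Algebra k G₀]

/-- The truncated logarithm of `det (1 + A)`. -/
def traceLog (k : Type*) [Field k] {G₀ : Type*} [CommRing G₀] [Algebra k G₀]
    {ι : Type*} [Fintype ι] [DecidableEq ι] (N : ℕ) (A : Matrix ι ι G₀⟦X⟧) : G₀⟦X⟧ :=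
  ∑ r ∈ Finset.range N, ((-1) ^ r * ((r + 1 : ℕ) : k)⁻¹) • (A ^ (r + 1)).trace

theorem coeff_derivative_traceLog {ι : Type*} [Fintype ι] [DecidableEq ι] (N : ℕ)
    (A : Matrix ι ι G₀⟦X⟧) (κ : ℕ) : PowerSeries.coeff κ (d⁄dX G₀ (traceLog k N A)) =
      (κ + 1) • ∑ r ∈ Finset.range N, algebraMap k G₀ ((-1) ^ r * ((r + 1 : ℕ) : k)⁻¹) *
        PowerSeries.coeff (κ + 1) (A ^ (r + 1)).trace := by
  rw [PowerSeries.coeff_derivative, traceLog, map_sum, nsmul_eq_mul, mul_comm, Nat.cast_succ]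
  congr 1
  refine Finset.sum_congr rfl fun r _ => ?_
  rw [PowerSeries.coeff_smul, Algebra.smul_def]

theorem X_pow_dvd_matrix_pow {ι : Type*} [Fintype ι] [DecidableEq ι] (A : Matrix ι ι G₀⟦X⟧)
    (hA : ∀ i j, PowerSeries.X ∣ A i j) (r : ℕ) (i j : ι) : (PowerSeries.X : G₀⟦X⟧) ^ r ∣ (A ^ r) i j := by
  induction r generalizing i j with
  | zero => simp
  | succ r ih =>
    rw [pow_succ, pow_succ, Matrix.mul_apply]
    exact Finset.dvd_sum fun l _ => mul_dvd_mul (ih i l) (hA l j)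

/-- The logarithmic derivative of `det (1 + A)` is the derivative of the truncated logarithm. -/
theorem derivative_det_one_add {ι : Type*} [Fintype ι] [DecidableEq ι] (N : ℕ)
    (hN : ∀ r < N, ((r + 1 : ℕ) : k) ≠ 0) (A : Matrix ι ι G₀⟦X⟧) (hA : ∀ i j, PowerSeries.X ∣ A i j) :
    (PowerSeries.X : G₀⟦X⟧) ^ N ∣ d⁄dX G₀ (1 + A).det - (1 + A).det * d⁄dX G₀ (traceLog k N A) := by
  set δ := d⁄dX G₀
  -- The truncated Neumann series for `(1 + A)⁻¹`; its error `(-A) ^ N` is divisible by the `N`-th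
  -- power of the variable. Replacing the adjugate in Jacobi's formula by `det (1 + A) • Y` is
  -- therefore harmless.
  set Y := ∑ r ∈ Finset.range N, (-A) ^ r with hY
  have hgeom : (1 + A) * Y = 1 - (-A) ^ N := by
    have := mul_geom_sum (-A) N
    rw [← hY] at this
    have h2 : (1 + A) * Y = -((-A - 1) * Y) := by
      rw [← Matrix.neg_mul]; congr 1; abel
    rw [h2, this]; abel
  have hadj : (1 + A).adjugate = (1 + A).det • Y + (1 + A).adjugate * (-A) ^ N := by
    have : (1 + A).adjugate * ((1 + A) * Y) = (1 + A).det • Y := by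
      rw [← Matrix.mul_assoc, Matrix.adjugate_mul, Matrix.smul_mul, Matrix.one_mul]
    rw [hgeom, Matrix.mul_sub, Matrix.mul_one] at this
    rw [← this]; abel
  have hmap : (1 + A).map δ = A.map δ := by
    ext i j
    simp only [Matrix.map_apply, Matrix.add_apply, map_add]
    by_cases h : i = j <;> simp [Matrix.one_apply, h]
  have hlog : δ (traceLog k N A) = (Y * A.map δ).trace := by
    rw [traceLog, map_sum, hY, Matrix.sum_mul, Matrix.trace_sum]
    refine Finset.sum_congr rfl fun r hr => ?_
    have hs : ∀ (c : k) (f : G₀⟦X⟧), δ (c • f) = c • δ f := by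
      intro c f
      rw [← algebraMap_smul G₀ c f, Derivation.map_smul, algebraMap_smul]
    rw [hs, derivation_trace_pow, ← nsmul_eq_mul, ← Nat.cast_smul_eq_nsmul k, smul_smul,
      mul_assoc, inv_mul_cancel₀ (hN r (Finset.mem_range.1 hr)), mul_one]
    rcases Nat.even_or_odd r with he | ho
    · simp [he.neg_one_pow, he.neg_pow]
    · simp [ho.neg_one_pow, ho.neg_pow]
  rw [derivation_det, hmap, hlog, hadj, Matrix.add_mul, Matrix.trace_add, Matrix.smul_mul,
    Matrix.trace_smul, smul_eq_mul, add_sub_cancel_left]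
  rw [Matrix.trace]
  refine Finset.dvd_sum fun i _ => ?_
  rw [Matrix.diag_apply, Matrix.mul_apply]
  refine Finset.dvd_sum fun j _ => Dvd.dvd.mul_right ?_ _
  rw [Matrix.mul_apply]
  refine Finset.dvd_sum fun l _ => Dvd.dvd.mul_left ?_ _
  exact X_pow_dvd_matrix_pow _ (fun i j => by simpa using hA i j) N l j

/-- A power series is determined by its constant term and its logarithmic derivative. -/
theorem coeff_eq_of_logDeriv (N : ℕ) (hN : ∀ r < N, ((r + 1 : ℕ) : k) ≠ 0)
    {f g μ ν : G₀⟦X⟧} (h0 : PowerSeries.coeff 0 f = PowerSeries.coeff 0 g)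
    (hf : PowerSeries.X ^ N ∣ d⁄dX G₀ f - f * μ) (hg : PowerSeries.X ^ N ∣ d⁄dX G₀ g - g * ν)
    (hμν : ∀ i < N, PowerSeries.coeff i μ = PowerSeries.coeff i ν) (i : ℕ) (hi : i ≤ N) : PowerSeries.coeff i f = PowerSeries.coeff i g := by
  induction i using Nat.strong_induction_on with
  | _ i ih =>
    rcases i with _ | i
    · exact h0
    · have e1 := (PowerSeries.X_pow_dvd_iff.1 hf) i (by omega)
      have e2 := (PowerSeries.X_pow_dvd_iff.1 hg) i (by omega)
      rw [map_sub, PowerSeries.coeff_derivative, sub_eq_zero, PowerSeries.coeff_mul] at e1 e2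
      have e3 : ∑ p ∈ Finset.HasAntidiagonal.antidiagonal i, PowerSeries.coeff p.1 f * PowerSeries.coeff p.2 μ =
          ∑ p ∈ Finset.HasAntidiagonal.antidiagonal i, PowerSeries.coeff p.1 g * PowerSeries.coeff p.2 ν := by
        refine Finset.sum_congr rfl fun p hp => ?_
        have := Finset.HasAntidiagonal.mem_antidiagonal.1 hp
        rw [ih p.1 (by omega) (by omega), hμν p.2 (by omega)]
      rw [e3, ← e2] at e1
      -- The equation `f' = f μ` expresses `i + 1` times the next coefficient of `f` by the earlier
      -- ones, so it can be solved as long as `i + 1` is invertible.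
      have hu : IsUnit ((i : G₀) + 1) := by
        have : ((i : G₀) + 1) = algebraMap k G₀ ((i + 1 : ℕ) : k) := by simp
        rw [this]
        exact (IsUnit.mk0 _ (hN i (by omega))).map _
      exact hu.mul_left_injective e1

/-- The logarithmic derivative of `1 + f`, for `f` with coefficients in a non-unital subring. -/
theorem coeff_logDeriv_mem (Z : NonUnitalSubring G₀) {f μ : G₀⟦X⟧}
    (h0 : PowerSeries.coeff 0 f = 1) (hf : ∀ i, i ≠ 0 → PowerSeries.coeff i f ∈ Z)
    (hμ : d⁄dX G₀ f = f * μ) (i : ℕ) : PowerSeries.coeff i μ ∈ Z := by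
  induction i using Nat.strong_induction_on with
  | _ i ih =>
    -- As `f` has constant term `1`, the coefficient of `μ` at `i` is `(i + 1) f_{i+1}` minus
    -- products of higher coefficients of `f` with earlier coefficients of `μ`. No division occurs,
    -- and no unit of the subring is needed.
    have h := congrArg (PowerSeries.coeff i) hμ
    rw [PowerSeries.coeff_derivative, PowerSeries.coeff_mul,
      ← Finset.add_sum_erase _ _ (show (0, i) ∈ Finset.HasAntidiagonal.antidiagonal i by simp), h0, one_mul] at h
    rw [show PowerSeries.coeff i μ = _ from eq_sub_iff_add_eq.2 h.symm]
    refine Z.sub_mem ?_ (Z.sum_mem fun p hp => ?_)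
    · have : ((i : G₀) + 1) = ((i + 1 : ℕ) : G₀) := by push_cast; rfl
      rw [this, mul_comm, ← nsmul_eq_mul]
      exact Z.nsmul_mem (hf (i + 1) (by omega)) _
    · rw [Finset.mem_erase, Finset.HasAntidiagonal.mem_antidiagonal] at hp
      have hp1 : p.1 ≠ 0 := by
        intro h0
        apply hp.1
        ext <;> simp <;> omega
      exact Z.mul_mem (hf _ hp1) (ih _ (by omega))

/-! ### Locality of powers of banded matrices -/

section Locality

variable {G₀ : Type*} [CommRing G₀] {ι ι₀ : Type*} [Fintype ι] [DecidableEq ι] [Fintype ι₀]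
  [DecidableEq ι₀]

/-- The rows of `A` far away from the origin (with respect to the size function `ν`) are regular,
and the entries of `A` far away from the diagonal are divisible by a high power of the variable. -/
structure IsBanded (O : Subring G₀) (b c : ℕ) (ν : ι → ℕ) (A : Matrix ι ι G₀⟦X⟧) : Prop where
  le_left : ∀ i j κ, PowerSeries.coeff κ (A i j) ≠ 0 → ν i ≤ ν j + b * κ
  le_right : ∀ i j κ, PowerSeries.coeff κ (A i j) ≠ 0 → ν j ≤ ν i + b * κ
  mem : ∀ i j κ, c < ν i → PowerSeries.coeff κ (A i j) ∈ O

/-- An entry of `A ^ r` is a sum over walks, and a walk of total weight `κ` moves by at most `b *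
κ`. Started beyond `c + b * κ`, it only meets rows with regular entries. -/
theorem coeff_pow_mem {O : Subring G₀} {b c : ℕ} {ν : ι → ℕ} {A : Matrix ι ι G₀⟦X⟧}
    (hA : IsBanded O b c ν A) (r : ℕ) (i j : ι) (κ : ℕ) (hi : c + b * κ < ν i) :
    PowerSeries.coeff κ ((A ^ r) i j) ∈ O := by
  induction r generalizing i κ with
  | zero =>
    rw [pow_zero, Matrix.one_apply]
    split_ifs
    · rw [PowerSeries.coeff_one]
      split_ifs <;> simp [O.one_mem, O.zero_mem]
    · simp [O.zero_mem]
  | succ r ih =>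
    rw [pow_succ', Matrix.mul_apply, map_sum]
    refine O.sum_mem fun l _ => ?_
    rw [PowerSeries.coeff_mul]
    refine O.sum_mem fun q hq => ?_
    rw [Finset.HasAntidiagonal.mem_antidiagonal] at hq
    subst hq
    by_cases h : PowerSeries.coeff q.1 (A i l) = 0
    · rw [h, zero_mul]; exact O.zero_mem
    · have h1 := hA.le_left _ _ _ h
      rw [mul_add] at hi
      exact O.mul_mem (hA.mem _ _ _ (by omega)) (ih _ _ (by omega))

/-- A walk of weight `κ` started at size at most `J - b * κ` never leaves the part where the two
matrices agree. -/
theorem coeff_pow_eq {b : ℕ} {ν : ι → ℕ} {A : Matrix ι ι G₀⟦X⟧} {A₀ : Matrix ι₀ ι₀ G₀⟦X⟧}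
    (hA : ∀ i j κ, PowerSeries.coeff κ (A i j) ≠ 0 → ν j ≤ ν i + b * κ)
    {f : ι₀ → ι} (hf : Function.Injective f) {J N : ℕ} (hJ : ∀ i, ν i ≤ J → i ∈ Set.range f)
    (h : ∀ a a' κ, κ ≤ N →
      PowerSeries.coeff κ (A (f a) (f a')) = PowerSeries.coeff κ (A₀ a a'))
    (r : ℕ) (a a' : ι₀) (κ : ℕ) (hκ : κ ≤ N) (ha : ν (f a) + b * κ ≤ J) :
    PowerSeries.coeff κ ((A ^ r) (f a) (f a')) = PowerSeries.coeff κ ((A₀ ^ r) a a') := by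
  induction r generalizing a κ with
  | zero =>
    rw [pow_zero, pow_zero, Matrix.one_apply, Matrix.one_apply]
    simp only [hf.eq_iff]
  | succ r ih =>
    rw [pow_succ', pow_succ', Matrix.mul_apply, Matrix.mul_apply, map_sum, map_sum]
    symm
    refine Fintype.sum_of_injective f hf _ _ (fun i hi => ?_) fun l => ?_
    · rw [PowerSeries.coeff_mul]
      refine Finset.sum_eq_zero fun q hq => ?_
      rw [Finset.HasAntidiagonal.mem_antidiagonal] at hq
      subst hq
      by_cases h0 : PowerSeries.coeff q.1 (A (f a) i) = 0
      · rw [h0, zero_mul]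
      · have h1 := hA _ _ _ h0
        rw [mul_add] at ha
        exact absurd (hJ i (by omega)) hi
    · rw [PowerSeries.coeff_mul, PowerSeries.coeff_mul]
      refine Finset.sum_congr rfl fun q hq => ?_
      rw [Finset.HasAntidiagonal.mem_antidiagonal] at hq
      subst hq
      rw [← h a l q.1 (by omega)]
      by_cases h0 : PowerSeries.coeff q.1 (A (f a) (f l)) = 0
      · rw [h0, zero_mul, zero_mul]
      · have h1 := hA _ _ _ h0
        rw [mul_add] at ha
        rw [ih _ _ (by omega) (by omega)]

/-- The traces of the powers of a banded matrix and of its central part have the same polar part. -/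
theorem coeff_trace_pow_sub_mem {O : Subring G₀} {b c : ℕ} {ν : ι → ℕ} {A : Matrix ι ι G₀⟦X⟧}
    {A₀ : Matrix ι₀ ι₀ G₀⟦X⟧} (hA : IsBanded O b c ν A)
    {f : ι₀ → ι} (hA₀ : IsBanded O b c (ν ∘ f) A₀)
    (hf : Function.Injective f) {J N : ℕ} (hJ : ∀ i, ν i ≤ J → i ∈ Set.range f)
    (h : ∀ a a' κ, κ ≤ N →
      PowerSeries.coeff κ (A (f a) (f a')) = PowerSeries.coeff κ (A₀ a a'))
    (hJN : c + 2 * (b * N) ≤ J) (r κ : ℕ) (hκ : κ ≤ N) :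
    PowerSeries.coeff κ (A ^ r).trace - PowerSeries.coeff κ (A₀ ^ r).trace ∈ O := by
  have hb : b * κ ≤ b * N := Nat.mul_le_mul_left b hκ
  rw [Matrix.trace, Matrix.trace, map_sum, map_sum,
    ← Finset.sum_add_sum_compl (Finset.univ.map ⟨f, hf⟩), Finset.sum_map, add_sub_right_comm,
    ← Finset.sum_sub_distrib]
  refine O.add_mem (O.sum_mem fun a _ => ?_) (O.sum_mem fun i hi => ?_)
  -- Near the origin the diagonal entries of the two powers coincide. Otherwise `ν (f a) > J - b * κ
  -- ≥ c + b * κ`, and each of them is regular; this is why `J` must exceed `c` by twice `b * N`.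
  · by_cases ha : ν (f a) + b * κ ≤ J
    · have := coeff_pow_eq hA.le_right hf hJ h r a a κ hκ ha
      simp only [Function.Embedding.coeFn_mk, Matrix.diag_apply, this, sub_self, O.zero_mem]
    · exact O.sub_mem (coeff_pow_mem hA r _ _ κ (by simp; omega))
        (coeff_pow_mem hA₀ r _ _ κ (by simp; omega))
  · refine coeff_pow_mem hA r i i κ ?_
    have : ¬ ν i ≤ J := by
      intro hi'
      obtain ⟨a, rfl⟩ := hJ i hi'
      simp at hi
    omega

theorem coeff_traceLog_sub_mem {k : Type*} [Field k] [Algebra k G₀] {O : Subring G₀}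
    (hO : ∀ s : k, algebraMap k G₀ s ∈ O)
    {b c : ℕ} {ν : ι → ℕ} {A : Matrix ι ι G₀⟦X⟧}
    {A₀ : Matrix ι₀ ι₀ G₀⟦X⟧} (hA : IsBanded O b c ν A)
    {f : ι₀ → ι} (hA₀ : IsBanded O b c (ν ∘ f) A₀)
    (hf : Function.Injective f) {J N : ℕ} (hJ : ∀ i, ν i ≤ J → i ∈ Set.range f)
    (h : ∀ a a' κ, κ ≤ N →
      PowerSeries.coeff κ (A (f a) (f a')) = PowerSeries.coeff κ (A₀ a a'))
    (hJN : c + 2 * (b * N) ≤ J) (κ : ℕ) (hκ : κ < N) :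
    PowerSeries.coeff κ (d⁄dX G₀ (traceLog k N A)) -
      PowerSeries.coeff κ (d⁄dX G₀ (traceLog k N A₀)) ∈ O := by
  rw [coeff_derivative_traceLog, coeff_derivative_traceLog, ← smul_sub, ← Finset.sum_sub_distrib]
  refine O.nsmul_mem (O.sum_mem fun r _ => ?_) _
  rw [← mul_sub]
  exact O.mul_mem (hO _) (coeff_trace_pow_sub_mem hA hA₀ hf hJ h hJN _ _ (by omega))

end Locality

/-! ### Regular and polar Laurent series -/

section Laurent

variable {S : Type*} [CommRing S]

/-- Polynomials as Laurent series. -/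
def polyLaurent (S : Type*) [CommRing S] : S[X] →+* LaurentSeries S :=
  (HahnSeries.ofPowerSeries ℤ S).comp Polynomial.coeToPowerSeries.ringHom

theorem polyLaurent_injective : Function.Injective (polyLaurent S) :=
  HahnSeries.ofPowerSeries_injective.comp (Polynomial.coe_injective S)

/-- The Laurent series without pole. -/
def regularSubring (S : Type*) [CommRing S] : Subring (LaurentSeries S) :=
  (HahnSeries.ofPowerSeries ℤ S).range

theorem polyLaurent_mem_regular (f : S[X]) : polyLaurent S f ∈ regularSubring S := ⟨_, rfl⟩

theorem coeff_eq_zero_of_regular {z : LaurentSeries S} (hz : z ∈ regularSubring S) {i : ℤ}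
    (hi : i < 0) : z.coeff i = 0 := by
  obtain ⟨f, rfl⟩ := hz
  rw [PowerSeries.coeff_coe, if_pos hi]

/-- The Laurent series with only terms of negative degree. -/
def polarSubring (S : Type*) [CommRing S] : NonUnitalSubring (LaurentSeries S) where
  carrier := {z | ∀ i : ℤ, 0 ≤ i → z.coeff i = 0}
  add_mem' {a b} ha hb i hi := by rw [HahnSeries.coeff_add, ha i hi, hb i hi, add_zero]
  zero_mem' i _ := by simp
  neg_mem' {a} ha i hi := by rw [HahnSeries.coeff_neg, ha i hi, neg_zero]
  mul_mem' {a b} ha hb i hi := by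
    rw [HahnSeries.coeff_mul]
    refine Finset.sum_eq_zero fun q hq => ?_
    have hq' := (Finset.mem_antidiagonal.1 hq).2.2
    by_cases h : 0 ≤ q.1
    · rw [ha _ h, zero_mul]
    · rw [hb _ (by omega), mul_zero]

theorem eq_zero_of_regular_of_polar {z : LaurentSeries S} (hz : z ∈ regularSubring S)
    (hz' : z ∈ polarSubring S) : z = 0 := by
  ext i
  by_cases hi : 0 ≤ i
  · exact hz' i hi
  · exact coeff_eq_zero_of_regular hz (by omega)

theorem polyLaurent_coeff (f : S[X]) (i : ℕ) : (polyLaurent S f).coeff i = f.coeff i := by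
  simp [polyLaurent, HahnSeries.ofPowerSeries_apply_coeff]

theorem polyLaurent_X_pow (n : ℕ) :
    polyLaurent S (Polynomial.X ^ n) = HahnSeries.single (n : ℤ) 1 := by
  simp [polyLaurent]

theorem single_mul_polyLaurent_X_pow (n : ℕ) :
    HahnSeries.single (-(n : ℤ)) 1 * polyLaurent S (Polynomial.X ^ n) = 1 := by
  rw [polyLaurent_X_pow, HahnSeries.single_mul_single]
  simp

theorem polyLaurent_mul_single_mem_polar {n : ℕ} {f : S[X]} (hf : f.degree < n) :
    polyLaurent S f * HahnSeries.single (-(n : ℤ)) 1 ∈ polarSubring S := by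
  intro i hi
  rw [HahnSeries.coeff_mul_single, mul_one]
  have : i - -(n : ℤ) = ((i.toNat + n : ℕ) : ℤ) := by omega
  rw [this, polyLaurent_coeff]
  exact Polynomial.coeff_eq_zero_of_degree_lt (hf.trans_le (by norm_cast; omega))

/-- For `a ≠ 0` the constant term is invertible, so the inverse is a power series; for `a = 0` the
inverse is `X⁻¹`, the only source of poles. -/
theorem isUnit_polyLaurent_X_add_C {k : Type*} [Field k] [Algebra k S] (a : k) :
    IsUnit (polyLaurent S (Polynomial.X + Polynomial.C (algebraMap k S a))) ∧
      (a ≠ 0 → ∃ u : S⟦X⟧, HahnSeries.ofPowerSeries ℤ S u *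
        polyLaurent S (Polynomial.X + Polynomial.C (algebraMap k S a)) = 1) := by
  have h : a ≠ 0 → ∃ u : S⟦X⟧, HahnSeries.ofPowerSeries ℤ S u *
        polyLaurent S (Polynomial.X + Polynomial.C (algebraMap k S a)) = 1 := by
    intro ha
    have hu : IsUnit ((Polynomial.X + Polynomial.C (algebraMap k S a) : S[X]) : S⟦X⟧) := by
      rw [PowerSeries.isUnit_iff_constantCoeff]
      simpa using (IsUnit.mk0 a ha).map (algebraMap k S)
    obtain ⟨u, hu⟩ := hu.exists_left_inv
    refine ⟨u, ?_⟩
    rw [polyLaurent, RingHom.comp_apply, ← map_mul]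
    rw [Polynomial.coeToPowerSeries.ringHom_apply, hu, map_one]
  refine ⟨?_, h⟩
  by_cases ha : a = 0
  · subst ha
    have := single_mul_polyLaurent_X_pow (S := S) 1
    rw [pow_one] at this
    simpa using IsUnit.of_mul_eq_one_right _ this
  · obtain ⟨u, hu⟩ := h ha
    exact IsUnit.of_mul_eq_one_right _ hu

/-! ### Weierstrass factorizations and logarithmic derivatives -/

/-- Reordering of a series in `S[X]⟦Y⟧` as a series in `S((X))⟦Y⟧`. -/
abbrev toLaurent (S : Type*) [CommRing S] : S[X]⟦X⟧ →+* (LaurentSeries S)⟦X⟧ :=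
  PowerSeries.map (polyLaurent S)

/-- The polynomial `w` is monic of degree `n` in `X`, and equal to `X ^ n` modulo `Y`. -/
def IsMonicLift (n : ℕ) (w : S[X]⟦X⟧) : Prop :=
  PowerSeries.coeff 0 w = Polynomial.X ^ n ∧ ∀ i, i ≠ 0 → (PowerSeries.coeff i w).degree < n

/-- `q` is congruent to a product of `w` and an invertible series modulo `Y ^ (N + 1)`. -/
def IsFactor (N : ℕ) (q w : S[X]⟦X⟧) : Prop :=
  ∃ u : S⟦X⟧⟦X⟧, IsUnit u ∧ PowerSeries.X ^ (N + 1) ∣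
    PowerSeries.map Polynomial.coeToPowerSeries.ringHom q -
      PowerSeries.map Polynomial.coeToPowerSeries.ringHom w * u

theorem coeff_logDeriv_of_isUnit {R : Type*} [CommRing R] {f : R⟦X⟧} (hf : IsUnit f) :
    ∃ μ, d⁄dX R f = f * μ := by
  obtain ⟨g, hg⟩ := hf.exists_right_inv
  exact ⟨g * d⁄dX R f, by rw [← mul_assoc, hg, one_mul]⟩

theorem derivative_map {R R' : Type*} [CommRing R] [CommRing R'] (φ : R →+* R') (f : R⟦X⟧) :
    d⁄dX R' (PowerSeries.map φ f) = PowerSeries.map φ (d⁄dX R f) := by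
  ext i
  simp [PowerSeries.coeff_derivative]

theorem X_pow_dvd_derivative {R : Type*} [CommRing R] {N : ℕ} {f : R⟦X⟧}
    (hf : PowerSeries.X ^ (N + 1) ∣ f) : PowerSeries.X ^ N ∣ d⁄dX R f := by
  rw [PowerSeries.X_pow_dvd_iff] at hf ⊢
  intro i hi
  rw [PowerSeries.coeff_derivative, hf _ (by omega), zero_mul]

/-- If `Q = W U` with `U` invertible and regular, the logarithmic derivatives of `Q` and `W` have
the same polar parts. -/
theorem logDeriv_sub_mem_of_isFactor {N : ℕ} {q w : S[X]⟦X⟧} (h : IsFactor N q w)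
    (hw : IsUnit (toLaurent S w)) {μ : (LaurentSeries S)⟦X⟧}
    (hμ : PowerSeries.X ^ N ∣ d⁄dX _ (toLaurent S q) - toLaurent S q * μ)
    {ν : (LaurentSeries S)⟦X⟧} (hν : d⁄dX _ (toLaurent S w) = toLaurent S w * ν) (i : ℕ)
    (hi : i < N) : PowerSeries.coeff i ν - PowerSeries.coeff i μ ∈ regularSubring S := by
  obtain ⟨u, hu, hd⟩ := h
  obtain ⟨η, hη⟩ := coeff_logDeriv_of_isUnit hu
  set φ := PowerSeries.map (HahnSeries.ofPowerSeries ℤ S)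
  have hq : PowerSeries.X ^ (N + 1) ∣ toLaurent S q - toLaurent S w * φ u := by
    have h1 := map_dvd φ hd
    have e : ∀ f : S[X]⟦X⟧,
        φ (PowerSeries.map Polynomial.coeToPowerSeries.ringHom f) = toLaurent S f := fun f => by
      ext1 i
      simp only [φ, PowerSeries.coeff_map]
      rfl
    rw [map_pow, PowerSeries.map_X, map_sub, map_mul, e, e] at h1
    exact h1
  have hu' : IsUnit (φ u) := hu.map φ
  have hη' : d⁄dX _ (φ u) = φ u * φ η := by
    rw [derivative_map, hη, map_mul]
  set Q := toLaurent S q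
  set W := toLaurent S w
  -- Differentiating `Q = W U`, at the cost of one power of `Y`, gives `μ = ν + η` up to the
  -- invertible factor `W U`, where `η` is the logarithmic derivative of `U` and has no poles.
  have h2 : PowerSeries.X ^ N ∣ (W * φ u) * (μ - ν - φ η) := by
    have h3 := X_pow_dvd_derivative hq
    have h4 : PowerSeries.X ^ N ∣ (Q - W * φ u) * μ :=
      Dvd.dvd.mul_right ((pow_dvd_pow _ (Nat.le_succ N)).trans hq) _
    have h5 := dvd_sub (dvd_sub h3 hμ) h4
    rw [map_sub, Derivation.leibniz, hν, hη', smul_eq_mul, smul_eq_mul] at h5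
    refine h5.trans (dvd_of_eq ?_)
    ring
  have h6 : PowerSeries.X ^ N ∣ μ - ν - φ η := by
    obtain ⟨g, hg⟩ := (hw.mul hu').exists_left_inv
    have := Dvd.dvd.mul_left h2 g
    rwa [← mul_assoc, hg, one_mul] at this
  have h7 := (PowerSeries.X_pow_dvd_iff.1 h6) i hi
  rw [map_sub, map_sub, sub_eq_zero] at h7
  rw [← neg_sub, h7]
  exact (regularSubring S).neg_mem ⟨_, (PowerSeries.coeff_map _ _ _).symm⟩

theorem IsMonicLift.isUnit_toLaurent {n : ℕ} {w : S[X]⟦X⟧} (hw : IsMonicLift n w) :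
    IsUnit (toLaurent S w) := by
  rw [PowerSeries.isUnit_iff_constantCoeff, ← PowerSeries.coeff_zero_eq_constantCoeff_apply,
    PowerSeries.coeff_map, hw.1]
  exact IsUnit.of_mul_eq_one_right _ (single_mul_polyLaurent_X_pow n)

/-- Dividing by the constant `X ^ n` does not change the logarithmic derivative, and makes `w` equal
to `1` plus terms with coefficients of degree less than `n` over `X ^ n`. These are polar, and polar
series are closed under multiplication. -/
theorem IsMonicLift.logDeriv_mem_polar {n : ℕ} {w : S[X]⟦X⟧} (hw : IsMonicLift n w)
    {ν : (LaurentSeries S)⟦X⟧} (hν : d⁄dX _ (toLaurent S w) = toLaurent S w * ν) (i : ℕ) :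
    PowerSeries.coeff i ν ∈ polarSubring S := by
  set a : LaurentSeries S := HahnSeries.single (-(n : ℤ)) 1
  have ha : a * polyLaurent S (Polynomial.X ^ n) = 1 := single_mul_polyLaurent_X_pow n
  refine coeff_logDeriv_mem (polarSubring S) (f := PowerSeries.C a * toLaurent S w) ?_ ?_ ?_ i
  · rw [PowerSeries.coeff_C_mul, PowerSeries.coeff_map, hw.1, ha]
  · intro i hi
    rw [PowerSeries.coeff_C_mul, PowerSeries.coeff_map, mul_comm]
    exact polyLaurent_mul_single_mem_polar (hw.2 i hi)
  · rw [Derivation.leibniz, PowerSeries.derivative_C, smul_zero, add_zero, hν, smul_eq_mul,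
      mul_assoc]

/-- Two series whose logarithmic derivatives have the same polar parts have the same Weierstrass
polynomial. -/
theorem coeff_eq_of_isFactor {k : Type*} [Field k] [Algebra k S] {n N : ℕ}
    (hN : ∀ r < N, ((r + 1 : ℕ) : k) ≠ 0) {q₁ q₂ w₁ w₂ : S[X]⟦X⟧}
    (hw₁ : IsMonicLift n w₁) (hw₂ : IsMonicLift n w₂)
    (h₁ : IsFactor N q₁ w₁) (h₂ : IsFactor N q₂ w₂) {μ₁ μ₂ : (LaurentSeries S)⟦X⟧}
    (hμ₁ : PowerSeries.X ^ N ∣ d⁄dX _ (toLaurent S q₁) - toLaurent S q₁ * μ₁)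
    (hμ₂ : PowerSeries.X ^ N ∣ d⁄dX _ (toLaurent S q₂) - toLaurent S q₂ * μ₂)
    (hμ : ∀ i < N, PowerSeries.coeff i μ₁ - PowerSeries.coeff i μ₂ ∈ regularSubring S)
    (i : ℕ) (hi : i ≤ N) : PowerSeries.coeff i w₁ = PowerSeries.coeff i w₂ := by
  obtain ⟨ν₁, hν₁⟩ := coeff_logDeriv_of_isUnit hw₁.isUnit_toLaurent
  obtain ⟨ν₂, hν₂⟩ := coeff_logDeriv_of_isUnit hw₂.isUnit_toLaurent
  apply polyLaurent_injective
  rw [← PowerSeries.coeff_map, ← PowerSeries.coeff_map]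
  refine coeff_eq_of_logDeriv N hN (f := toLaurent S w₁) (g := toLaurent S w₂) (μ := ν₁)
    (ν := ν₂) ?_ (by rw [hν₁, sub_self]; exact dvd_zero _)
    (by rw [hν₂, sub_self]; exact dvd_zero _) (fun j hj => ?_) i hi
  · rw [PowerSeries.coeff_map, PowerSeries.coeff_map, hw₁.1, hw₂.1]
  · rw [← sub_eq_zero]
    -- Both logarithmic derivatives are polar, and by hypothesis they differ by something regular,
    -- so they coincide.
    refine eq_zero_of_regular_of_polar ?_ ((polarSubring S).sub_mem
      (hw₁.logDeriv_mem_polar hν₁ j) (hw₂.logDeriv_mem_polar hν₂ j))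
    have e1 := logDeriv_sub_mem_of_isFactor h₁ hw₁.isUnit_toLaurent hμ₁ hν₁ j hj
    have e2 := logDeriv_sub_mem_of_isFactor h₂ hw₂.isUnit_toLaurent hμ₂ hν₂ j hj
    have e3 := (regularSubring S).add_mem ((regularSubring S).sub_mem e1 e2) (hμ j hj)
    convert e3 using 1
    ring

/-! ### The determinant of a perturbed diagonal matrix -/

/-- Taking the diagonal out of the rows leaves `det (1 + A)`; the factor taken out does not involve
`Y` and drops out of the logarithmic derivative. -/
theorem logDeriv_det_diagonal_add {k : Type*} [Field k] [Algebra k S] {ι : Type*} [Fintype ι]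
    [DecidableEq ι] (N : ℕ) (hN : ∀ r < N, ((r + 1 : ℕ) : k) ≠ 0) (Λ : ι → S[X])
    (T : Matrix ι ι S[X]⟦X⟧) (hT : ∀ i j, PowerSeries.X ∣ T i j) (v : ι → LaurentSeries S)
    (hv : ∀ i, v i * polyLaurent S (Λ i) = 1) :
    PowerSeries.X ^ N ∣
      d⁄dX _ (toLaurent S (Matrix.diagonal (fun i => PowerSeries.C (Λ i)) + T).det) -
      toLaurent S (Matrix.diagonal (fun i => PowerSeries.C (Λ i)) + T).det *
        d⁄dX _ (traceLog k N (Matrix.of fun i j => PowerSeries.C (v i) * toLaurent S (T i j))) := by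
  set A := Matrix.of fun i j => PowerSeries.C (v i) * toLaurent S (T i j) with hA
  set s := PowerSeries.C (∏ i, polyLaurent S (Λ i))
  have hdet : toLaurent S (Matrix.diagonal (fun i => PowerSeries.C (Λ i)) + T).det =
      s * (1 + A).det := by
    have : (Matrix.diagonal (fun i => PowerSeries.C (Λ i)) + T).map (toLaurent S) =
        Matrix.diagonal (fun i => PowerSeries.C (polyLaurent S (Λ i))) * (1 + A) := by
      ext1 i j
      rw [Matrix.diagonal_mul, Matrix.map_apply, Matrix.add_apply, Matrix.add_apply, mul_add, hA,
        Matrix.of_apply, ← mul_assoc, ← map_mul, mul_comm _ (v i), hv, map_one, one_mul, map_add]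
      congr 1
      by_cases h : i = j
      · subst h; simp
      · simp [h]
    rw [RingHom.map_det, RingHom.mapMatrix_apply, this, Matrix.det_mul, Matrix.det_diagonal,
      ← map_prod]
  have hX : ∀ i j, PowerSeries.X ∣ A i j := by
    intro i j
    refine Dvd.dvd.mul_left ?_ _
    have := map_dvd (toLaurent S) (hT i j)
    rwa [PowerSeries.map_X] at this
  have h1 := Dvd.dvd.mul_left (derivative_det_one_add N hN A hX) s
  rw [hdet, Derivation.leibniz, PowerSeries.derivative_C, smul_zero, add_zero, smul_eq_mul]
  convert h1 using 1
  ring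

end Laurent

/-! ### Determinants over windows of integers -/

section Window

variable {k S : Type*} [Field k] [CommRing S] [Algebra k S] {n : ℕ}

/-- The polynomial `∏ (X - l_k)`. -/
def indicial (S : Type*) [CommRing S] {n : ℕ} (l : Fin n → ℤ) : S[X] :=
  ∏ i, (Polynomial.X - Polynomial.C (l i : S))

theorem indicial_comp (l : Fin n → ℤ) (a : k) :
    (indicial S l).comp (Polynomial.X + Polynomial.C (algebraMap k S a)) =
      ∏ i, (Polynomial.X + Polynomial.C (algebraMap k S (a - l i))) := by
  rw [indicial, Polynomial.prod_comp]
  refine Finset.prod_congr rfl fun i _ => ?_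
  rw [Polynomial.sub_comp, Polynomial.X_comp, Polynomial.C_comp, map_sub, map_sub]
  simp only [map_intCast]
  ring

/-- The factor `X + a - l_i` has an inverse without pole unless `a = l_i`. So only rows at positions
equal to an exponent in `k` can produce poles. -/
theorem exists_inv_indicial (l : Fin n → ℤ) (a : k) : ∃ v : LaurentSeries S,
    v * polyLaurent S ((indicial S l).comp (Polynomial.X + Polynomial.C (algebraMap k S a))) = 1 ∧
      ((∀ i, a ≠ l i) → v ∈ regularSubring S) := by
  have h : ∀ i, ∃ v : LaurentSeries S,
      v * polyLaurent S (Polynomial.X + Polynomial.C (algebraMap k S (a - l i))) = 1 ∧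
        (a ≠ l i → v ∈ regularSubring S) := by
    intro i
    obtain ⟨h1, h2⟩ := isUnit_polyLaurent_X_add_C (S := S) (a - (l i : k))
    by_cases ha : a = l i
    · obtain ⟨v, hv⟩ := h1.exists_left_inv
      exact ⟨v, hv, fun h => absurd ha h⟩
    · obtain ⟨u, hu⟩ := h2 (sub_ne_zero.2 ha)
      exact ⟨_, hu, fun _ => ⟨u, rfl⟩⟩
  choose v hv hv' using h
  refine ⟨∏ i, v i, ?_, fun ha => (regularSubring S).prod_mem fun i _ => hv' i (ha i)⟩
  rw [indicial_comp, map_prod, ← Finset.prod_mul_distrib]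
  exact Finset.prod_eq_one fun i _ => hv i

/-- The inverse of `∏ (X + a - l_k)` as a Laurent series. -/
def indicialInv (S : Type*) [CommRing S] [Algebra k S] (l : Fin n → ℤ) (a : k) : LaurentSeries S :=
  Classical.choose (exists_inv_indicial (S := S) l a)

theorem indicialInv_mul (l : Fin n → ℤ) (a : k) : indicialInv S l a *
    polyLaurent S ((indicial S l).comp (Polynomial.X + Polynomial.C (algebraMap k S a))) = 1 :=
  (Classical.choose_spec (exists_inv_indicial (S := S) l a)).1

theorem indicialInv_mem (l : Fin n → ℤ) (a : k) (ha : ∀ i, a ≠ l i) :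
    indicialInv S l a ∈ regularSubring S :=
  (Classical.choose_spec (exists_inv_indicial (S := S) l a)).2 ha

/-- The diagonal matrix with entries `∏ (X + a_i - l_k)`, perturbed by `T`. -/
def diagPert {ι : Type*} [DecidableEq ι] (l : Fin n → ℤ) (a : ι → k) (T : Matrix ι ι S[X]⟦X⟧) :
    Matrix ι ι S[X]⟦X⟧ :=
  Matrix.diagonal (fun i => PowerSeries.C
    ((indicial S l).comp (Polynomial.X + Polynomial.C (algebraMap k S (a i))))) + T

/-- The matrix `T` with rows divided by the diagonal of `diagPert l a 0`. -/
def scaledPert {ι : Type*} (l : Fin n → ℤ) (a : ι → k) (T : Matrix ι ι S[X]⟦X⟧) :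
    Matrix ι ι (LaurentSeries S)⟦X⟧ :=
  Matrix.of fun i j => PowerSeries.C (indicialInv S l (a i)) * toLaurent S (T i j)

theorem coeff_scaledPert {ι : Type*} (l : Fin n → ℤ) (a : ι → k) (T : Matrix ι ι S[X]⟦X⟧)
    (i j : ι) (κ : ℕ) : PowerSeries.coeff κ (scaledPert l a T i j) =
      indicialInv S l (a i) * polyLaurent S (PowerSeries.coeff κ (T i j)) := by
  rw [scaledPert, Matrix.of_apply, PowerSeries.coeff_C_mul, PowerSeries.coeff_map]

theorem logDeriv_det_diagPert {ι : Type*} [Fintype ι] [DecidableEq ι] (N : ℕ)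
    (hN : ∀ r < N, ((r + 1 : ℕ) : k) ≠ 0) (l : Fin n → ℤ) (a : ι → k)
    (T : Matrix ι ι S[X]⟦X⟧) (hT : ∀ i j, PowerSeries.X ∣ T i j) :
    PowerSeries.X ^ N ∣ d⁄dX _ (toLaurent S (diagPert l a T).det) -
      toLaurent S (diagPert l a T).det * d⁄dX _ (traceLog k N (scaledPert l a T)) :=
  logDeriv_det_diagonal_add N hN _ T hT _ fun i => indicialInv_mul l (a i)

theorem isBanded_scaledPert {ι : Type*} [Fintype ι] [DecidableEq ι] (l : Fin n → ℤ) (a : ι → k)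
    (T : Matrix ι ι S[X]⟦X⟧) {b c : ℕ} {ν : ι → ℕ}
    (hT : ∀ i j κ, PowerSeries.coeff κ (T i j) ≠ 0 → ν i ≤ ν j + b * κ ∧ ν j ≤ ν i + b * κ)
    (ha : ∀ i, c < ν i → ∀ q, a i ≠ l q) :
    IsBanded (regularSubring S) b c ν (scaledPert l a T) := by
  have h : ∀ i j κ, PowerSeries.coeff κ (scaledPert l a T i j) ≠ 0 →
      PowerSeries.coeff κ (T i j) ≠ 0 := by
    intro i j κ h h0
    rw [coeff_scaledPert, h0, map_zero, mul_zero] at h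
    exact h rfl
  refine ⟨fun i j κ h' => (hT i j κ (h i j κ h')).1, fun i j κ h' => (hT i j κ (h i j κ h')).2,
    fun i j κ hi => ?_⟩
  rw [coeff_scaledPert]
  exact (regularSubring S).mul_mem (indicialInv_mem l _ (ha i hi)) (polyLaurent_mem_regular _)

theorem algebraMap_mem_regular (s : k) : algebraMap k (LaurentSeries S) s ∈ regularSubring S :=
  ⟨algebraMap k S⟦X⟧ s, rfl⟩

/-- The weight of a shift by `d`. -/
def shiftWeight (m : ℕ) (d : ℤ) : ℕ := if 0 < d then d.toNat else (d + m + 1).toNat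

/-- The weighted off-diagonal entry for the shift `d`, at the position `a`. -/
def pertEntry (m : ℕ) (τ : ℤ → S[X]) (d : ℤ) (a : S) : S[X]⟦X⟧ :=
  PowerSeries.X ^ shiftWeight m d * PowerSeries.C ((τ d).comp (Polynomial.X + Polynomial.C a))

theorem X_dvd_pertEntry {m : ℕ} {τ : ℤ → S[X]} (hτ : ∀ d < -(m : ℤ), τ d = 0) (d : ℤ) (a : S) :
    PowerSeries.X ∣ pertEntry m τ d a := by
  by_cases hd : d < -(m : ℤ)
  · simp [pertEntry, hτ d hd]
  · refine Dvd.dvd.mul_right (dvd_pow_self _ ?_) _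
    rw [shiftWeight]
    split_ifs <;> omega

theorem coeff_pertEntry (m : ℕ) (τ : ℤ → S[X]) (d : ℤ) (a : S) (κ : ℕ) :
    PowerSeries.coeff κ (pertEntry m τ d a) =
      if κ = shiftWeight m d then (τ d).comp (Polynomial.X + Polynomial.C a) else 0 := by
  rw [pertEntry, PowerSeries.coeff_mul_C, PowerSeries.coeff_X_pow]
  split_ifs <;> simp

/-- A shift by `d > 0` has weight `d`; a shift with `-m ≤ d ≤ 0` has weight at least `1` and length
at most `m`. This is the bandwidth `b = m + 1` used for the locality of traces. -/
theorem abs_le_of_coeff_pertEntry_ne_zero {m : ℕ} {τ : ℤ → S[X]}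
    (hτ : ∀ d < -(m : ℤ), τ d = 0) {d : ℤ} {a : S} {κ : ℕ}
    (h : PowerSeries.coeff κ (pertEntry m τ d a) ≠ 0) : d.natAbs ≤ (m + 1) * κ := by
  rw [coeff_pertEntry] at h
  split_ifs at h with h1
  · have hd : ¬ d < -(m : ℤ) := by
      intro hd
      rw [hτ d hd, Polynomial.zero_comp] at h
      exact h rfl
    rw [shiftWeight] at h1
    split_ifs at h1 with h2
    · have : κ ≤ (m + 1) * κ := Nat.le_mul_of_pos_left κ (by omega)
      omega
    · have : (m + 1) * 1 ≤ (m + 1) * κ := Nat.mul_le_mul_left _ (by omega)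
      omega
  · exact absurd rfl h

/-- The off-diagonal part of the matrix over a window of integers. -/
def windowPert (m : ℕ) (τ : ℤ → S[X]) (M N : ℕ) :
    Matrix (Finset.Icc (-(M : ℤ)) (N : ℤ)) (Finset.Icc (-(M : ℤ)) (N : ℤ)) S[X]⟦X⟧ :=
  Matrix.of fun i j => pertEntry m τ ((i : ℤ) - j) ((j : ℤ) : S)

/-- The weighted determinant over a window of integers. -/
def windowDet (k : Type*) [Field k] [Algebra k S] (m : ℕ) (l : Fin n → ℤ) (τ : ℤ → S[X])
    (M N : ℕ) : S[X]⟦X⟧ :=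
  (diagPert l (fun i : Finset.Icc (-(M : ℤ)) (N : ℤ) => ((i : ℤ) : k)) (windowPert m τ M N)).det

theorem windowPert_bound {m : ℕ} {τ : ℤ → S[X]} (hτ : ∀ d < -(m : ℤ), τ d = 0) {M N : ℕ}
    (i j : Finset.Icc (-(M : ℤ)) (N : ℤ)) (κ : ℕ)
    (h : PowerSeries.coeff κ (windowPert m τ M N i j) ≠ 0) :
    (i : ℤ).natAbs ≤ (j : ℤ).natAbs + (m + 1) * κ ∧
      (j : ℤ).natAbs ≤ (i : ℤ).natAbs + (m + 1) * κ := by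
  have := abs_le_of_coeff_pertEntry_ne_zero hτ h
  omega

/-- The logarithmic derivatives of a perturbed determinant and of the determinant over a central
window have the same polar parts. -/
theorem coeff_traceLog_window_sub_mem {ι : Type*} [Fintype ι] [DecidableEq ι] (l : Fin n → ℤ)
    (a : ι → k) (T : Matrix ι ι S[X]⟦X⟧) {m c J N : ℕ} {τ : ℤ → S[X]}
    (hτ : ∀ d < -(m : ℤ), τ d = 0) {ν : ι → ℕ}
    (hT : ∀ i j κ, PowerSeries.coeff κ (T i j) ≠ 0 →
      ν i ≤ ν j + (m + 1) * κ ∧ ν j ≤ ν i + (m + 1) * κ)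
    (ha : ∀ i, c < ν i → ∀ q, a i ≠ l q)
    {f : Finset.Icc (-(J : ℤ)) (J : ℤ) → ι} (hf : Function.Injective f)
    (hν : ∀ i, ν (f i) = (i : ℤ).natAbs) (hfa : ∀ i, a (f i) = ((i : ℤ) : k))
    (hJ : ∀ i, ν i ≤ J → i ∈ Set.range f)
    (h : ∀ i j κ, κ ≤ N → PowerSeries.coeff κ (T (f i) (f j)) =
      PowerSeries.coeff κ (windowPert m τ J J i j))
    (hJN : c + 2 * ((m + 1) * N) ≤ J) (κ : ℕ) (hκ : κ < N) :
    PowerSeries.coeff κ (d⁄dX _ (traceLog k N (scaledPert l a T))) -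
      PowerSeries.coeff κ (d⁄dX _ (traceLog k N (scaledPert l
        (fun i : Finset.Icc (-(J : ℤ)) (J : ℤ) => ((i : ℤ) : k)) (windowPert m τ J J)))) ∈
      regularSubring S := by
  refine coeff_traceLog_sub_mem algebraMap_mem_regular (b := m + 1) (c := c) (ν := ν) (J := J)
    (isBanded_scaledPert l a T hT ha) ?_ hf hJ (fun i j κ hκ => ?_) hJN κ hκ
  · have : ν ∘ f = fun i : Finset.Icc (-(J : ℤ)) (J : ℤ) => (i : ℤ).natAbs := funext hν
    rw [this]
    refine isBanded_scaledPert l _ _ (windowPert_bound hτ) fun i hi q => ?_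
    rw [← hfa]
    exact ha (f i) (by rw [hν]; exact hi) q
  · rw [coeff_scaledPert, coeff_scaledPert, h i j κ hκ, hfa]

/-- The Weierstrass polynomial of the determinant over a large window does not depend on the
window. -/
theorem coeff_eq_of_isFactor_windowDet {m c J M M' N : ℕ} (l : Fin n → ℤ) {τ : ℤ → S[X]}
    (hN : ∀ r < N, ((r + 1 : ℕ) : k) ≠ 0)
    (hτ : ∀ d < -(m : ℤ), τ d = 0) (hJN : c + 2 * ((m + 1) * N) ≤ J) (hM : J ≤ M) (hM' : J ≤ M')
    (hc : ∀ i : ℤ, -(M : ℤ) ≤ i → i ≤ M' → c < i.natAbs → ∀ q, (i : k) ≠ l q)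
    {w₁ w₂ : S[X]⟦X⟧} (hw₁ : IsMonicLift n w₁) (hw₂ : IsMonicLift n w₂)
    (h₁ : IsFactor N (windowDet k m l τ M M') w₁) (h₂ : IsFactor N (windowDet k m l τ J J) w₂)
    (κ : ℕ) (hκ : κ ≤ N) : PowerSeries.coeff κ w₁ = PowerSeries.coeff κ w₂ := by
  refine coeff_eq_of_isFactor hN hw₁ hw₂ h₁ h₂
    (logDeriv_det_diagPert N hN l _ _ fun i j => X_dvd_pertEntry hτ _ _)
    (logDeriv_det_diagPert N hN l _ _ fun i j => X_dvd_pertEntry hτ _ _) (fun i hi => ?_) κ hκ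
  set f : Finset.Icc (-(J : ℤ)) (J : ℤ) → Finset.Icc (-(M : ℤ)) (M' : ℤ) := fun i => ⟨i, by
    have := Finset.mem_Icc.1 i.2
    exact Finset.mem_Icc.2 ⟨by omega, by omega⟩⟩ with hf
  have hfi : Function.Injective f := fun i j h => Subtype.ext (Subtype.mk.inj h)
  refine coeff_traceLog_window_sub_mem l (fun i : Finset.Icc (-(M : ℤ)) (M' : ℤ) => ((i : ℤ) : k))
    (windowPert m τ M M') (ν := fun i => (i : ℤ).natAbs) hτ (windowPert_bound hτ) (c := c)
    (fun i hi => hc i (Finset.mem_Icc.1 i.2).1 (Finset.mem_Icc.1 i.2).2 hi) hfi (fun i => rfl)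
    (fun i => rfl) (fun i hi => ⟨⟨i, Finset.mem_Icc.2 ⟨by omega, by omega⟩⟩, rfl⟩)
    (fun i j κ _ => rfl) hJN i hi

end Window

/-! ### Periodic rational functions in characteristic `p` -/

section Periodic

variable {p : ℕ} [Fact p.Prime] {S : Type*} [CommRing S] [Algebra (ZMod p) S]

/-- The substitution `X ↦ X + a`. -/
abbrev shiftHom (a : S) : S[X] →+* S[X] := Polynomial.compRingHom (Polynomial.X + Polynomial.C a)

theorem shiftHom_shiftHom (a b : S) (f : S[X]) : shiftHom a (shiftHom b f) = shiftHom (b + a) f := by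
  simp only [shiftHom, Polynomial.coe_compRingHom_apply, Polynomial.comp_assoc]
  congr 1
  simp only [Polynomial.add_comp, Polynomial.X_comp, Polynomial.C_comp, map_add]
  ring

theorem shiftHom_X (a : S) : shiftHom a Polynomial.X = Polynomial.X + Polynomial.C a := by
  simp

theorem shiftHom_C (a b : S) : shiftHom a (Polynomial.C b) = Polynomial.C b := by
  simp

theorem degree_shiftHom_le (a : S) (f : S[X]) : (shiftHom a f).degree ≤ f.degree := by
  by_cases hf : f = 0
  · simp [hf]
  have h1 : (shiftHom a f).natDegree ≤ f.natDegree := by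
    rw [shiftHom, Polynomial.coe_compRingHom_apply]
    refine Polynomial.natDegree_comp_le.trans ?_
    have : (Polynomial.X + Polynomial.C a).natDegree ≤ 1 := by compute_degree
    nlinarith
  rw [Polynomial.degree_eq_natDegree hf]
  exact Polynomial.degree_le_of_natDegree_le h1

variable (p S) in
/-- The polynomial `X ^ p - X`, as a product of linear factors. -/
def artinSchreier : S[X] := ∏ j : ZMod p, (Polynomial.X + Polynomial.C (algebraMap (ZMod p) S j))

theorem artinSchreier_monic : (artinSchreier p S).Monic :=
  Polynomial.monic_prod_of_monic _ _ fun _ _ => Polynomial.monic_X_add_C _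

theorem artinSchreier_natDegree [Nontrivial S] : (artinSchreier p S).natDegree = p := by
  rw [artinSchreier, Polynomial.natDegree_prod_of_monic _ _ fun _ _ => Polynomial.monic_X_add_C _]
  simp

theorem artinSchreier_pow_degree [Nontrivial S] (L : ℕ) :
    (artinSchreier p S ^ L).degree = (p * L : ℕ) := by
  rw [Polynomial.degree_eq_natDegree (artinSchreier_monic.pow L).ne_zero,
    artinSchreier_monic.natDegree_pow, artinSchreier_natDegree, mul_comm]

theorem shiftHom_artinSchreier (a : ZMod p) :
    shiftHom (algebraMap (ZMod p) S a) (artinSchreier p S) = artinSchreier p S := by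
  rw [artinSchreier, map_prod]
  refine Fintype.prod_equiv (Equiv.addLeft a) _ _ fun j => ?_
  rw [map_add, shiftHom_X, shiftHom_C, Equiv.coe_addLeft, map_add, map_add, add_assoc]

theorem X_dvd_artinSchreier : Polynomial.X ∣ artinSchreier p S := by
  have := Finset.dvd_prod_of_mem
    (fun j : ZMod p => Polynomial.X + Polynomial.C (algebraMap (ZMod p) S j)) (Finset.mem_univ 0)
  rwa [map_zero, map_zero, add_zero] at this

theorem isUnit_polyLaurent_artinSchreier : IsUnit (polyLaurent S (artinSchreier p S)) := by
  rw [artinSchreier, map_prod]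
  exact IsUnit.prod_univ_iff.2 fun j => (isUnit_polyLaurent_X_add_C j).1

theorem shiftHom_of_periodic {H : S[X]} (hH : shiftHom 1 H = H) (a : ZMod p) :
    shiftHom (algebraMap (ZMod p) S a) H = H := by
  have h : ∀ i : ℕ, shiftHom (i : S) H = H := by
    intro i
    induction i with
    | zero => simp
    | succ i ih => rw [Nat.cast_succ, ← shiftHom_shiftHom, ih, hH]
  rw [← ZMod.natCast_zmod_val a, map_natCast]
  exact h _

theorem degree_mul_lt {f g : S[X]} {a b : ℕ} (hf : f.degree < a) (hg : g.degree ≤ b) :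
    (f * g).degree < (a + b : ℕ) := by
  refine (Polynomial.degree_mul_le f g).trans_lt ?_
  refine (add_le_add_right hg _).trans_lt ?_
  rw [Nat.cast_add]
  exact WithBot.add_lt_add_right (WithBot.coe_ne_bot) hf

variable (p S) in
/-- The quotients `H / (X ^ p - X) ^ L` for periodic polynomials `H` of degree less than `p L`. -/
def periodicSubring [Nontrivial S] : NonUnitalSubring (LaurentSeries S) where
  -- The strict degree bound means vanishing at infinity. It excludes nonzero constants, which is
  -- why this subring is non-unital.
  carrier := {z | ∃ (L : ℕ) (H : S[X]), shiftHom 1 H = H ∧ H.degree < (p * L : ℕ) ∧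
    z * polyLaurent S (artinSchreier p S) ^ L = polyLaurent S H}
  zero_mem' := ⟨0, 0, by simp, by simp, by simp⟩
  add_mem' {a b} ha hb := by
    obtain ⟨L, H, h1, h2, h3⟩ := ha
    obtain ⟨L', H', h1', h2', h3'⟩ := hb
    have hD := shiftHom_artinSchreier (S := S) (1 : ZMod p)
    rw [map_one] at hD
    refine ⟨L + L', H * artinSchreier p S ^ L' + H' * artinSchreier p S ^ L, ?_, ?_, ?_⟩
    · rw [map_add, map_mul, map_mul, map_pow, map_pow, h1, h1', hD]
    · refine (Polynomial.degree_add_le _ _).trans_lt (max_lt ?_ ?_)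
      · have := degree_mul_lt h2 (artinSchreier_pow_degree (S := S) (p := p) L').le
        rwa [← mul_add] at this
      · have := degree_mul_lt h2' (artinSchreier_pow_degree (S := S) (p := p) L).le
        rwa [← mul_add, add_comm L'] at this
    · rw [map_add, map_mul, map_mul, ← h3, ← h3', map_pow, map_pow]
      ring
  neg_mem' {a} ha := by
    obtain ⟨L, H, h1, h2, h3⟩ := ha
    exact ⟨L, -H, by rw [map_neg, h1], by rwa [Polynomial.degree_neg], by rw [map_neg, ← h3]; ring⟩
  mul_mem' {a b} ha hb := by
    obtain ⟨L, H, h1, h2, h3⟩ := ha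
    obtain ⟨L', H', h1', h2', h3'⟩ := hb
    refine ⟨L + L', H * H', by rw [map_mul, h1, h1'], ?_, ?_⟩
    · have := degree_mul_lt h2 h2'.le
      rwa [← mul_add] at this
    · rw [map_mul, ← h3, ← h3']
      ring

/-- Regularity at `0` makes `X ^ L` divide the numerator; by periodicity every `(X + j) ^ L` divides
it too. These factors are pairwise coprime, so the monic polynomial `(X ^ p - X) ^ L` divides a
polynomial of smaller degree. -/
theorem eq_zero_of_regular_of_periodic [Nontrivial S] {z : LaurentSeries S}
    (hz : z ∈ regularSubring S) (hz' : z ∈ periodicSubring p S) : z = 0 := by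
  obtain ⟨L, H, h1, h2, h3⟩ := hz'
  obtain ⟨u, rfl⟩ := hz
  have h4 : (H : S⟦X⟧) = u * (artinSchreier p S : S⟦X⟧) ^ L := by
    apply HahnSeries.ofPowerSeries_injective (Γ := ℤ)
    rw [map_mul, map_pow]
    exact h3.symm
  have h5 : Polynomial.X ^ L ∣ H := by
    rw [Polynomial.X_pow_dvd_iff]
    intro i hi
    rw [← Polynomial.coeff_coe]
    refine PowerSeries.X_pow_dvd_iff.1 ?_ i hi
    rw [h4]
    refine Dvd.dvd.mul_left (pow_dvd_pow_of_dvd ?_ L) _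
    have := map_dvd Polynomial.coeToPowerSeries.ringHom (X_dvd_artinSchreier (p := p) (S := S))
    simpa using this
  have h6 : artinSchreier p S ^ L ∣ H := by
    rw [artinSchreier, ← Finset.prod_pow]
    refine Finset.prod_dvd_of_coprime (fun i _ j _ hij => IsCoprime.pow ?_) fun j _ => ?_
    · have hu : IsUnit (algebraMap (ZMod p) S (-i) - algebraMap (ZMod p) S (-j)) := by
        rw [← map_sub]
        refine (IsUnit.mk0 _ ?_).map _
        rw [sub_ne_zero]
        exact fun h => hij (neg_injective h)
      have := Polynomial.isCoprime_X_sub_C_of_isUnit_sub hu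
      simpa using this
    · have := map_dvd (shiftHom (algebraMap (ZMod p) S j)) h5
      rwa [shiftHom_of_periodic h1, map_pow, shiftHom_X] at this
  have h7 : H = 0 := by
    by_contra hH
    refine (artinSchreier_monic.pow L).not_dvd_of_degree_lt hH ?_ h6
    rw [artinSchreier_pow_degree]
    exact h2
  rw [h7, map_zero] at h3
  exact (isUnit_polyLaurent_artinSchreier.pow L).mul_left_eq_zero.1 h3

/-- By the binomial formula this reduces to the vanishing of the power sums over `ZMod p` with
exponents below `p - 1`. -/
theorem sum_shiftHom_eq_zero {f : S[X]} (hf : f.natDegree < p - 1) :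
    ∑ j : ZMod p, shiftHom (algebraMap (ZMod p) S j) f = 0 := by
  have h : ∀ i < p - 1, ∑ j : ZMod p, shiftHom (algebraMap (ZMod p) S j) (Polynomial.X ^ i) = 0 := by
    intro i hi
    simp only [map_pow, shiftHom_X, add_pow]
    rw [Finset.sum_comm]
    refine Finset.sum_eq_zero fun b _ => ?_
    rw [← Finset.sum_mul, ← Finset.mul_sum]
    have : ∑ j : ZMod p, Polynomial.C (algebraMap (ZMod p) S j) ^ (i - b) = 0 := by
      have h0 := FiniteField.sum_pow_lt_card_sub_one (ZMod p) (i - b)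
        (by rw [ZMod.card]; omega)
      simp only [← map_pow]
      rw [← map_sum, ← map_sum, h0, map_zero, map_zero]
    rw [this, mul_zero, zero_mul]
  conv_lhs =>
    enter [2, j]
    rw [f.as_sum_range_C_mul_X_pow, map_sum]
  rw [Finset.sum_comm]
  refine Finset.sum_eq_zero fun i hi => ?_
  simp only [map_mul, shiftHom_C]
  rw [← Finset.mul_sum, h i (by have := Finset.mem_range.1 hi; omega), mul_zero]

/-- The sum of the translates of a polynomial has degree less than expected. -/
theorem degree_sum_shiftHom_lt [Nontrivial S] {f : S[X]} {L : ℕ}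
    (hf : f.natDegree < p * L + (p - 1)) :
    (∑ j : ZMod p, shiftHom (algebraMap (ZMod p) S j) f).degree < (p * L : ℕ) := by
  have hm := (artinSchreier_monic (p := p) (S := S)).pow L
  set D := artinSchreier p S ^ L with hD
  -- Since `D` is translation invariant, the quotient of `f` by `D` can be summed separately. Its
  -- degree is below `p - 1`, so its translates cancel and only the remainder is left.
  have h1 : ∑ j : ZMod p, shiftHom (algebraMap (ZMod p) S j) f =
      ∑ j : ZMod p, shiftHom (algebraMap (ZMod p) S j) (f %ₘ D) := by
    have h2 : ∀ j : ZMod p, shiftHom (algebraMap (ZMod p) S j) f =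
        shiftHom (algebraMap (ZMod p) S j) (f %ₘ D) +
          D * shiftHom (algebraMap (ZMod p) S j) (f /ₘ D) := by
      intro j
      conv_lhs => rw [← Polynomial.modByMonic_add_div f D]
      rw [map_add, map_mul, hD, map_pow, shiftHom_artinSchreier]
    simp only [h2]
    rw [Finset.sum_add_distrib, ← Finset.mul_sum, sum_shiftHom_eq_zero (f := f /ₘ D),
      mul_zero, add_zero]
    rw [Polynomial.natDegree_divByMonic _ hm, hD, artinSchreier_monic.natDegree_pow,
      artinSchreier_natDegree]
    have : 0 < p - 1 := by have := (Fact.out : p.Prime).two_le; omega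
    rw [mul_comm L]
    omega
  rw [h1]
  refine (Polynomial.degree_sum_le _ _).trans_lt ?_
  rw [Finset.sup_lt_iff (WithBot.bot_lt_coe _)]
  intro j _
  refine (degree_shiftHom_le _ _).trans_lt ?_
  rw [← artinSchreier_pow_degree (S := S) (p := p) L]
  exact Polynomial.degree_modByMonic_lt _ hm

theorem shiftHom_sum_shiftHom (f : S[X]) :
    shiftHom 1 (∑ j : ZMod p, shiftHom (algebraMap (ZMod p) S j) f) =
      ∑ j : ZMod p, shiftHom (algebraMap (ZMod p) S j) f := by
  rw [map_sum]
  refine Fintype.sum_equiv (Equiv.addRight 1) _ _ fun j => ?_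
  rw [shiftHom_shiftHom, Equiv.coe_addRight, map_add, map_one]

end Periodic

/-! ### The determinant of the periodic matrix -/

section Cyclic

variable {p : ℕ} [Fact p.Prime] {S : Type*} [CommRing S] [Algebra (ZMod p) S] {n : ℕ}

/-- The substitution `X ↦ X + a` on `S[X]⟦Y⟧`. -/
abbrev shiftSeries (a : S) : S[X]⟦X⟧ →+* S[X]⟦X⟧ := PowerSeries.map (shiftHom a)

/-- The off-diagonal part of the periodic matrix. -/
def cyclicPert (p : ℕ) [Algebra (ZMod p) S] (m : ℕ) (τ : ℤ → S[X]) :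
    Matrix (ZMod p) (ZMod p) S[X]⟦X⟧ :=
  Matrix.of fun i j => ∑ d ∈ (Finset.Icc (-(m : ℤ)) ((p : ℤ) - 1)).filter
    (fun d : ℤ => (d : ZMod p) = i - j),
    pertEntry m τ d (algebraMap (ZMod p) S j)

/-- The determinant of the periodic matrix. -/
def cyclicDet (p : ℕ) [Fact p.Prime] [Algebra (ZMod p) S] (m : ℕ) (l : Fin n → ℤ) (τ : ℤ → S[X]) :
    S[X]⟦X⟧ :=
  (diagPert l (fun i : ZMod p => i) (cyclicPert p m τ)).det

theorem shiftSeries_pertEntry (m : ℕ) (τ : ℤ → S[X]) (d : ℤ) (a b : S) :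
    shiftSeries b (pertEntry m τ d a) = pertEntry m τ d (a + b) := by
  rw [pertEntry, map_mul, map_pow, PowerSeries.map_X, PowerSeries.map_C]
  have := shiftHom_shiftHom b a (τ d)
  simp only [shiftHom, Polynomial.coe_compRingHom_apply] at this ⊢
  rw [this, pertEntry]

theorem shiftSeries_cyclicPert (m : ℕ) (τ : ℤ → S[X]) (i j s : ZMod p) :
    shiftSeries (algebraMap (ZMod p) S s) (cyclicPert p m τ i j) =
      cyclicPert p m τ (i + s) (j + s) := by
  simp only [cyclicPert, Matrix.of_apply, map_sum, shiftSeries_pertEntry, ← map_add,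
    add_sub_add_right_eq_sub]

theorem X_dvd_cyclicPert {m : ℕ} {τ : ℤ → S[X]} (hτ : ∀ d < -(m : ℤ), τ d = 0) (i j : ZMod p) :
    PowerSeries.X ∣ cyclicPert p m τ i j := by
  rw [cyclicPert, Matrix.of_apply]
  exact Finset.dvd_sum fun d _ => X_dvd_pertEntry hτ _ _

variable (p S) in
/-- The cofactor of `∏ (X - l_k)` in `(X ^ p - X) ^ n`. -/
def indicialCofactor (l : Fin n → ℤ) : S[X] :=
  ∏ q, ∏ j ∈ Finset.univ.erase (-(l q : ZMod p)),
    (Polynomial.X + Polynomial.C (algebraMap (ZMod p) S j))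

theorem indicialCofactor_mul (l : Fin n → ℤ) :
    indicialCofactor p S l * indicial S l = artinSchreier p S ^ n := by
  rw [indicialCofactor, indicial, ← Finset.prod_mul_distrib]
  have : ∀ q, (∏ j ∈ Finset.univ.erase (-(l q : ZMod p)),
      (Polynomial.X + Polynomial.C (algebraMap (ZMod p) S j))) *
        (Polynomial.X - Polynomial.C (l q : S)) = artinSchreier p S := by
    intro q
    rw [artinSchreier, ← Finset.prod_erase_mul _ _ (Finset.mem_univ (-(l q : ZMod p)))]
    congr 1
    rw [map_neg, map_neg, sub_eq_add_neg]
    simp only [map_intCast]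
  rw [Finset.prod_congr rfl fun q _ => this q]
  simp

theorem indicialCofactor_natDegree_le (l : Fin n → ℤ) :
    (indicialCofactor p S l).natDegree ≤ n * (p - 1) := by
  refine (Polynomial.natDegree_prod_le _ _).trans ?_
  refine (Finset.sum_le_card_nsmul _ _ (p - 1) fun q _ => ?_).trans (by simp)
  refine (Polynomial.natDegree_prod_le _ _).trans ?_
  refine (Finset.sum_le_card_nsmul _ _ 1 fun j _ => by compute_degree).trans ?_
  rw [Finset.card_erase_of_mem (Finset.mem_univ _), Finset.card_univ, ZMod.card]
  simp

/-- The off-diagonal part of the periodic matrix, with rows scaled to be polynomial. -/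
def cyclicScaled (p : ℕ) [Fact p.Prime] [Algebra (ZMod p) S] (m : ℕ) (l : Fin n → ℤ)
    (τ : ℤ → S[X]) : Matrix (ZMod p) (ZMod p) S[X]⟦X⟧ :=
  Matrix.of fun i j => PowerSeries.C (shiftHom (algebraMap (ZMod p) S i) (indicialCofactor p S l)) *
    cyclicPert p m τ i j

theorem shiftSeries_cyclicScaled (m : ℕ) (l : Fin n → ℤ) (τ : ℤ → S[X]) (i j s : ZMod p) :
    shiftSeries (algebraMap (ZMod p) S s) (cyclicScaled p m l τ i j) =
      cyclicScaled p m l τ (i + s) (j + s) := by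
  rw [cyclicScaled, Matrix.of_apply, Matrix.of_apply, map_mul, shiftSeries_cyclicPert,
    PowerSeries.map_C, shiftHom_shiftHom, map_add]

theorem shiftSeries_cyclicScaled_pow (m : ℕ) (l : Fin n → ℤ) (τ : ℤ → S[X]) (r : ℕ)
    (i j s : ZMod p) :
    shiftSeries (algebraMap (ZMod p) S s) ((cyclicScaled p m l τ ^ r) i j) =
      (cyclicScaled p m l τ ^ r) (i + s) (j + s) := by
  induction r generalizing i j with
  | zero =>
    rw [pow_zero, Matrix.one_apply, Matrix.one_apply]
    simp only [add_left_inj]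
    split_ifs <;> simp
  | succ r ih =>
    rw [pow_succ, Matrix.mul_apply, Matrix.mul_apply, map_sum]
    refine Fintype.sum_equiv (Equiv.addRight s) _ _ fun q => ?_
    rw [map_mul, ih, shiftSeries_cyclicScaled, Equiv.coe_addRight]

theorem polyLaurent_mul_indicialInv (l : Fin n → ℤ) (i : ZMod p) :
    polyLaurent S (artinSchreier p S ^ n) * indicialInv S l i =
      polyLaurent S (shiftHom (algebraMap (ZMod p) S i) (indicialCofactor p S l)) := by
  rw [← shiftHom_artinSchreier i, ← map_pow, ← indicialCofactor_mul l, map_mul, map_mul, mul_assoc,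
    mul_comm _ (indicialInv S l i)]
  rw [shiftHom, Polynomial.coe_compRingHom_apply, Polynomial.coe_compRingHom_apply,
    indicialInv_mul, mul_one]

theorem polyLaurent_mul_scaledPert_pow (m : ℕ) (l : Fin n → ℤ) (τ : ℤ → S[X]) (r : ℕ)
    (i j : ZMod p) :
    PowerSeries.C (polyLaurent S (artinSchreier p S ^ n)) ^ r *
      (scaledPert l (fun i : ZMod p => i) (cyclicPert p m τ) ^ r) i j =
      toLaurent S ((cyclicScaled p m l τ ^ r) i j) := by
  induction r generalizing i j with
  | zero =>
    rw [pow_zero, pow_zero, pow_zero, one_mul, Matrix.one_apply, Matrix.one_apply]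
    split_ifs <;> simp
  | succ r ih =>
    rw [pow_succ, pow_succ, pow_succ, Matrix.mul_apply, Matrix.mul_apply, map_sum, Finset.mul_sum]
    refine Finset.sum_congr rfl fun q _ => ?_
    rw [map_mul, ← ih, cyclicScaled, scaledPert, Matrix.of_apply, Matrix.of_apply, map_mul,
      PowerSeries.map_C, ← polyLaurent_mul_indicialInv, map_mul]
    ring

theorem natDegree_comp_X_add_C_le (f : S[X]) (a : S) :
    (f.comp (Polynomial.X + Polynomial.C a)).natDegree ≤ f.natDegree := by
  refine Polynomial.natDegree_comp_le.trans ?_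
  have : (Polynomial.X + Polynomial.C a).natDegree ≤ 1 := by compute_degree
  nlinarith

theorem natDegree_coeff_cyclicScaled_le {m : ℕ} (l : Fin n → ℤ) {τ : ℤ → S[X]}
    (hτ : ∀ d, (τ d).natDegree ≤ m) (i j : ZMod p) (κ : ℕ) :
    (PowerSeries.coeff κ (cyclicScaled p m l τ i j)).natDegree ≤ n * (p - 1) + m := by
  rw [cyclicScaled, Matrix.of_apply, PowerSeries.coeff_C_mul]
  refine Polynomial.natDegree_mul_le.trans (add_le_add ?_ ?_)
  · rw [shiftHom, Polynomial.coe_compRingHom_apply]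
    exact (natDegree_comp_X_add_C_le _ _).trans (indicialCofactor_natDegree_le l)
  · rw [cyclicPert, Matrix.of_apply, map_sum]
    refine Polynomial.natDegree_sum_le_of_forall_le _ _ fun d _ => ?_
    rw [coeff_pertEntry]
    split_ifs
    · exact (natDegree_comp_X_add_C_le _ _).trans (hτ d)
    · simp

theorem natDegree_coeff_cyclicScaled_pow_le {m : ℕ} (l : Fin n → ℤ) {τ : ℤ → S[X]}
    (hτ : ∀ d, (τ d).natDegree ≤ m) (r : ℕ) (i j : ZMod p) (κ : ℕ) :
    (PowerSeries.coeff κ ((cyclicScaled p m l τ ^ r) i j)).natDegree ≤ r * (n * (p - 1) + m) := by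
  induction r generalizing i j κ with
  | zero =>
    rw [pow_zero, Matrix.one_apply]
    split_ifs
    · rw [PowerSeries.coeff_one]
      split_ifs <;> simp
    · simp
  | succ r ih =>
    rw [pow_succ, Matrix.mul_apply, map_sum]
    refine Polynomial.natDegree_sum_le_of_forall_le _ _ fun q _ => ?_
    rw [PowerSeries.coeff_mul]
    refine Polynomial.natDegree_sum_le_of_forall_le _ _ fun e _ => ?_
    refine Polynomial.natDegree_mul_le.trans ?_
    rw [Nat.succ_mul]
    exact add_le_add (ih _ _ _) (natDegree_coeff_cyclicScaled_le l hτ _ _ _)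

/-- With denominators cleared, the diagonal entries are the translates of the entry at `0`, so the
trace is periodic. That entry has degree at most `r * (n * (p - 1) + m)`, which is below `p * (n *
r) + (p - 1)` as `r * m < p - 1`; summing the translates then brings the degree below that of the
denominator. -/
theorem coeff_trace_scaledPert_mem [Nontrivial S] {m : ℕ} (l : Fin n → ℤ) {τ : ℤ → S[X]}
    (hτ : ∀ d, (τ d).natDegree ≤ m) {r : ℕ} (hr : r * m < p - 1) (κ : ℕ) :
    PowerSeries.coeff κ (scaledPert l (fun i : ZMod p => i) (cyclicPert p m τ) ^ r).trace ∈
      periodicSubring p S := by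
  set F := PowerSeries.coeff κ ((cyclicScaled p m l τ ^ r) 0 0) with hF
  refine ⟨n * r, ∑ j : ZMod p, shiftHom (algebraMap (ZMod p) S j) F, shiftHom_sum_shiftHom F,
    degree_sum_shiftHom_lt ?_, ?_⟩
  · refine (natDegree_coeff_cyclicScaled_pow_le l hτ r 0 0 κ).trans_lt ?_
    have h1 : n * (p - 1) ≤ n * p := Nat.mul_le_mul_left n (Nat.sub_le p 1)
    calc r * (n * (p - 1) + m) ≤ r * (n * p) + r * m := by
          rw [mul_add]; exact Nat.add_le_add_right (Nat.mul_le_mul_left r h1) _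
      _ = p * (n * r) + r * m := by ring
      _ < _ := by omega
  · have h1 : ∀ j : ZMod p, shiftHom (algebraMap (ZMod p) S j) F =
        PowerSeries.coeff κ ((cyclicScaled p m l τ ^ r) j j) := by
      intro j
      rw [hF, ← PowerSeries.coeff_map]
      have := shiftSeries_cyclicScaled_pow m l τ r 0 0 j
      rw [zero_add] at this
      rw [← this]
    simp only [h1]
    rw [Matrix.trace, map_sum, map_sum, Finset.sum_mul]
    refine Finset.sum_congr rfl fun j _ => ?_
    have h2 := congrArg (PowerSeries.coeff κ) (polyLaurent_mul_scaledPert_pow m l τ r j j)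
    rw [← map_pow PowerSeries.C, PowerSeries.coeff_C_mul, PowerSeries.coeff_map, mul_comm,
      ← map_pow, ← pow_mul, map_pow] at h2
    exact h2

theorem coeff_derivative_traceLog_mem [Nontrivial S] {m N : ℕ} (l : Fin n → ℤ) {τ : ℤ → S[X]}
    (hτ : ∀ d, (τ d).natDegree ≤ m) (hN : N * m < p - 1) (κ : ℕ) :
    PowerSeries.coeff κ (d⁄dX _ (traceLog (ZMod p) N
      (scaledPert l (fun i : ZMod p => i) (cyclicPert p m τ)))) ∈ periodicSubring p S := by
  rw [coeff_derivative_traceLog]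
  refine (periodicSubring p S).nsmul_mem ((periodicSubring p S).sum_mem fun r hr => ?_) _
  -- Scalars in `ZMod p` are natural multiples, under which even a non-unital subring is closed.
  rw [← ZMod.natCast_zmod_val ((-1) ^ r * ((r + 1 : ℕ) : ZMod p)⁻¹), map_natCast, ← nsmul_eq_mul]
  refine (periodicSubring p S).nsmul_mem (coeff_trace_scaledPert_mem l hτ ?_ _) _
  exact (Nat.mul_le_mul_right m (by have := Finset.mem_range.1 hr; omega)).trans_lt hN

/-! #### Comparison with a window -/

theorem valMinAbs_natAbs_le (i : ZMod p) (x : ℤ) (hx : (x : ZMod p) = i) :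
    i.valMinAbs.natAbs ≤ x.natAbs :=
  ZMod.natAbs_min_of_le_div_two p _ _ (by rw [ZMod.coe_valMinAbs, hx]) (ZMod.natAbs_valMinAbs_le i)

theorem cyclicPert_bound {m : ℕ} {τ : ℤ → S[X]} (hτ : ∀ d < -(m : ℤ), τ d = 0)
    (i j : ZMod p) (κ : ℕ) (h : PowerSeries.coeff κ (cyclicPert p m τ i j) ≠ 0) :
    i.valMinAbs.natAbs ≤ j.valMinAbs.natAbs + (m + 1) * κ ∧
      j.valMinAbs.natAbs ≤ i.valMinAbs.natAbs + (m + 1) * κ := by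
  rw [cyclicPert, Matrix.of_apply, map_sum] at h
  obtain ⟨d, hd, h⟩ := Finset.exists_ne_zero_of_sum_ne_zero h
  have h1 := abs_le_of_coeff_pertEntry_ne_zero hτ h
  have h2 := (Finset.mem_filter.1 hd).2
  have h3 := valMinAbs_natAbs_le i (j.valMinAbs + d) (by
    push_cast [ZMod.coe_valMinAbs]; rw [h2]; ring)
  have h4 := valMinAbs_natAbs_le j (i.valMinAbs - d) (by
    push_cast [ZMod.coe_valMinAbs]; rw [h2]; ring)
  omega

/-- Another representative of `i - j` in the range of summation is at least `p - 2 * J`, hence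
larger than `N`. Its term has weight greater than `N` and is invisible at the orders considered. -/
theorem coeff_cyclicPert_cast {m N J : ℕ} {τ : ℤ → S[X]} (hτ : ∀ d < -(m : ℤ), τ d = 0)
    (hJ : 2 * J + m + N < p) (i j : Finset.Icc (-(J : ℤ)) (J : ℤ)) (κ : ℕ) (hκ : κ ≤ N) :
    PowerSeries.coeff κ (cyclicPert p m τ ((i : ℤ) : ZMod p) ((j : ℤ) : ZMod p)) =
      PowerSeries.coeff κ (windowPert m τ J J i j) := by
  have hi := Finset.mem_Icc.1 i.2
  have hj := Finset.mem_Icc.1 j.2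
  rw [cyclicPert, Matrix.of_apply, windowPert, Matrix.of_apply, map_sum, map_intCast]
  refine Finset.sum_eq_single _ (fun d hd hne => ?_) (fun hd => ?_)
  · obtain ⟨hd1, hd2⟩ := Finset.mem_filter.1 hd
    rw [Finset.mem_Icc] at hd1
    rw [← Int.cast_sub, ZMod.intCast_eq_intCast_iff_dvd_sub] at hd2
    obtain ⟨e, he⟩ := hd2
    rw [coeff_pertEntry, if_neg]
    have he' : e < 0 := by
      by_contra h
      have : e ≠ 0 := by rintro rfl; apply hne; linarith
      have : (p : ℤ) * 1 ≤ p * e := mul_le_mul_of_nonneg_left (by omega) (by omega)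
      omega
    have : (p : ℤ) * e ≤ p * (-1) := mul_le_mul_of_nonneg_left (by omega) (by omega)
    rw [shiftWeight]
    split_ifs <;> omega
  · have : (i : ℤ) - j < -m := by
      by_contra h
      apply hd
      rw [Finset.mem_filter, Finset.mem_Icc]
      refine ⟨⟨by omega, by omega⟩, by push_cast; rfl⟩
    rw [pertEntry, hτ _ this]
    simp

/-- At `Y = 0` the matrix is diagonal, and for each exponent the product over all residues is `X ^ p
- X`, whatever the exponent. -/
theorem coeff_zero_cyclicDet {m : ℕ} (l : Fin n → ℤ) {τ : ℤ → S[X]}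
    (hτ : ∀ d < -(m : ℤ), τ d = 0) :
    PowerSeries.coeff 0 (cyclicDet p m l τ) = artinSchreier p S ^ n := by
  rw [PowerSeries.coeff_zero_eq_constantCoeff_apply, cyclicDet, RingHom.map_det]
  have : (PowerSeries.constantCoeff (R := S[X])).mapMatrix
      (diagPert l (fun i : ZMod p => i) (cyclicPert p m τ)) = Matrix.diagonal fun i : ZMod p =>
        (indicial S l).comp (Polynomial.X + Polynomial.C (algebraMap (ZMod p) S i)) := by
    ext1 i j
    rw [RingHom.mapMatrix_apply, Matrix.map_apply, diagPert, Matrix.add_apply, map_add]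
    have h0 : PowerSeries.constantCoeff (cyclicPert p m τ i j) = 0 := by
      rw [← PowerSeries.X_dvd_iff]
      exact X_dvd_cyclicPert hτ i j
    rw [h0, add_zero]
    by_cases h : i = j
    · subst h; simp
    · simp [h]
  rw [this, Matrix.det_diagonal]
  simp only [indicial_comp]
  rw [Finset.prod_comm]
  have : ∀ q, ∏ i : ZMod p, (Polynomial.X + Polynomial.C (algebraMap (ZMod p) S (i - l q))) =
      artinSchreier p S := by
    intro q
    rw [artinSchreier]
    refine Fintype.prod_equiv (Equiv.subRight (l q : ZMod p)) _ _ fun i => by simp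
  rw [Finset.prod_congr rfl fun q _ => this q]
  simp

/-! #### The product of the translates of a Weierstrass polynomial -/

variable (p) in
/-- The product of the translates of `w`. -/
def translateProd (w : S[X]⟦X⟧) : S[X]⟦X⟧ :=
  ∏ j : ZMod p, shiftSeries (algebraMap (ZMod p) S j) w

theorem coeff_prod_degree {ι : Type*} [DecidableEq ι] (s : Finset ι) (f : ι → S[X]⟦X⟧)
    (hf : ∀ i ∈ s, ∀ κ, (PowerSeries.coeff κ (f i)).degree ≤ n ∧
      (κ ≠ 0 → (PowerSeries.coeff κ (f i)).degree < n)) (κ : ℕ) :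
    (PowerSeries.coeff κ (∏ i ∈ s, f i)).degree ≤ (s.card * n : ℕ) ∧
      (κ ≠ 0 → (PowerSeries.coeff κ (∏ i ∈ s, f i)).degree < (s.card * n : ℕ)) := by
  induction s using Finset.induction_on generalizing κ with
  | empty =>
    rw [Finset.prod_empty, PowerSeries.coeff_one]
    split_ifs with h
    · exact ⟨Polynomial.degree_one_le.trans (by simp), fun h' => absurd h h'⟩
    · simp
  | insert a s ha ih =>
    have ih' := ih fun i hi => hf i (Finset.mem_insert_of_mem hi)
    have ha' := hf a (Finset.mem_insert_self a s)
    rw [Finset.prod_insert ha, Finset.card_insert_of_notMem ha, PowerSeries.coeff_mul]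
    have e : (s.card + 1) * n = n + s.card * n := by ring
    rw [e]
    constructor
    · refine (Polynomial.degree_sum_le _ _).trans (Finset.sup_le fun q _ => ?_)
      refine (Polynomial.degree_mul_le _ _).trans ?_
      rw [Nat.cast_add]
      exact add_le_add (ha' _).1 (ih' _).1
    · intro hκ
      refine (Polynomial.degree_sum_le _ _).trans_lt ?_
      rw [Finset.sup_lt_iff (WithBot.bot_lt_coe _)]
      intro q hq
      rw [Finset.HasAntidiagonal.mem_antidiagonal] at hq
      by_cases hq1 : q.1 = 0
      · have := degree_mul_lt ((ih' q.2).2 (by omega)) (ha' q.1).1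
        rwa [mul_comm, add_comm] at this
      · exact degree_mul_lt ((ha' q.1).2 hq1) (ih' q.2).1

theorem coeff_zero_translateProd {w : S[X]⟦X⟧} (hw : IsMonicLift n w) :
    PowerSeries.coeff 0 (translateProd p w) = artinSchreier p S ^ n := by
  rw [PowerSeries.coeff_zero_eq_constantCoeff_apply, translateProd, map_prod, artinSchreier,
    ← Finset.prod_pow]
  refine Finset.prod_congr rfl fun j _ => ?_
  rw [← PowerSeries.coeff_zero_eq_constantCoeff_apply, PowerSeries.coeff_map, hw.1, map_pow,
    shiftHom_X]

theorem degree_coeff_translateProd_lt [Nontrivial S] {w : S[X]⟦X⟧} (hw : IsMonicLift n w) {κ : ℕ}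
    (hκ : κ ≠ 0) : (PowerSeries.coeff κ (translateProd p w)).degree < (p * n : ℕ) := by
  have := (coeff_prod_degree (n := n) (Finset.univ : Finset (ZMod p))
    (fun j => shiftSeries (algebraMap (ZMod p) S j) w) (fun j _ κ => ?_) κ).2 hκ
  · rwa [Finset.card_univ, ZMod.card] at this
  · rw [PowerSeries.coeff_map]
    refine ⟨(degree_shiftHom_le _ _).trans ?_, fun hκ =>
      (degree_shiftHom_le _ _).trans_lt (hw.2 κ hκ)⟩
    by_cases h : κ = 0
    · rw [h, hw.1, Polynomial.degree_X_pow]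
    · exact (hw.2 κ h).le

theorem shiftSeries_translateProd (w : S[X]⟦X⟧) :
    shiftSeries 1 (translateProd p w) = translateProd p w := by
  rw [translateProd, map_prod]
  refine Fintype.prod_equiv (Equiv.addRight 1) _ _ fun j => ?_
  ext1 κ
  rw [PowerSeries.coeff_map, PowerSeries.coeff_map, PowerSeries.coeff_map, shiftHom_shiftHom,
    Equiv.coe_addRight, map_add, map_one]

/-- Divided by its constant term `(X ^ p - X) ^ n`, the product is `1` plus periodic terms that
vanish at infinity. This is the periodic analogue of `IsMonicLift.logDeriv_mem_polar`. -/
theorem logDeriv_translateProd_mem [Nontrivial S] {w : S[X]⟦X⟧} (hw : IsMonicLift n w)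
    {μ : (LaurentSeries S)⟦X⟧}
    (hμ : d⁄dX _ (toLaurent S (translateProd p w)) = toLaurent S (translateProd p w) * μ) (κ : ℕ) :
    PowerSeries.coeff κ μ ∈ periodicSubring p S := by
  obtain ⟨a, ha⟩ := ((isUnit_polyLaurent_artinSchreier (p := p) (S := S)).pow n).exists_left_inv
  refine coeff_logDeriv_mem _ (f := PowerSeries.C a * toLaurent S (translateProd p w)) ?_ ?_ ?_ κ
  · rw [PowerSeries.coeff_C_mul, PowerSeries.coeff_map, coeff_zero_translateProd hw, map_pow, ha]
  · intro i hi
    refine ⟨n, PowerSeries.coeff i (translateProd p w), ?_, degree_coeff_translateProd_lt hw hi, ?_⟩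
    · rw [← PowerSeries.coeff_map, shiftSeries_translateProd]
    · rw [PowerSeries.coeff_C_mul, PowerSeries.coeff_map, mul_right_comm, ha, one_mul]
  · rw [Derivation.leibniz, PowerSeries.derivative_C, smul_zero, add_zero, hμ, smul_eq_mul,
      mul_assoc]

/-- A translate by `j ≠ 0` reduces to `(X + j) ^ n` at `Y = 0`, which is invertible as a power
series in `X`. So `w` is the Weierstrass part of the product at `X = 0`. -/
theorem isFactor_translateProd (N : ℕ) {w : S[X]⟦X⟧} (hw : IsMonicLift n w) :
    IsFactor N (translateProd p w) w := by
  refine ⟨PowerSeries.map Polynomial.coeToPowerSeries.ringHom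
    (∏ j ∈ Finset.univ.erase (0 : ZMod p), shiftSeries (algebraMap (ZMod p) S j) w), ?_, ?_⟩
  · rw [PowerSeries.isUnit_iff_constantCoeff, ← PowerSeries.coeff_zero_eq_constantCoeff_apply,
      PowerSeries.coeff_map, PowerSeries.coeff_zero_eq_constantCoeff_apply, map_prod, map_prod,
      IsUnit.prod_iff]
    intro j hj
    rw [← PowerSeries.coeff_zero_eq_constantCoeff_apply, PowerSeries.coeff_map, hw.1, map_pow,
      map_pow, shiftHom_X]
    refine IsUnit.pow _ ?_
    rw [PowerSeries.isUnit_iff_constantCoeff]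
    simpa using (IsUnit.mk0 j (Finset.ne_of_mem_erase hj)).map (algebraMap (ZMod p) S)
  · rw [← map_mul]
    have : w * ∏ j ∈ Finset.univ.erase (0 : ZMod p), shiftSeries (algebraMap (ZMod p) S j) w =
        translateProd p w := by
      rw [translateProd, ← Finset.mul_prod_erase _ _ (Finset.mem_univ (0 : ZMod p))]
      congr 1
      ext1 κ
      simp
    rw [this, sub_self]
    exact dvd_zero _

/-- The determinant of the periodic matrix is the product of the translates of the Weierstrass
polynomial of the determinant over a window. -/
theorem coeff_cyclicDet_eq [Nontrivial S] {m c J N : ℕ} (l : Fin n → ℤ) {τ : ℤ → S[X]}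
    (hτ : ∀ d < -(m : ℤ), τ d = 0) (hτm : ∀ d, (τ d).natDegree ≤ m) (hl : ∀ q, (l q).natAbs ≤ c)
    (hJN : c + 2 * ((m + 1) * N) ≤ J) (hJ : 2 * J + m + N < p) (hN : N * m < p - 1)
    {w : S[X]⟦X⟧} (hw : IsMonicLift n w) (h : IsFactor N (windowDet (ZMod p) m l τ J J) w)
    (κ : ℕ) (hκ : κ ≤ N) :
    PowerSeries.coeff κ (cyclicDet p m l τ) = PowerSeries.coeff κ (translateProd p w) := by
  have hN' : ∀ r < N, ((r + 1 : ℕ) : ZMod p) ≠ 0 := by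
    intro r hr h0
    rw [ZMod.natCast_eq_zero_iff] at h0
    have := Nat.le_of_dvd (Nat.succ_pos r) h0
    omega
  have hT : ∀ i j, PowerSeries.X ∣ cyclicPert p m τ i j := X_dvd_cyclicPert hτ
  have hU : IsUnit (toLaurent S (translateProd p w)) := by
    rw [PowerSeries.isUnit_iff_constantCoeff, ← PowerSeries.coeff_zero_eq_constantCoeff_apply,
      PowerSeries.coeff_map, coeff_zero_translateProd hw, map_pow]
    exact isUnit_polyLaurent_artinSchreier.pow n
  obtain ⟨μ, hμ⟩ := coeff_logDeriv_of_isUnit hU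
  obtain ⟨ν, hν⟩ := coeff_logDeriv_of_isUnit hw.isUnit_toLaurent
  -- On the circle `ZMod p`, size is the distance to `0`; on the central window it agrees with the
  -- absolute value.
  have hval : ∀ x : ℤ, x.natAbs ≤ p / 2 → (x : ZMod p).valMinAbs.natAbs = x.natAbs := fun x hx =>
    le_antisymm (valMinAbs_natAbs_le _ _ rfl)
      (ZMod.natAbs_min_of_le_div_two p _ _ (by rw [ZMod.coe_valMinAbs]) hx)
  apply polyLaurent_injective
  rw [← PowerSeries.coeff_map, ← PowerSeries.coeff_map]
  refine coeff_eq_of_logDeriv N hN' (f := toLaurent S (cyclicDet p m l τ))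
    (g := toLaurent S (translateProd p w))
    (μ := d⁄dX _ (traceLog (ZMod p) N (scaledPert l (fun i : ZMod p => i) (cyclicPert p m τ))))
    (ν := μ) ?_ (logDeriv_det_diagPert N hN' l _ _ hT) (by rw [hμ, sub_self]; exact dvd_zero _)
    (fun i hi => ?_) κ hκ
  · rw [PowerSeries.coeff_map, PowerSeries.coeff_map, coeff_zero_cyclicDet l hτ,
      coeff_zero_translateProd hw]
  · rw [← sub_eq_zero]
    -- The two logarithmic derivatives are periodic and vanish at infinity. Their difference is
    -- regular, since the cyclic determinant, the window determinant, `w` and the product of its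
    -- translates all have the same polar part at `0`.
    refine eq_zero_of_regular_of_periodic (p := p) ?_ ((periodicSubring p S).sub_mem
      (coeff_derivative_traceLog_mem l hτm hN i) (logDeriv_translateProd_mem hw hμ i))
    have e1 := logDeriv_sub_mem_of_isFactor (isFactor_translateProd (p := p) N hw)
      hw.isUnit_toLaurent (μ := μ) (by rw [hμ, sub_self]; exact dvd_zero _) hν i hi
    have e2 := logDeriv_sub_mem_of_isFactor h hw.isUnit_toLaurent
      (logDeriv_det_diagPert N hN' l _ _ fun i j => X_dvd_pertEntry hτ _ _) hν i hi
    have e3 := coeff_traceLog_window_sub_mem (k := ZMod p) l (fun i : ZMod p => i)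
      (cyclicPert p m τ) (ν := fun i => i.valMinAbs.natAbs) (c := c) hτ (cyclicPert_bound hτ)
      (fun i hi q hq => ?_) (J := J) (N := N) (f := fun i => ((i : ℤ) : ZMod p)) ?_ ?_
      (fun i => rfl) ?_ (fun i j κ hκ => coeff_cyclicPert_cast hτ hJ i j κ hκ) hJN i hi
    · have e4 := (regularSubring S).add_mem e3 ((regularSubring S).sub_mem e1 e2)
      convert e4 using 1
      ring
    · have := valMinAbs_natAbs_le i (l q) hq.symm
      have := hl q
      omega
    · intro i j hij
      have hi := Finset.mem_Icc.1 i.2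
      have hj := Finset.mem_Icc.1 j.2
      have h0 := (ZMod.intCast_eq_intCast_iff_dvd_sub _ _ _).1 hij
      obtain ⟨e, he⟩ := h0
      have he0 : e = 0 := by
        by_contra h
        rcases lt_or_gt_of_ne h with h | h
        · have : (p : ℤ) * e ≤ p * (-1) := mul_le_mul_of_nonneg_left (by omega) (by omega)
          omega
        · have : (p : ℤ) * 1 ≤ p * e := mul_le_mul_of_nonneg_left (by omega) (by omega)
          omega
      subst he0
      exact Subtype.ext (by omega)
    · intro i
      have hi := Finset.mem_Icc.1 i.2
      exact hval _ (by omega)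
    · intro i hi
      exact ⟨⟨i.valMinAbs, Finset.mem_Icc.2 ⟨by omega, by omega⟩⟩, ZMod.coe_valMinAbs i⟩

end Cyclic

/-! ### The entries of the matrix of `D` -/

section Entries

/-- The coefficient `∑_b c_{b + d, b} X (X - 1) ⋯ (X - b + 1)` of the shift by `d`. -/
def shiftSymbol {B : Type*} [CommRing B] (c : ℕ → ℕ → B) (m : ℕ) (d : ℤ) : B[X] :=
  ∑ b ∈ Finset.range (m + 1),
    if 0 ≤ d + b then Polynomial.C (c (d + b).toNat b) * descPochhammer B b else 0

theorem shiftSymbol_eq_zero {B : Type*} [CommRing B] (c : ℕ → ℕ → B) (m : ℕ) :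
    ∀ d < -(m : ℤ), shiftSymbol c m d = 0 := by
  intro d hd
  refine Finset.sum_eq_zero fun b hb => if_neg ?_
  have := Finset.mem_range.1 hb
  omega

theorem natDegree_shiftSymbol_le {B : Type*} [CommRing B] [Nontrivial B] [NoZeroDivisors B]
    (c : ℕ → ℕ → B) (m : ℕ) (d : ℤ) :
    (shiftSymbol c m d).natDegree ≤ m := by
  refine Polynomial.natDegree_sum_le_of_forall_le _ _ fun b hb => ?_
  split_ifs
  · refine Polynomial.natDegree_mul_le.trans ?_
    rw [Polynomial.natDegree_C, descPochhammer_natDegree]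
    have := Finset.mem_range.1 hb
    omega
  · simp

theorem eval_shiftSymbol {B : Type*} [CommRing B] (c : ℕ → ℕ → B) (m : ℕ) (d : ℤ) (x : B) :
    (shiftSymbol c m d).eval x = ∑ b ∈ Finset.range (m + 1),
      if 0 ≤ d + b then c (d + b).toNat b * (descPochhammer B b).eval x else 0 := by
  rw [shiftSymbol, Polynomial.eval_finsetSum]
  refine Finset.sum_congr rfl fun b _ => ?_
  split_ifs <;> simp

theorem descPochhammer_comp {B : Type*} [CommRing B] (f : B[X]) (b : ℕ) :
    (descPochhammer B b).comp f = (descPochhammer B[X] b).eval f := by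
  induction b with
  | zero => simp
  | succ b ih =>
    rw [descPochhammer_succ_eval, descPochhammer_succ_right, Polynomial.mul_comp, ih]
    simp

theorem comp_shiftSymbol {B : Type*} [CommRing B] (c : ℕ → ℕ → B) (m : ℕ) (d : ℤ) (f : B[X]) :
    (shiftSymbol c m d).comp f = ∑ b ∈ Finset.range (m + 1),
      if 0 ≤ d + b then Polynomial.C (c (d + b).toNat b) * (descPochhammer B[X] b).eval f
        else 0 := by
  rw [shiftSymbol, Polynomial.sum_comp]
  refine Finset.sum_congr rfl fun b _ => ?_
  split_ifs <;> simp [descPochhammer_comp]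

variable {S : Type} [CommRing S]

theorem twistedDerivative_single (ε : S) (j : ℤ) (a : S) :
    twistedDerivative ε (HahnSeries.single j a) = HahnSeries.single (j - 1) (a * (j + ε)) := by
  rw [twistedDerivative, LinearMap.add_apply, LaurentSeries.derivative_apply,
    LaurentSeries.hasseDeriv_single]
  change _ + HahnSeries.single (-1) ε * HahnSeries.single j a = _
  rw [HahnSeries.single_mul_single]
  have : (-1 : ℤ) + j = j - 1 := by ring
  rw [this, Nat.cast_one, ← HahnSeries.single_add, Ring.choose_one_right, zsmul_eq_mul]
  congr 1
  ring

theorem twistedDerivative_pow_single (ε : S) (j : ℤ) (b : ℕ) :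
    (twistedDerivative ε ^ b) (HahnSeries.single j 1) =
      HahnSeries.single (j - b) ((descPochhammer S b).eval (j + ε)) := by
  induction b with
  | zero => simp
  | succ b ih =>
    rw [pow_succ', Module.End.mul_apply, ih, twistedDerivative_single, descPochhammer_succ_eval]
    push_cast
    congr 1
    · ring_nf
    · ring

theorem prod_ofFn_apply {E : Type*} [AddCommGroup E] [Module S E] {n : ℕ} (A : Module.End S E)
    (l : Fin n → ℤ) (e : S) (v : E) (hA : A v = e • v) :
    (List.ofFn fun k => A - (l k : Module.End S E)).prod v = (∏ k, (e - l k)) • v := by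
  induction n with
  | zero => simp
  | succ n ih =>
    rw [List.ofFn_succ, List.prod_cons, Module.End.mul_apply, ih (fun k => l k.succ), map_smul,
      LinearMap.sub_apply, hA, Module.End.intCast_apply, ← Int.cast_smul_eq_zsmul S, ← sub_smul,
      smul_smul, Fin.prod_univ_succ, mul_comm]

theorem coeff_twistedOp_single (ε : S) (c : ℕ → ℕ → S) {n : ℕ} (m : ℕ) (l : Fin n → ℤ) (i j : ℤ) :
    (twistedOp ε c m l (HahnSeries.single j 1)).coeff i =
      (if i = j then ∏ k, (j + ε - l k) else 0) + (shiftSymbol c m (i - j)).eval (j + ε) := by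
  rw [twistedOp, diffOp, LinearMap.add_apply, HahnSeries.coeff_add, LinearMap.sum_apply,
    HahnSeries.coeff_sum, eval_shiftSymbol]
  congr 1
  · rw [prod_ofFn_apply _ l (j + ε)]
    · rw [HahnSeries.coeff_smul, HahnSeries.coeff_single]
      split_ifs <;> simp
    · rw [Module.End.mul_apply, twistedDerivative_single]
      change HahnSeries.single (1 : ℤ) (1 : S) * HahnSeries.single (j - 1) (1 * ((j : S) + ε)) = _
      rw [HahnSeries.single_mul_single]
      ext a
      simp only [HahnSeries.coeff_smul, HahnSeries.coeff_single, one_mul, smul_eq_mul]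
      rw [show (1 : ℤ) + (j - 1) = j by ring]
      split_ifs <;> simp
  · refine Finset.sum_congr rfl fun b _ => ?_
    rw [Module.End.mul_apply, twistedDerivative_pow_single]
    change (HahnSeries.ofPowerSeries ℤ S _ * HahnSeries.single (j - b) _).coeff i = _
    rw [HahnSeries.coeff_mul_single, PowerSeries.coeff_coe]
    have e : i - (j - b) = i - j + b := by ring
    rw [e]
    by_cases h : 0 ≤ i - j + b
    · rw [if_pos h, if_neg (by omega), PowerSeries.coeff_mk]
      congr 2
      omega
    · rw [if_neg h, if_pos (by omega), zero_mul]

/-- The entries of the matrix of `D` over the ring `A`. -/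
def bOver (A : Type) [CommRing A] {n : ℕ} (m : ℕ) (l : Fin n → ℤ) (i j : ℤ) : (Par A)[X] :=
  (if i = j then (indicial (Par A) l).comp (Polynomial.X + Polynomial.C (j : Par A)) else 0) +
    (shiftSymbol (t A) m (i - j)).comp (Polynomial.X + Polynomial.C (j : Par A))

theorem bEntry_eq {n : ℕ} (m : ℕ) (l : Fin n → ℤ) (i j : ℤ) : bEntry m l i j = bOver ℤ m l i j := by
  rw [bEntry, coeff_twistedOp_single, bOver, comp_shiftSymbol, eval_shiftSymbol, indicial,
    Polynomial.prod_comp]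
  have e : Polynomial.X + Polynomial.C (j : Par ℤ) = (j : (Par ℤ)[X]) + Polynomial.X := by
    rw [map_intCast, add_comm]
  rw [e]
  congr 2
  refine Finset.prod_congr rfl fun k _ => ?_
  rw [Polynomial.sub_comp, Polynomial.X_comp, Polynomial.C_comp, map_intCast]

theorem map_shiftSymbol {B B' : Type*} [CommRing B] [CommRing B'] (φ : B →+* B') (c : ℕ → ℕ → B)
    (m : ℕ) (d : ℤ) :
    (shiftSymbol c m d).map φ = shiftSymbol (fun i j => φ (c i j)) m d := by
  rw [shiftSymbol, shiftSymbol, Polynomial.map_sum]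
  refine Finset.sum_congr rfl fun b _ => ?_
  split_ifs <;> simp [descPochhammer_map]

theorem map_bOver {A A' : Type} [CommRing A] [CommRing A'] (φ : A →+* A') {n : ℕ} (m : ℕ)
    (l : Fin n → ℤ) (i j : ℤ) : (bOver A m l i j).map (MvPolynomial.map φ) = bOver A' m l i j := by
  have hX : (Polynomial.X + Polynomial.C (j : Par A)).map (MvPolynomial.map φ) =
      Polynomial.X + Polynomial.C (j : Par A') := by
    rw [Polynomial.map_add, Polynomial.map_X, Polynomial.map_C, map_intCast]
  have hP : (indicial (Par A) l).map (MvPolynomial.map φ) = indicial (Par A') l := by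
    rw [indicial, indicial, Polynomial.map_prod]
    simp only [Polynomial.map_sub, Polynomial.map_X, map_intCast, Polynomial.map_intCast]
  have hT : (shiftSymbol (t A) m (i - j)).map (MvPolynomial.map φ) =
      shiftSymbol (t A') m (i - j) := by
    rw [map_shiftSymbol]
    simp only [t, MvPolynomial.map_X]
  rw [bOver, bOver, Polynomial.map_add, Polynomial.map_comp, hT, hX,
    apply_ite (Polynomial.map (MvPolynomial.map φ)), Polynomial.map_comp, hP, hX,
    Polynomial.map_zero]

/-- The determinant of the matrix of `D` over a window, over the ring `A`. -/
def detOver (A : Type) [CommRing A] {n : ℕ} (m : ℕ) (l : Fin n → ℤ) (M N : ℕ) : (Par A)[X] :=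
  Matrix.det (Matrix.of fun i j : Finset.Icc (-(M : ℤ)) (N : ℤ) => bOver A m l i j)

theorem detB_eq {n : ℕ} (m : ℕ) (l : Fin n → ℤ) (M N : ℕ) : detB m l M N = detOver ℤ m l M N := by
  simp only [detB, detOver, bEntry_eq]

theorem map_detOver {A A' : Type} [CommRing A] [CommRing A'] (φ : A →+* A') {n : ℕ} (m : ℕ)
    (l : Fin n → ℤ) (M N : ℕ) :
    (detOver A m l M N).map (MvPolynomial.map φ) = detOver A' m l M N := by
  rw [detOver, detOver, ← Polynomial.coe_mapRingHom, RingHom.map_det]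
  congr 1
  ext1 i j
  simp [map_bOver]

/-! ### The `p`-determinant as the determinant of a matrix -/

variable {p : ℕ}

/-- The first `p` coefficients of a power series. -/
def firstCoeffs (p : ℕ) (B : Type*) [CommRing B] : B⟦X⟧ →ₗ[B] (Fin p → B) :=
  LinearMap.pi fun i => PowerSeries.coeff (R := B) (i : ℕ)

theorem ker_firstCoeffs : LinearMap.ker (firstCoeffs p (Par (ZMod p))) = tailSubmodule p := by
  ext f
  have : f ∈ tailSubmodule p ↔ (PowerSeries.X : (Par (ZMod p))⟦X⟧) ^ p ∣ f :=
    Ideal.mem_span_singleton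
  rw [this, PowerSeries.X_pow_dvd_iff, LinearMap.mem_ker, funext_iff]
  exact ⟨fun h i hi => h ⟨i, hi⟩, fun h i => h i i.2⟩

theorem firstCoeffs_X_pow {B : Type*} [CommRing B] (j : Fin p) :
    firstCoeffs p B (PowerSeries.X ^ (j : ℕ)) = Pi.single j 1 := by
  ext i
  change PowerSeries.coeff (i : ℕ) ((PowerSeries.X : B⟦X⟧) ^ (j : ℕ)) = _
  rw [PowerSeries.coeff_X_pow, Pi.single_apply]
  simp only [Fin.ext_iff]

theorem firstCoeffs_surjective {B : Type*} [CommRing B] :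
    Function.Surjective (firstCoeffs p B) := by
  intro v
  refine ⟨∑ j, v j • PowerSeries.X ^ (j : ℕ), ?_⟩
  rw [map_sum]
  simp only [map_smul, firstCoeffs_X_pow]
  ext i
  simp [Pi.single_apply]

theorem pDet_eq_det {n : ℕ} (m : ℕ) (l : Fin n → ℤ) : pDet p m l =
    Matrix.det (Matrix.of fun i j : Fin p =>
      PowerSeries.coeff (i : ℕ) (opModP p m l (PowerSeries.X ^ (j : ℕ)))) := by
  set π := firstCoeffs p (Par (ZMod p))
  let e : (_ ⧸ tailSubmodule p) ≃ₗ[Par (ZMod p)] (Fin p → Par (ZMod p)) :=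
    (Submodule.quotEquivOfEq _ _ ker_firstCoeffs.symm).trans
      (π.quotKerEquivOfSurjective firstCoeffs_surjective)
  have he : ∀ f, e (Submodule.Quotient.mk f) = π f := fun f => rfl
  rw [pDet, ← LinearMap.det_conj _ e, ← LinearMap.det_toMatrix']
  congr 1
  ext1 i j
  rw [LinearMap.toMatrix'_apply, ← firstCoeffs_X_pow, Matrix.of_apply]
  have h1 : e.symm (π (PowerSeries.X ^ (j : ℕ))) =
      Submodule.Quotient.mk (PowerSeries.X ^ (j : ℕ)) := by
    rw [← he, LinearEquiv.symm_apply_apply]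
  change e ((tailSubmodule p).mapQ (tailSubmodule p) (opModP p m l) (tail_invariant p m l)
    (e.symm (π (PowerSeries.X ^ (j : ℕ))))) i = _
  rw [h1]
  rfl

theorem derivative_X_pow_iterate {B : Type} [CommRing B] (j b : ℕ) :
    ((PowerSeries.derivative B).toLinearMap ^ b) (PowerSeries.X ^ j) =
      (descPochhammer B b).eval (j : B) • PowerSeries.X ^ (j - b) := by
  induction b with
  | zero => simp
  | succ b ih =>
    rw [pow_succ', Module.End.mul_apply, ih, map_smul, descPochhammer_succ_eval]
    change _ • d⁄dX B ((PowerSeries.X : B⟦X⟧) ^ (j - b)) = _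
    rw [PowerSeries.derivative_pow, PowerSeries.derivative_X, mul_one, ← nsmul_eq_mul,
      ← Nat.cast_smul_eq_nsmul B, smul_smul, Nat.sub_sub]
    by_cases h : b ≤ j
    · rw [Nat.cast_sub h]
    · have : (descPochhammer B b).eval (j : B) = 0 :=
        descPochhammer_eval_coe_nat_of_lt (by omega)
      rw [this, zero_mul, zero_mul]

/-- At `ε = 0` the power series form an invariant block of the matrix on Laurent series: a
derivative of order `b > j` would lead from `x ^ j` to a negative exponent, but its falling
factorial vanishes at `j`. This also repairs the truncated subtraction `j - b`. -/
theorem coeff_opModP {n : ℕ} (m : ℕ) (l : Fin n → ℤ) (i j : ℕ) :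
    PowerSeries.coeff i (opModP p m l (PowerSeries.X ^ j)) =
      (bOver (ZMod p) m l i j).eval 0 := by
  rw [opModP, diffOp, LinearMap.add_apply, map_add, LinearMap.sum_apply, map_sum, bOver,
    Polynomial.eval_add, Polynomial.eval_comp]
  have e0 : Polynomial.eval 0 (Polynomial.X + Polynomial.C (((j : ℕ) : ℤ) : Par (ZMod p))) =
      (j : Par (ZMod p)) := by simp
  rw [e0, eval_shiftSymbol]
  congr 1
  · rw [prod_ofFn_apply _ l (j : Par (ZMod p))]
    · rw [PowerSeries.coeff_smul, PowerSeries.coeff_X_pow]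
      by_cases h : i = j
      · subst h
        rw [if_pos rfl, if_pos rfl, Polynomial.eval_comp, e0, indicial, Polynomial.eval_prod]
        simp
      · rw [if_neg h, if_neg (by exact_mod_cast h)]
        simp
    · rw [Module.End.mul_apply]
      change (PowerSeries.X : (Par (ZMod p))⟦X⟧) * d⁄dX _ ((PowerSeries.X : (Par (ZMod p))⟦X⟧) ^ j) = _
      rw [PowerSeries.derivative_pow, PowerSeries.derivative_X, mul_one, ← nsmul_eq_mul,
        ← Nat.cast_smul_eq_nsmul (Par (ZMod p)), mul_smul_comm]
      rcases j with _ | j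
      · simp
      · rw [Nat.add_sub_cancel, pow_succ']
  · refine Finset.sum_congr rfl fun b _ => ?_
    rw [Module.End.mul_apply, derivative_X_pow_iterate, map_smul, PowerSeries.coeff_smul,
      LinearMap.mulLeft_apply, PowerSeries.coeff_mul_X_pow', PowerSeries.coeff_mk]
    by_cases hb : b ≤ j
    · by_cases h : j - b ≤ i
      · rw [if_pos h, if_pos (by omega), smul_eq_mul, mul_comm]
        congr 3
        omega
      · rw [if_neg h, if_neg (by omega), smul_zero]
    · have : (descPochhammer (Par (ZMod p)) b).eval (j : Par (ZMod p)) = 0 :=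
        descPochhammer_eval_coe_nat_of_lt (by omega)
      rw [this, zero_smul]
      split_ifs <;> simp

end Entries

/-! ### The grading by the small parameters -/

section Grading

variable (A : Type) [CommRing A] (m : ℕ)

/-- The rescaling of the small parameters by `Y ^ (m + 1)`. -/
def smallScale : Par A →+* (Par A)⟦X⟧ :=
  MvPolynomial.eval₂Hom ((PowerSeries.C (R := Par A)).comp MvPolynomial.C)
    fun ij => (if ij.1 ≤ ij.2 then PowerSeries.X ^ (m + 1) else 1) * PowerSeries.C (t A ij.1 ij.2)

theorem smallScale_t (i j : ℕ) : smallScale A m (t A i j) =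
    (if i ≤ j then PowerSeries.X ^ (m + 1) else 1) * PowerSeries.C (t A i j) := by
  rw [smallScale, MvPolynomial.coe_eval₂Hom, MvPolynomial.eval₂_X]

theorem smallScale_C (a : A) : smallScale A m (MvPolynomial.C a) =
    PowerSeries.C (MvPolynomial.C a) := by
  rw [smallScale, MvPolynomial.coe_eval₂Hom, MvPolynomial.eval₂_C, RingHom.comp_apply]

/-- The degree of a monomial in the small parameters. -/
def smallDegree (s : ℕ × ℕ →₀ ℕ) : ℕ := s.sum fun ij e => if ij.1 ≤ ij.2 then e else 0

theorem smallScale_monomial (s : ℕ × ℕ →₀ ℕ) (a : A) :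
    smallScale A m (MvPolynomial.monomial s a) =
      PowerSeries.X ^ ((m + 1) * smallDegree s) * PowerSeries.C (MvPolynomial.monomial s a) := by
  rw [MvPolynomial.monomial_eq, map_mul, smallScale_C, Finsupp.prod, map_prod, map_mul, map_prod,
    smallDegree, Finsupp.sum, Finset.mul_sum, ← Finset.prod_pow_eq_pow_sum, mul_left_comm,
    ← Finset.prod_mul_distrib]
  congr 1
  refine Finset.prod_congr rfl fun ij _ => ?_
  rw [map_pow, map_pow]
  change smallScale A m (t A ij.1 ij.2) ^ _ = _
  rw [smallScale_t]
  split_ifs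
  · rw [mul_pow, ← pow_mul]
  · simp

theorem coeff_coeff_smallScale (f : Par A) (κ : ℕ) (s : ℕ × ℕ →₀ ℕ) :
    (PowerSeries.coeff κ (smallScale A m f)).coeff s =
      if (m + 1) * smallDegree s = κ then f.coeff s else 0 := by
  induction f using MvPolynomial.induction_on' with
  | monomial s' a =>
    rw [smallScale_monomial, mul_comm, PowerSeries.coeff_C_mul, PowerSeries.coeff_X_pow]
    rw [MvPolynomial.coeff_monomial]
    by_cases h : s' = s
    · subst h
      simp only [eq_comm (a := κ)]
      split_ifs <;> simp
    · simp only [if_neg h, ite_self]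
      split_ifs <;> simp [h]
  | add f g hf hg =>
    rw [map_add, map_add, MvPolynomial.coeff_add, hf, hg, MvPolynomial.coeff_add]
    split_ifs <;> simp

theorem monomial_mem_smallIdeal_pow (s : ℕ × ℕ →₀ ℕ) (a : A) {K : ℕ} (h : K ≤ smallDegree s) :
    MvPolynomial.monomial s a ∈ smallIdeal A ^ K := by
  refine Ideal.pow_le_pow_right h ?_
  rw [MvPolynomial.monomial_eq]
  refine Ideal.mul_mem_left _ _ ?_
  rw [smallDegree, Finsupp.sum, Finsupp.prod, ← Finset.prod_pow_eq_pow_sum]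
  refine Ideal.prod_mem_prod fun ij _ => ?_
  split_ifs with hij
  · have : t A ij.1 ij.2 ∈ smallIdeal A := Ideal.subset_span ⟨ij.1, ij.2, hij, rfl⟩
    exact Ideal.pow_mem_pow this _
  · simp

/-- `I` is generated by variables, so membership in its powers is decided monomial by monomial. For
the forward direction, scaling the small variables by the first power of `Y` sends `I` into the
ideal generated by `Y`. -/
theorem mem_smallIdeal_pow_iff_coeff (f : Par A) (K : ℕ) :
    f ∈ smallIdeal A ^ K ↔ ∀ s, smallDegree s < K → f.coeff s = 0 := by
  constructor
  · intro hf s hs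
    have h1 : smallIdeal A ≤ (Ideal.span {(PowerSeries.X : (Par A)⟦X⟧)}).comap
        (smallScale A 0) := by
      rw [smallIdeal, Ideal.span_le]
      rintro _ ⟨i, j, hij, rfl⟩
      rw [SetLike.mem_coe, Ideal.mem_comap, smallScale_t, if_pos hij, zero_add, pow_one]
      exact Ideal.mul_mem_right _ _ (Ideal.mem_span_singleton_self _)
    have h2 := Ideal.le_comap_pow _ _ (Ideal.pow_right_mono h1 K hf)
    rw [Ideal.mem_comap, Ideal.span_singleton_pow, Ideal.mem_span_singleton,
      PowerSeries.X_pow_dvd_iff] at h2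
    have h3 := coeff_coeff_smallScale A 0 f (smallDegree s) s
    rw [h2 _ hs, if_pos (by simp)] at h3
    exact h3.symm.trans (by simp)
  · intro h
    rw [f.as_sum]
    refine Ideal.sum_mem _ fun s hs => monomial_mem_smallIdeal_pow A s _ ?_
    by_contra hK
    exact MvPolynomial.mem_support_iff.1 hs (h s (by omega))

theorem mem_smallIdeal_pow_iff (f : Par A) (K : ℕ) :
    f ∈ smallIdeal A ^ K ↔ ∀ κ < (m + 1) * K, PowerSeries.coeff κ (smallScale A m f) = 0 := by
  rw [mem_smallIdeal_pow_iff_coeff]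
  constructor
  · intro h κ hκ
    ext s
    rw [coeff_coeff_smallScale, MvPolynomial.coeff_zero]
    split_ifs with hs
    · refine h s ?_
      rw [← hs] at hκ
      exact lt_of_mul_lt_mul_left hκ (by omega)
    · rfl
  · intro h s hs
    have := coeff_coeff_smallScale A m f ((m + 1) * smallDegree s) s
    rw [if_pos rfl, h _ (Nat.mul_lt_mul_of_pos_left hs (by omega))] at this
    rw [← this, MvPolynomial.coeff_zero]

theorem mem_smallIdeal_iff (f : Par A) :
    f ∈ smallIdeal A ↔ PowerSeries.coeff 0 (smallScale A m f) = 0 := by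
  have h := mem_smallIdeal_pow_iff A m f 1
  rw [pow_one] at h
  rw [h]
  refine ⟨fun h => h 0 (by omega), fun h κ hκ => ?_⟩
  rcases Nat.eq_zero_or_pos κ with rfl | hpos
  · exact h
  · ext s
    rw [coeff_coeff_smallScale, if_neg, MvPolynomial.coeff_zero]
    intro hs
    rcases Nat.eq_zero_or_pos (smallDegree s) with h0 | h0
    · rw [h0] at hs; omega
    · nlinarith

/-! ### Rescaling polynomials and power series -/

/-- The rescaling of the small parameters in the coefficients of a polynomial. -/
def polyScale : (Par A)[X] →+* (Par A)[X]⟦X⟧ :=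
  Polynomial.eval₂RingHom ((PowerSeries.map Polynomial.C).comp (smallScale A m))
    (PowerSeries.C Polynomial.X)

theorem polyScale_C (a : Par A) :
    polyScale A m (Polynomial.C a) = PowerSeries.map Polynomial.C (smallScale A m a) := by
  rw [polyScale, Polynomial.coe_eval₂RingHom, Polynomial.eval₂_C, RingHom.comp_apply]

theorem polyScale_X : polyScale A m Polynomial.X = PowerSeries.C Polynomial.X := by
  rw [polyScale, Polynomial.coe_eval₂RingHom, Polynomial.eval₂_X]

theorem coeff_coeff_polyScale (f : (Par A)[X]) (κ j : ℕ) :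
    (PowerSeries.coeff κ (polyScale A m f)).coeff j =
      PowerSeries.coeff κ (smallScale A m (f.coeff j)) := by
  induction f using Polynomial.induction_on' with
  | add f g hf hg => simp only [map_add, Polynomial.coeff_add, hf, hg]
  | monomial i a =>
    rw [← Polynomial.C_mul_X_pow_eq_monomial, map_mul, map_pow, polyScale_C, polyScale_X, ← map_pow,
      PowerSeries.coeff_mul_C, PowerSeries.coeff_map, Polynomial.coeff_C_mul_X_pow,
      Polynomial.coeff_C_mul_X_pow]
    split_ifs <;> simp

variable {A}

/-- The interchange of the two variables. -/
def swapSeries (B : Type*) [CommRing B] : B⟦X⟧⟦X⟧ →+* B⟦X⟧⟦X⟧ where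
  toFun f := PowerSeries.mk fun κ => PowerSeries.mk fun i =>
    PowerSeries.coeff κ (PowerSeries.coeff i f)
  map_zero' := by ext; simp
  map_one' := by
    ext κ i
    simp only [PowerSeries.coeff_mk, PowerSeries.coeff_one]
    split_ifs <;> simp_all [PowerSeries.coeff_one]
  map_add' f g := by ext; simp
  map_mul' f g := by
    ext κ i
    simp only [PowerSeries.coeff_mk, PowerSeries.coeff_mul, map_sum]
    exact Finset.sum_comm

theorem coeff_coeff_swapSeries {B : Type*} [CommRing B] (f : B⟦X⟧⟦X⟧) (κ i : ℕ) :
    PowerSeries.coeff i (PowerSeries.coeff κ (swapSeries B f)) =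
      PowerSeries.coeff κ (PowerSeries.coeff i f) := by
  change PowerSeries.coeff i (PowerSeries.coeff κ (PowerSeries.mk fun κ => PowerSeries.mk fun i =>
    PowerSeries.coeff κ (PowerSeries.coeff i f))) = _
  rw [PowerSeries.coeff_mk, PowerSeries.coeff_mk]

variable (A) in
/-- The rescaling of the small parameters in the coefficients of a power series. -/
def seriesScale : (Par A)⟦X⟧ →+* (Par A)⟦X⟧⟦X⟧ :=
  (swapSeries (Par A)).comp (PowerSeries.map (smallScale A m))

theorem coeff_coeff_seriesScale (f : (Par A)⟦X⟧) (κ i : ℕ) :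
    PowerSeries.coeff i (PowerSeries.coeff κ (seriesScale A m f)) =
      PowerSeries.coeff κ (smallScale A m (PowerSeries.coeff i f)) := by
  rw [seriesScale, RingHom.comp_apply, coeff_coeff_swapSeries, PowerSeries.coeff_map]

theorem map_coe_polyScale (f : (Par A)[X]) :
    PowerSeries.map Polynomial.coeToPowerSeries.ringHom (polyScale A m f) =
      seriesScale A m (f : (Par A)⟦X⟧) := by
  ext κ i
  rw [coeff_coeff_seriesScale, PowerSeries.coeff_map, Polynomial.coeToPowerSeries.ringHom_apply,
    Polynomial.coeff_coe, coeff_coeff_polyScale, Polynomial.coeff_coe]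

theorem isMonicLift_polyScale [Nontrivial A] {n : ℕ} {w : (Par A)[X]} (hw : w.Monic)
    (hn : w.natDegree = n)
    (hI : ∀ i < n, w.coeff i ∈ smallIdeal A) : IsMonicLift n (polyScale A m w) := by
  have hn1 : w.coeff n = 1 := by rw [← hn]; exact hw
  constructor
  · ext j
    rw [coeff_coeff_polyScale, Polynomial.coeff_X_pow]
    rcases lt_trichotomy j n with h | h | h
    · rw [if_neg h.ne, (mem_smallIdeal_iff A m _).1 (hI j h)]
    · rw [if_pos h, h, hn1, map_one, PowerSeries.coeff_zero_one]
    · rw [if_neg h.ne', Polynomial.coeff_eq_zero_of_natDegree_lt (by omega), map_zero, map_zero]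
  · intro κ hκ
    rw [Polynomial.degree_lt_iff_coeff_zero]
    intro j hj
    rw [coeff_coeff_polyScale]
    rcases hj.eq_or_lt with h | h
    · rw [← h, hn1, map_one, PowerSeries.coeff_one, if_neg hκ]
    · rw [Polynomial.coeff_eq_zero_of_natDegree_lt (by omega), map_zero, map_zero]

/-- Small degree `K` becomes order `(m + 1) * K = N + 1` in `Y`, so a factorization modulo `I ^ K`
gives one modulo `Y ^ (N + 1)`. The unit condition only concerns the reduction modulo `I`. -/
theorem isFactor_polyScale {K N : ℕ} (hK : K ≠ 0) (hN : N + 1 = (m + 1) * K) {q w : (Par A)[X]}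
    {u : (Par A)⟦X⟧} {v : Par A} (hu : PowerSeries.coeff 0 u * v - 1 ∈ smallIdeal A ^ K)
    (h : ∀ i, PowerSeries.coeff i ((q : (Par A)⟦X⟧) - (w : (Par A)⟦X⟧) * u) ∈ smallIdeal A ^ K) :
    IsFactor N (polyScale A m q) (polyScale A m w) := by
  refine ⟨seriesScale A m u, ?_, ?_⟩
  · rw [PowerSeries.isUnit_iff_constantCoeff, PowerSeries.isUnit_iff_constantCoeff,
      ← PowerSeries.coeff_zero_eq_constantCoeff_apply,
      ← PowerSeries.coeff_zero_eq_constantCoeff_apply, coeff_coeff_seriesScale]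
    have h1 := (mem_smallIdeal_iff A m _).1 (Ideal.pow_le_self hK hu)
    rw [PowerSeries.coeff_zero_eq_constantCoeff_apply, map_sub, map_one, map_mul, map_sub, map_mul,
      map_one, sub_eq_zero] at h1
    rw [PowerSeries.coeff_zero_eq_constantCoeff_apply]
    exact IsUnit.of_mul_eq_one _ h1
  · rw [map_coe_polyScale, map_coe_polyScale, ← map_mul, ← map_sub, PowerSeries.X_pow_dvd_iff]
    intro κ hκ
    ext i
    rw [coeff_coeff_seriesScale, (mem_smallIdeal_pow_iff A m _ K).1 (h i) κ (by omega)]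
    simp

end Grading

/-! ### Comparison of the rescaled determinants -/

section Rescaled

theorem map_descPochhammer_eval {B B' : Type*} [CommRing B] [CommRing B'] (φ : B →+* B') (b : ℕ)
    (x : B) : φ ((descPochhammer B b).eval x) = (descPochhammer B' b).eval (φ x) := by
  rw [← descPochhammer_map φ, Polynomial.eval_map, Polynomial.eval₂_at_apply]

variable (A : Type) [CommRing A] (m : ℕ) {n : ℕ} (l : Fin n → ℤ)

theorem polyScale_X_add (j : ℤ) :
    polyScale A m (Polynomial.X + Polynomial.C (j : Par A)) =
      PowerSeries.C (Polynomial.X + Polynomial.C (j : Par A)) := by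
  rw [map_add, polyScale_X, map_add, map_intCast, map_intCast, map_intCast]

theorem polyScale_indicial (j : ℤ) :
    polyScale A m ((indicial (Par A) l).comp (Polynomial.X + Polynomial.C (j : Par A))) =
      PowerSeries.C ((indicial (Par A) l).comp (Polynomial.X + Polynomial.C (j : Par A))) := by
  have h : (indicial (Par A) l).comp (Polynomial.X + Polynomial.C (j : Par A)) =
      ∏ q, (Polynomial.X + Polynomial.C (j : Par A) - (l q : (Par A)[X])) := by
    rw [indicial, Polynomial.prod_comp]
    refine Finset.prod_congr rfl fun q _ => ?_
    rw [Polynomial.sub_comp, Polynomial.X_comp, Polynomial.C_comp,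
      map_intCast (Polynomial.C (R := Par A)) (l q)]
  rw [h, map_prod, map_prod]
  refine Finset.prod_congr rfl fun q _ => ?_
  rw [map_sub, polyScale_X_add, map_sub, map_intCast (polyScale A m),
    map_intCast (PowerSeries.C (R := (Par A)[X])) (l q)]

/-- The exponent of the rescaling of the shift by `d`. -/
def scaleWeight (d : ℤ) : ℕ := if d ≤ 0 then m + 1 else 0

theorem polyScale_shiftSymbol (d j : ℤ) :
    polyScale A m ((shiftSymbol (t A) m d).comp (Polynomial.X + Polynomial.C (j : Par A))) =
      PowerSeries.X ^ scaleWeight m d * PowerSeries.C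
        ((shiftSymbol (t A) m d).comp (Polynomial.X + Polynomial.C (j : Par A))) := by
  rw [comp_shiftSymbol, map_sum, map_sum, Finset.mul_sum]
  refine Finset.sum_congr rfl fun b _ => ?_
  split_ifs with h
  · rw [map_mul, polyScale_C, smallScale_t, map_descPochhammer_eval, polyScale_X_add, map_mul,
      map_mul PowerSeries.C, map_descPochhammer_eval (PowerSeries.C (R := (Par A)[X])),
      PowerSeries.map_C,
      scaleWeight, mul_assoc]
    congr 1
    by_cases hd : d ≤ 0
    · rw [if_pos hd, if_pos (by omega), map_pow, PowerSeries.map_X]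
    · rw [if_neg hd, if_neg (by omega), map_one, pow_zero]
  · rw [map_zero, map_zero, mul_zero]

theorem polyScale_bOver (i j : ℤ) :
    polyScale A m (bOver A m l i j) =
      (if i = j then PowerSeries.C
        ((indicial (Par A) l).comp (Polynomial.X + Polynomial.C (j : Par A))) else 0) +
      PowerSeries.X ^ scaleWeight m (i - j) * PowerSeries.C
        ((shiftSymbol (t A) m (i - j)).comp (Polynomial.X + Polynomial.C (j : Par A))) := by
  rw [bOver, map_add, polyScale_shiftSymbol, apply_ite (polyScale A m), polyScale_indicial,
    map_zero]

theorem smallScale_eval_zero (f : (Par A)[X]) :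
    smallScale A m (f.eval 0) = PowerSeries.map (Polynomial.evalRingHom 0) (polyScale A m f) := by
  ext1 κ
  rw [PowerSeries.coeff_map, Polynomial.coe_evalRingHom, ← Polynomial.coeff_zero_eq_eval_zero,
    ← Polynomial.coeff_zero_eq_eval_zero, coeff_coeff_polyScale]

theorem X_pow_mul_cancel' {B : Type*} [CommRing B] (a : ℕ) {f g : B⟦X⟧}
    (h : PowerSeries.X ^ a * f = PowerSeries.X ^ a * g) : f = g := by
  ext i
  have := congrArg (PowerSeries.coeff (i + a)) h
  rwa [PowerSeries.coeff_X_pow_mul, PowerSeries.coeff_X_pow_mul] at this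

/-- Matrices that are conjugate under a diagonal matrix of powers of the variable have the
same determinant. -/
theorem det_eq_of_conj {B ι : Type*} [CommRing B] [Fintype ι] [DecidableEq ι] (a : ι → ℕ)
    (U V : Matrix ι ι B⟦X⟧)
    (h : ∀ i j, PowerSeries.X ^ a j * U i j = PowerSeries.X ^ a i * V i j) : U.det = V.det := by
  apply X_pow_mul_cancel' (∑ i, a i)
  rw [← Finset.prod_pow_eq_pow_sum, ← Matrix.det_mul_row, ← Matrix.det_mul_column]
  congr 1
  ext1 i j
  exact h i j

variable {k : Type} [Field k]

/-- Conjugation by powers of `Y` adds `d` to the weight of a shift by `d`, turning `scaleWeight`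
into `shiftWeight`. Scaling by `Y ^ (m + 1)` is just enough to keep the weight positive for all
shifts `-m ≤ d ≤ 0`. The indices are moved by `M` to make the exponents natural numbers. -/
theorem polyScale_detOver (M N : ℕ) :
    polyScale k m (detOver k m l M N) =
      windowDet k m l (shiftSymbol (t k) m) M N := by
  rw [detOver, RingHom.map_det, windowDet]
  symm
  refine det_eq_of_conj
    (fun i : Finset.Icc (-(M : ℤ)) (N : ℤ) => ((i : ℤ) + M).toNat) _ _ fun i j => ?_
  have hi := Finset.mem_Icc.1 i.2
  have hj := Finset.mem_Icc.1 j.2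
  rw [RingHom.mapMatrix_apply, Matrix.map_apply, Matrix.of_apply, polyScale_bOver, diagPert,
    Matrix.add_apply, windowPert, Matrix.of_apply, pertEntry, Matrix.diagonal_apply, mul_add,
    mul_add]
  refine congrArg₂ (· + ·) ?_ ?_
  · by_cases h : i = j
    · subst h
      rw [if_pos rfl, if_pos rfl, map_intCast]
    · rw [if_neg h, if_neg (fun h' => h (Subtype.ext h'))]
      simp
  · rw [← mul_assoc, ← mul_assoc, ← pow_add, ← pow_add]
    by_cases hd : (i : ℤ) - j < -(m : ℤ)
    · rw [shiftSymbol_eq_zero _ _ _ hd]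
      simp
    · congr 2
      rw [shiftWeight, scaleWeight]
      split_ifs <;> omega

variable {p : ℕ} [Fact p.Prime]

/-- The extra factor `Y ^ (a i)` in the divisibility can be cancelled row by row, so `U` is
conjugate to a matrix congruent to `V` modulo `Y ^ N`. -/
theorem X_pow_dvd_det_sub {B ι : Type*} [CommRing B] [Fintype ι] [DecidableEq ι] (a : ι → ℕ)
    (N : ℕ) (U V : Matrix ι ι B⟦X⟧)
    (h : ∀ i j, PowerSeries.X ^ (a i + N) ∣
      PowerSeries.X ^ a j * U i j - PowerSeries.X ^ a i * V i j) :
    PowerSeries.X ^ N ∣ U.det - V.det := by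
  choose G hG using h
  have h1 : U.det = (V + (PowerSeries.X : B⟦X⟧) ^ N • Matrix.of G).det := by
    refine det_eq_of_conj a _ _ fun i j => ?_
    rw [Matrix.add_apply, Matrix.smul_apply, Matrix.of_apply, smul_eq_mul, mul_add,
      ← sub_eq_iff_eq_add', hG, pow_add, mul_assoc]
  rw [h1, ← Ideal.mem_span_singleton, ← Ideal.Quotient.mk_eq_mk_iff_sub_mem, RingHom.map_det,
    RingHom.map_det]
  congr 1
  ext1 i j
  simp only [RingHom.mapMatrix_apply, Matrix.map_apply, Matrix.add_apply, Matrix.smul_apply,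
    smul_eq_mul]
  rw [Ideal.Quotient.mk_eq_mk_iff_sub_mem, add_sub_cancel_left]
  exact Ideal.mul_mem_right _ _ (Ideal.mem_span_singleton_self _)

/-- After conjugation by the powers `Y ^ i`, `0 ≤ i < p`, the cyclic matrix at `ε = 0` differs from
the matrix defining `Det_p(D)` only by wrapped terms. Those that wrap upwards carry an additional `Y
^ p`; those that wrap downwards vanish. -/
theorem X_pow_dvd_cyclicDet_sub :
    PowerSeries.X ^ p ∣ PowerSeries.map (Polynomial.evalRingHom 0)
      (cyclicDet p m l (shiftSymbol (t (ZMod p)) m)) - smallScale (ZMod p) m (pDet p m l) := by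
  let e : ZMod p ≃ Fin p := ⟨fun i => ⟨i.val, i.val_lt⟩, fun i => ((i : ℕ) : ZMod p),
    fun i => ZMod.natCast_zmod_val i, fun i => Fin.ext (ZMod.val_cast_of_lt i.2)⟩
  rw [cyclicDet, RingHom.map_det, pDet_eq_det, ← Matrix.det_submatrix_equiv_self e,
    RingHom.map_det]
  refine X_pow_dvd_det_sub (fun i : ZMod p => i.val) p _ _ fun i j => ?_
  have hi := i.val_lt
  have hj := j.val_lt
  have hjc : algebraMap (ZMod p) (Par (ZMod p)) j = ((j.val : ℕ) : Par (ZMod p)) := by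
    conv_lhs => rw [← ZMod.natCast_zmod_val j]
    rw [map_natCast]
  have hev : ∀ f : (Par (ZMod p))[X], Polynomial.evalRingHom 0
      (f.comp (Polynomial.X + Polynomial.C ((j.val : ℕ) : Par (ZMod p)))) =
        f.eval ((j.val : ℕ) : Par (ZMod p)) := by
    intro f
    rw [Polynomial.coe_evalRingHom, Polynomial.eval_comp]
    simp
  rw [RingHom.mapMatrix_apply, Matrix.map_apply, RingHom.mapMatrix_apply, Matrix.map_apply,
    Matrix.submatrix_apply, Matrix.of_apply, coeff_opModP, smallScale_eval_zero, polyScale_bOver,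
    diagPert, Matrix.add_apply, Matrix.diagonal_apply]
  change PowerSeries.X ^ (i.val + p) ∣ PowerSeries.X ^ j.val *
    PowerSeries.map (Polynomial.evalRingHom 0) (_ + cyclicPert p m (shiftSymbol (t (ZMod p)) m) i j)
      - PowerSeries.X ^ i.val * PowerSeries.map (Polynomial.evalRingHom 0)
      ((if ((i.val : ℕ) : ℤ) = ((j.val : ℕ) : ℤ) then _ else _) +
        PowerSeries.X ^ scaleWeight m (((i.val : ℕ) : ℤ) - ((j.val : ℕ) : ℤ)) * PowerSeries.C
        ((shiftSymbol (t (ZMod p)) m (((i.val : ℕ) : ℤ) - ((j.val : ℕ) : ℤ))).comp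
          (Polynomial.X + Polynomial.C (((j.val : ℕ) : ℤ) : Par (ZMod p)))))
  rw [map_add, map_add, mul_add, mul_add, add_sub_add_comm]
  refine dvd_add ?_ ?_
  · by_cases h : i = j
    · subst h
      rw [if_pos rfl, if_pos rfl, hjc, Int.cast_natCast]
      change _ ∣ PowerSeries.X ^ i.val * _ - PowerSeries.X ^ i.val * PowerSeries.map _
        (PowerSeries.C ((indicial (Par (ZMod p)) l).comp
          (Polynomial.X + Polynomial.C ((i.val : ℕ) : Par (ZMod p)))))
      rw [sub_self]
      exact dvd_zero _
    · rw [if_neg h, if_neg (fun h' => h (ZMod.val_injective p (by exact_mod_cast h')))]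
      simp
  · rw [cyclicPert, Matrix.of_apply, map_sum, Finset.mul_sum, map_mul, map_pow, PowerSeries.map_X,
      PowerSeries.map_C, Int.cast_natCast, hev]
    set D : ℤ := ((i.val : ℕ) : ℤ) - ((j.val : ℕ) : ℤ) with hD
    have hterm : ∀ d : ℤ, PowerSeries.X ^ j.val * PowerSeries.map (Polynomial.evalRingHom 0)
        (pertEntry m (shiftSymbol (t (ZMod p)) m) d (algebraMap (ZMod p) (Par (ZMod p)) j)) =
        PowerSeries.X ^ (j.val + shiftWeight m d) * PowerSeries.C
          ((shiftSymbol (t (ZMod p)) m d).eval ((j.val : ℕ) : Par (ZMod p))) := by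
      intro d
      rw [pertEntry, map_mul, map_pow, PowerSeries.map_X, PowerSeries.map_C, hjc, hev, ← mul_assoc,
        ← pow_add]
    have hrest : ∀ d ∈ ((Finset.Icc (-(m : ℤ)) ((p : ℤ) - 1)).filter
        (fun d : ℤ => (d : ZMod p) = i - j)).erase D,
        PowerSeries.X ^ (i.val + p) ∣ PowerSeries.X ^ j.val * PowerSeries.map
          (Polynomial.evalRingHom 0)
        (pertEntry m (shiftSymbol (t (ZMod p)) m) d (algebraMap (ZMod p) (Par (ZMod p)) j)) := by
      intro d hd
      rw [Finset.mem_erase, Finset.mem_filter, Finset.mem_Icc] at hd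
      obtain ⟨hdD, ⟨hd1, hd2⟩, hd3⟩ := hd
      have hdvd : (p : ℤ) ∣ d - D := by
        rw [← ZMod.intCast_eq_intCast_iff_dvd_sub, hd3, hD]
        push_cast
        rw [ZMod.natCast_zmod_val, ZMod.natCast_zmod_val]
      obtain ⟨c, hc⟩ := hdvd
      rw [hterm]
      rcases lt_trichotomy c 0 with h | h | h
      -- Such a shift lowers `x ^ j` below degree `0`, so it needs a derivative of order `b > j`,
      -- whose falling factorial is zero at `j`.
      · have : d ≤ D - p := by nlinarith
        rw [eval_shiftSymbol, Finset.sum_eq_zero, map_zero, mul_zero]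
        · exact dvd_zero _
        intro b _
        split_ifs with hb
        · rw [descPochhammer_eval_coe_nat_of_lt (by omega), mul_zero]
        · rfl
      · rw [h, mul_zero] at hc
        omega
      · have : D + p ≤ d := by nlinarith
        refine Dvd.dvd.mul_right (pow_dvd_pow _ ?_) _
        rw [shiftWeight]
        split_ifs <;> omega
    by_cases hm : D < -(m : ℤ)
    · rw [shiftSymbol_eq_zero _ _ _ hm, Polynomial.eval_zero, map_zero, mul_zero, mul_zero,
        sub_zero]
      refine Finset.dvd_sum fun d hd => hrest d (Finset.mem_erase.2 ⟨?_, hd⟩)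
      rintro rfl
      have := (Finset.mem_Icc.1 (Finset.mem_filter.1 hd).1).1
      omega
    · have hmem : D ∈ (Finset.Icc (-(m : ℤ)) ((p : ℤ) - 1)).filter
          (fun d : ℤ => (d : ZMod p) = i - j) := by
        rw [Finset.mem_filter, Finset.mem_Icc]
        refine ⟨⟨by omega, by omega⟩, ?_⟩
        rw [hD]
        push_cast
        rw [ZMod.natCast_zmod_val, ZMod.natCast_zmod_val]
      rw [← Finset.add_sum_erase _ _ hmem, add_sub_right_comm]
      refine dvd_add ?_ (Finset.dvd_sum hrest)
      rw [hterm, ← mul_assoc, ← pow_add]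
      have : j.val + shiftWeight m D = i.val + scaleWeight m D := by
        rw [shiftWeight, scaleWeight]
        split_ifs <;> omega
      rw [this, sub_self]
      exact dvd_zero _

end Rescaled

/-! ### Weierstrass preparation modulo a power of an ideal -/

section Weierstrass

variable {B : Type*} [CommRing B]

/-- A Weierstrass factorization is unique if the ring is separated. -/
theorem weierstrass_unique (J : Ideal B) (hJ : ∀ x, (∀ s, x ∈ J ^ s) → x = 0) {n : ℕ}
    {w w' : B[X]} {u u' : B⟦X⟧} (hw : w.Monic) (hn : w.natDegree = n) (hw' : w'.Monic)
    (hn' : w'.natDegree = n) (hI' : ∀ i < n, w'.coeff i ∈ J) (hu : IsUnit u)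
    (h : (w : B⟦X⟧) * u = w' * u') : w = w' ∧ u = u' := by
  obtain ⟨v, hv⟩ := hu.exists_right_inv
  set g : B⟦X⟧ := u' * v - 1 with hg
  have hr : (w' : B⟦X⟧) * g = ((w - w' : B[X]) : B⟦X⟧) := by
    rw [hg, mul_sub, ← mul_assoc, ← h, mul_assoc, hv, mul_one, mul_one, Polynomial.coe_sub]
  have h0 : ∀ i, (w - w').coeff (n + i) = 0 := by
    intro i
    rw [Polynomial.coeff_sub]
    rcases Nat.eq_zero_or_pos i with rfl | hi
    · have h1 : w.coeff n = 1 := by rw [← hn]; exact hw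
      have h2 : w'.coeff n = 1 := by rw [← hn']; exact hw'
      rw [add_zero, h1, h2, sub_self]
    · rw [Polynomial.coeff_eq_zero_of_natDegree_lt (by omega),
        Polynomial.coeff_eq_zero_of_natDegree_lt (by omega), sub_self]
  have hsum : (w' : B⟦X⟧) = PowerSeries.X ^ n + ((w' - Polynomial.X ^ n : B[X]) : B⟦X⟧) := by
    rw [Polynomial.coe_sub, Polynomial.coe_pow, Polynomial.coe_X, add_sub_cancel]
  have hlow : ∀ i, (w' - Polynomial.X ^ n).coeff i ∈ J := by
    intro i
    rw [Polynomial.coeff_sub, Polynomial.coeff_X_pow]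
    rcases lt_trichotomy i n with hi | hi | hi
    · rw [if_neg hi.ne, sub_zero]
      exact hI' i hi
    · have h2 : w'.coeff n = 1 := by rw [← hn']; exact hw'
      rw [if_pos hi, hi, h2, sub_self]
      exact J.zero_mem
    · rw [if_neg hi.ne', Polynomial.coeff_eq_zero_of_natDegree_lt (by omega), sub_zero]
      exact J.zero_mem
  -- The product `w' g = w - w'` has degree below `n`, while `w'` is `X ^ n` modulo `J`. Comparing
  -- coefficients at `n + i` writes each coefficient of `g` as a combination of coefficients of `g`
  -- with factors in `J`.
  have hgs : ∀ s i, PowerSeries.coeff i g ∈ J ^ s := by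
    intro s
    induction s with
    | zero => simp
    | succ s ih =>
      intro i
      have h1 := congrArg (PowerSeries.coeff (n + i)) hr
      rw [Polynomial.coeff_coe, h0, hsum, add_mul, map_add, add_comm n i,
        PowerSeries.coeff_X_pow_mul, ← eq_neg_iff_add_eq_zero] at h1
      rw [h1, pow_succ']
      refine neg_mem (coeff_mul_mem_ideal_mul_ideal_of_coeff_mem_ideal' (fun j => ?_) ih _)
      rw [Polynomial.coeff_coe]
      exact hlow j
  have hg0 : g = 0 := by
    ext i
    exact hJ _ fun s => hgs s i
  constructor
  · rw [hg0, mul_zero] at hr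
    exact (sub_eq_zero.1 (Polynomial.coe_injective B (hr.symm.trans Polynomial.coe_zero.symm)))
  · have h1 : u' * v = 1 := sub_eq_zero.1 hg0
    calc u = u * (u' * v) := by rw [h1, mul_one]
      _ = u' * (u * v) := by ring
      _ = u' := by rw [hv, mul_one]

/-- The operator `h ↦ b` times the quotient of `a h` by `X ^ n`. -/
def shiftMul (a b : B⟦X⟧) (n : ℕ) : Module.End B B⟦X⟧ where
  toFun h := b * PowerSeries.mk fun i => PowerSeries.coeff (i + n) (a * h)
  map_add' f g := by
    rw [← mul_add]
    congr 1
    ext i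
    simp [mul_add]
  map_smul' c f := by
    rw [RingHom.id_apply, ← mul_smul_comm]
    congr 1
    ext i
    simp

/-- Weierstrass preparation over a ring with a nilpotent ideal. -/
theorem exists_weierstrass {J : Ideal B} {K : ℕ} (hJ : J ^ K = ⊥) {n : ℕ} {q : B⟦X⟧}
    (hq : ∀ i < n, PowerSeries.coeff i q ∈ J) (hqn : IsUnit (PowerSeries.coeff n q)) :
    ∃ (w : B[X]) (u : B⟦X⟧), (∀ i < n, w.coeff i ∈ J) ∧ w.coeff n = 1 ∧
      (∀ i, n < i → w.coeff i = 0) ∧ IsUnit u ∧ q = w * u := by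
  have hnil : ∀ x ∈ J, IsNilpotent x := fun x hx => ⟨K, by
    have := Ideal.pow_mem_pow hx K
    rwa [hJ, Ideal.mem_bot] at this⟩
  set a : B⟦X⟧ := ((PowerSeries.trunc n q : B[X]) : B⟦X⟧) with ha
  have haJ : ∀ i, PowerSeries.coeff i a ∈ J := by
    intro i
    rw [ha, Polynomial.coeff_coe, PowerSeries.coeff_trunc]
    split_ifs with h
    · exact hq i h
    · exact J.zero_mem
  set c : B⟦X⟧ := PowerSeries.mk fun i => PowerSeries.coeff (i + n) q with hc
  have hqac : q = PowerSeries.X ^ n * c + a := PowerSeries.eq_X_pow_mul_shift_add_trunc n q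
  have hcu : IsUnit c := by
    rw [PowerSeries.isUnit_iff_constantCoeff, ← PowerSeries.coeff_zero_eq_constantCoeff_apply, hc,
      PowerSeries.coeff_mk, zero_add]
    exact hqn
  obtain ⟨b, hb⟩ := hcu.exists_right_inv
  -- Each application multiplies by coefficients of `a`, all in `J`, and so gains one power of `J`.
  have hT : IsNilpotent (shiftMul a b n) := by
    have : ∀ s h i, PowerSeries.coeff i ((shiftMul a b n ^ s) h) ∈ J ^ s := by
      intro s h
      induction s with
      | zero => simp
      | succ s ih =>
        intro i
        rw [pow_succ' (shiftMul a b n), Module.End.mul_apply]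
        refine coeff_mul_mem_ideal_of_coeff_right_mem_ideal' (fun i => ?_) i
        rw [PowerSeries.coeff_mk, pow_succ']
        exact coeff_mul_mem_ideal_mul_ideal_of_coeff_mem_ideal' haJ ih _
    refine ⟨K, LinearMap.ext fun h => PowerSeries.ext fun i => ?_⟩
    have := this K h i
    rwa [hJ, Ideal.mem_bot] at this
  -- With `q = X ^ n c + a` and `b = c⁻¹`, this equation says that `q h` equals `X ^ n` plus a
  -- polynomial of degree below `n`. Then `h⁻¹` is the invertible factor.
  obtain ⟨h, hh⟩ : ∃ h, h + shiftMul a b n h = b := by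
    obtain ⟨V, hV⟩ := hT.isUnit_one_add.exists_right_inv
    refine ⟨V b, ?_⟩
    have := LinearMap.congr_fun hV b
    rwa [Module.End.mul_apply, LinearMap.add_apply] at this
  have hah : ∀ i, PowerSeries.coeff i (a * h) ∈ J := fun i =>
    coeff_mul_mem_ideal_of_coeff_left_mem_ideal' haJ i
  set w : B[X] := Polynomial.X ^ n + PowerSeries.trunc n (a * h) with hw
  have hqh : q * h = w := by
    have h1 : c * h + PowerSeries.mk (fun i => PowerSeries.coeff (i + n) (a * h)) = 1 := by
      have h2 := congrArg (c * ·) hh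
      rw [hb, mul_add] at h2
      change c * h + c * (b * _) = 1 at h2
      rwa [← mul_assoc, hb, one_mul] at h2
    conv_lhs => rw [hqac, add_mul, PowerSeries.eq_X_pow_mul_shift_add_trunc n (a * h)]
    rw [← add_assoc, mul_assoc, ← mul_add, h1, mul_one, hw, Polynomial.coe_add, Polynomial.coe_pow,
      Polynomial.coe_X]
  have hhu : IsUnit h := by
    rw [PowerSeries.isUnit_iff_constantCoeff, ← PowerSeries.coeff_zero_eq_constantCoeff_apply]
    have h1 : IsUnit (PowerSeries.coeff 0 b) := by
      rw [PowerSeries.coeff_zero_eq_constantCoeff_apply]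
      exact PowerSeries.isUnit_iff_constantCoeff.1
        (IsUnit.of_mul_eq_one _ ((mul_comm b c).trans hb))
    have h2 : PowerSeries.coeff 0 h = PowerSeries.coeff 0 b -
        PowerSeries.coeff 0 (shiftMul a b n h) := by
      rw [eq_sub_iff_add_eq, ← map_add, hh]
    rw [h2]
    rw [sub_eq_add_neg]
    refine IsNilpotent.isUnit_add_left_of_commute (IsNilpotent.neg ?_) h1 (Commute.all _ _)
    refine hnil _ (coeff_mul_mem_ideal_of_coeff_right_mem_ideal' (fun i => ?_) 0)
    rw [PowerSeries.coeff_mk]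
    exact hah _
  obtain ⟨u, hu⟩ := hhu.exists_right_inv
  refine ⟨w, u, fun i hi => ?_, ?_, fun i hi => ?_, IsUnit.of_mul_eq_one _ ((mul_comm u h).trans hu),
    ?_⟩
  · rw [hw, Polynomial.coeff_add, Polynomial.coeff_X_pow, if_neg hi.ne, zero_add,
      PowerSeries.coeff_trunc, if_pos hi]
    exact hah i
  · rw [hw, Polynomial.coeff_add, Polynomial.coeff_X_pow, if_pos rfl,
      PowerSeries.coeff_trunc, if_neg (lt_irrefl n), add_zero]
  · rw [hw, Polynomial.coeff_add, Polynomial.coeff_X_pow, if_neg hi.ne',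
      PowerSeries.coeff_trunc, if_neg hi.not_gt, add_zero]
  · rw [← hqh, mul_assoc, hu, mul_one]

/-- `w` and `u` form a Weierstrass factorization of `q` modulo `I ^ K`. -/
structure IsPrep (I : Ideal B) (K n : ℕ) (q w : B[X]) (u : B⟦X⟧) (v : B) : Prop where
  low : ∀ i < n, w.coeff i ∈ I
  lead : w.coeff n = 1
  high : ∀ i, n < i → w.coeff i = 0
  inv : PowerSeries.coeff 0 u * v - 1 ∈ I ^ K
  congr : ∀ i, PowerSeries.coeff i ((q : B⟦X⟧) - (w : B⟦X⟧) * u) ∈ I ^ K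

namespace IsPrep

variable {I : Ideal B} {K n : ℕ} {q w : B[X]} {u : B⟦X⟧} {v : B}

theorem natDegree_le (h : IsPrep I K n q w u v) : w.natDegree ≤ n :=
  Polynomial.natDegree_le_iff_coeff_eq_zero.2 h.high

theorem monic (h : IsPrep I K n q w u v) : w.Monic :=
  Polynomial.monic_of_natDegree_le_of_coeff_eq_one n h.natDegree_le h.lead

theorem natDegree_eq [Nontrivial B] (h : IsPrep I K n q w u v) : w.natDegree = n :=
  le_antisymm h.natDegree_le (Polynomial.le_natDegree_of_ne_zero (by rw [h.lead]; exact one_ne_zero))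

theorem mono (h : IsPrep I K n q w u v) {K' : ℕ} (hK : K' ≤ K) : IsPrep I K' n q w u v :=
  ⟨h.low, h.lead, h.high, Ideal.pow_le_pow_right hK h.inv,
    fun i => Ideal.pow_le_pow_right hK (h.congr i)⟩

theorem map (h : IsPrep I K n q w u v) {B' : Type*} [CommRing B'] (φ : B →+* B') {I' : Ideal B'}
    (hI : I ≤ I'.comap φ) :
    IsPrep I' K n (q.map φ) (w.map φ) (PowerSeries.map φ u) (φ v) := by
  have hIK : I ^ K ≤ (I' ^ K).comap φ := (Ideal.pow_right_mono hI K).trans (Ideal.le_comap_pow φ K)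
  refine ⟨fun i hi => ?_, ?_, fun i hi => ?_, ?_, fun i => ?_⟩
  · rw [Polynomial.coeff_map]
    exact hI (h.low i hi)
  · rw [Polynomial.coeff_map, h.lead, map_one]
  · rw [Polynomial.coeff_map, h.high i hi, map_zero]
  · rw [PowerSeries.coeff_map, ← map_mul, ← map_one φ, ← map_sub]
    exact hIK h.inv
  · rw [Polynomial.polynomial_map_coe, Polynomial.polynomial_map_coe, ← map_mul, ← map_sub,
      PowerSeries.coeff_map]
    exact hIK (h.congr i)

/-- In the quotient by `I ^ K` the image of `I` is nilpotent, hence separated, and the uniqueness of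
genuine Weierstrass factorizations applies. -/
theorem unique (h : IsPrep I K n q w u v) {w' : B[X]} {u' : B⟦X⟧} {v' : B}
    (h' : IsPrep I K n q w' u' v') (i : ℕ) :
    w.coeff i - w'.coeff i ∈ I ^ K ∧ PowerSeries.coeff i u - PowerSeries.coeff i u' ∈ I ^ K := by
  rcases subsingleton_or_nontrivial (B ⧸ I ^ K) with hs | hs
  · have := Ideal.Quotient.subsingleton_iff.1 hs
    rw [this]
    exact ⟨trivial, trivial⟩
  set φ := Ideal.Quotient.mk (I ^ K)
  have hI : I ≤ (I.map φ).comap φ := Ideal.le_comap_map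
  have hbot : (I.map φ) ^ K = ⊥ := by rw [← Ideal.map_pow, Ideal.map_quotient_self]
  have g := h.map φ hI
  have g' := h'.map φ hI
  have key : ∀ {w : (B ⧸ I ^ K)[X]} {u : (B ⧸ I ^ K)⟦X⟧} {v : B ⧸ I ^ K},
      IsPrep (I.map φ) K n (q.map φ) w u v → IsUnit u ∧ (q.map φ : (B ⧸ I ^ K)⟦X⟧) = w * u := by
    intro w u v g
    constructor
    · rw [PowerSeries.isUnit_iff_constantCoeff, ← PowerSeries.coeff_zero_eq_constantCoeff_apply]
      have := g.inv
      rw [hbot, Ideal.mem_bot, sub_eq_zero] at this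
      exact IsUnit.of_mul_eq_one _ this
    · rw [← sub_eq_zero]
      ext i
      have := g.congr i
      rwa [hbot, Ideal.mem_bot] at this
  obtain ⟨e1, e2⟩ := weierstrass_unique (I.map φ) (fun x hx => by
    have := hx K
    rwa [hbot, Ideal.mem_bot] at this) g.monic g.natDegree_eq g'.monic g'.natDegree_eq g'.low
      (key g).1 ((key g).2.symm.trans (key g').2)
  constructor
  · rw [← Ideal.Quotient.mk_eq_mk_iff_sub_mem]
    have := congrArg (fun f => Polynomial.coeff f i) e1
    simpa only [Polynomial.coeff_map] using this
  · rw [← Ideal.Quotient.mk_eq_mk_iff_sub_mem]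
    have := congrArg (PowerSeries.coeff i) e2
    rwa [PowerSeries.coeff_map, PowerSeries.coeff_map] at this

end IsPrep

/-- The factorization exists over the quotient by `I ^ K`, where `I` is nilpotent; its coefficients
are lifted arbitrarily, except that the leading one and those above it are fixed. -/
theorem exists_isPrep (I : Ideal B) (K : ℕ) {n : ℕ} {q : B[X]} (hq : ∀ i < n, q.coeff i ∈ I) {v : B}
    (hv : q.coeff n * v - 1 ∈ I) : ∃ w u v, IsPrep I K n q w u v := by
  rcases Nat.eq_zero_or_pos K with rfl | hK
  -- For `K = 0` the congruences are void, but the lower coefficients must still lie in `I`, which a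
  -- lift from the zero ring does not ensure.
  · exact ⟨Polynomial.X ^ n, 0, 0, fun i hi => by simp [Polynomial.coeff_X_pow, hi.ne], by simp,
      fun i hi => by simp [Polynomial.coeff_X_pow, hi.ne'], by simp, by simp⟩
  set φ := Ideal.Quotient.mk (I ^ K)
  have hbot : (I.map φ) ^ K = ⊥ := by rw [← Ideal.map_pow, Ideal.map_quotient_self]
  have hsurj : Function.Surjective φ := Ideal.Quotient.mk_surjective
  have hmem : ∀ x, φ x ∈ I.map φ → x ∈ I := by
    intro x hx
    have := Ideal.mem_comap.2 hx
    rwa [Ideal.comap_map_of_surjective' φ hsurj, Ideal.mk_ker,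
      sup_eq_left.2 (Ideal.pow_le_self hK.ne')] at this
  have hker : ∀ x, φ x = 0 → x ∈ I ^ K := fun x hx => Ideal.Quotient.eq_zero_iff_mem.1 hx
  obtain ⟨w, u, h1, h2, h3, h4, h5⟩ := exists_weierstrass hbot (n := n)
    (q := ((q.map φ : (B ⧸ I ^ K)[X]) : (B ⧸ I ^ K)⟦X⟧)) (fun i hi => by
      rw [Polynomial.coeff_coe, Polynomial.coeff_map]
      exact Ideal.mem_map_of_mem _ (hq i hi)) (by
      rw [Polynomial.coeff_coe, Polynomial.coeff_map]
      have h1 : IsUnit (φ (q.coeff n) * φ v) := by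
        have : φ (q.coeff n) * φ v = 1 + φ (q.coeff n * v - 1) := by
          rw [map_sub, map_mul, map_one]; ring
        rw [this]
        refine IsNilpotent.isUnit_one_add ⟨K, ?_⟩
        have := Ideal.pow_mem_pow (Ideal.mem_map_of_mem φ hv) K
        rwa [hbot, Ideal.mem_bot] at this
      exact isUnit_of_mul_isUnit_left h1)
  choose g hg using hsurj
  obtain ⟨v', hv'⟩ := (PowerSeries.isUnit_iff_constantCoeff.1 h4).exists_right_inv
  have hcoeff : ∀ i, (Polynomial.X ^ n + ∑ j ∈ Finset.range n,
      Polynomial.C (g (w.coeff j)) * Polynomial.X ^ j).coeff i =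
        (if i = n then 1 else 0) + if i < n then g (w.coeff i) else 0 := by
    intro i
    rw [Polynomial.coeff_add, Polynomial.coeff_X_pow, Polynomial.finsetSum_coeff]
    simp only [Polynomial.coeff_C_mul_X_pow]
    congr 1
    rw [Finset.sum_ite_eq]
    simp only [Finset.mem_range]
  refine ⟨Polynomial.X ^ n + ∑ j ∈ Finset.range n, Polynomial.C (g (w.coeff j)) * Polynomial.X ^ j,
    PowerSeries.mk fun i => g (PowerSeries.coeff i u), g v', fun i hi => ?_, ?_, fun i hi => ?_,
    hker _ ?_, fun i => hker _ ?_⟩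
  · rw [hcoeff, if_neg hi.ne, if_pos hi, zero_add]
    refine hmem _ ?_
    rw [hg]
    exact h1 i hi
  · rw [hcoeff, if_pos rfl, if_neg (lt_irrefl n), add_zero]
  · rw [hcoeff, if_neg hi.ne', if_neg hi.not_gt, add_zero]
  · rw [map_sub, map_mul, PowerSeries.coeff_mk, hg, hg, map_one,
      PowerSeries.coeff_zero_eq_constantCoeff_apply, hv', sub_self]
  · have hw : (Polynomial.X ^ n + ∑ j ∈ Finset.range n,
        Polynomial.C (g (w.coeff j)) * Polynomial.X ^ j).map φ = w := by
      ext i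
      rw [Polynomial.coeff_map, hcoeff]
      rcases lt_trichotomy i n with hi | hi | hi
      · rw [if_neg hi.ne, if_pos hi, zero_add, hg]
      · rw [if_pos hi, if_neg (by omega), add_zero, map_one, hi, h2]
      · rw [if_neg hi.ne', if_neg hi.not_gt, add_zero, map_zero, h3 i hi]
    have hu : PowerSeries.map φ (PowerSeries.mk fun i => g (PowerSeries.coeff i u)) = u := by
      ext i
      rw [PowerSeries.coeff_map, PowerSeries.coeff_mk, hg]
    rw [← PowerSeries.coeff_map, map_sub, map_mul, ← Polynomial.polynomial_map_coe,
      ← Polynomial.polynomial_map_coe, hw, hu, h5, sub_self, map_zero]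

end Weierstrass

/-! ### The determinants modulo the small parameters -/

section ModSmall

variable (A : Type) [CommRing A] (m : ℕ) {n : ℕ} (l : Fin n → ℤ)

/-- A shift by `d ≤ 0` involves only parameters `t_{ij}` with `i - j = d`, all of them small. So the
matrix of `D` is lower triangular modulo `I`. -/
theorem map_shiftSymbol_of_nonpos {d : ℤ} (hd : d ≤ 0) :
    (shiftSymbol (t A) m d).map (Ideal.Quotient.mk (smallIdeal A)) = 0 := by
  rw [map_shiftSymbol, shiftSymbol]
  refine Finset.sum_eq_zero fun b _ => ?_
  split_ifs with h
  · have : t A (d + b).toNat b ∈ smallIdeal A := Ideal.subset_span ⟨_, _, by omega, rfl⟩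
    rw [Ideal.Quotient.eq_zero_iff_mem.2 this, map_zero, zero_mul]
  · rfl

theorem map_bOver_of_lt {i j : ℤ} (h : i < j) :
    (bOver A m l i j).map (Ideal.Quotient.mk (smallIdeal A)) = 0 := by
  rw [bOver, if_neg h.ne, zero_add, Polynomial.map_comp,
    map_shiftSymbol_of_nonpos A m (by omega), Polynomial.zero_comp]

theorem map_bOver_self (j : ℤ) :
    (bOver A m l j j).map (Ideal.Quotient.mk (smallIdeal A)) =
      ((indicial (Par A) l).comp (Polynomial.X + Polynomial.C (j : Par A))).map
        (Ideal.Quotient.mk (smallIdeal A)) := by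
  rw [bOver, if_pos rfl, Polynomial.map_add, Polynomial.map_comp _ (shiftSymbol _ _ _),
    map_shiftSymbol_of_nonpos A m (by omega), Polynomial.zero_comp, add_zero]

theorem map_det_bOver {ι : Type*} [Fintype ι] [DecidableEq ι] (f : ι → ℤ)
    (hf : Function.Injective f) :
    (Matrix.det (Matrix.of fun i j => bOver A m l (f i) (f j))).map
        (Ideal.Quotient.mk (smallIdeal A)) =
      (∏ j, (indicial (Par A) l).comp (Polynomial.X + Polynomial.C (f j : Par A))).map
        (Ideal.Quotient.mk (smallIdeal A)) := by
  rw [← Polynomial.coe_mapRingHom, map_prod]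
  refine (RingHom.map_det (S := (Par A ⧸ smallIdeal A)[X]) (Polynomial.mapRingHom (Ideal.Quotient.mk (smallIdeal A)))
    (Matrix.of fun i j => bOver A m l (f i) (f j))).trans ?_
  -- Triangularity refers to the order of the positions `f i` in `ℤ`.
  let _ : LinearOrder ι := LinearOrder.lift' f hf
  refine (Matrix.det_of_isLowerTriangular _ ?_).trans ?_
  rotate_left
  · refine Finset.prod_congr rfl fun j _ => ?_
    rw [RingHom.mapMatrix_apply, Matrix.map_apply, Matrix.of_apply, Polynomial.coe_mapRingHom,
      map_bOver_self]
  · intro i j hij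
    rw [RingHom.mapMatrix_apply, Matrix.map_apply, Matrix.of_apply, Polynomial.coe_mapRingHom]
    exact map_bOver_of_lt A m l hij

theorem coeff_detOver_sub_mem (M N : ℕ) (i : ℕ) :
    (detOver A m l M N).coeff i - (∏ j ∈ Finset.Icc (-(M : ℤ)) (N : ℤ),
      (indicial (Par A) l).comp (Polynomial.X + Polynomial.C (j : Par A))).coeff i ∈
        smallIdeal A := by
  rw [← Ideal.Quotient.mk_eq_mk_iff_sub_mem, ← Polynomial.coeff_map, ← Polynomial.coeff_map, detOver,
    map_det_bOver A m l (fun i : Finset.Icc (-(M : ℤ)) (N : ℤ) => (i : ℤ)) Subtype.val_injective,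
    Finset.prod_coe_sort (Finset.Icc (-(M : ℤ)) (N : ℤ))
      fun j => (indicial (Par A) l).comp (Polynomial.X + Polynomial.C (j : Par A))]

theorem pDet_sub_mem (p : ℕ) :
    pDet p m l - ∏ j : Fin p, (indicial (Par (ZMod p)) l).eval ((j : ℕ) : Par (ZMod p)) ∈
      smallIdeal (ZMod p) := by
  have h := congrArg (Polynomial.eval 0) (map_det_bOver (ZMod p) m l
    (fun i : Fin p => ((i : ℕ) : ℤ)) fun i j h => Fin.ext (by simpa using h))
  rw [Polynomial.eval_zero_map, Polynomial.eval_zero_map,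
    Ideal.Quotient.mk_eq_mk_iff_sub_mem, Polynomial.eval_prod] at h
  have h1 : Polynomial.eval 0 (Matrix.det (Matrix.of fun i j : Fin p =>
      bOver (ZMod p) m l ((i : ℕ) : ℤ) ((j : ℕ) : ℤ))) = pDet p m l := by
    rw [pDet_eq_det, ← Polynomial.coe_evalRingHom, RingHom.map_det]
    congr 1
    ext1 i j
    rw [RingHom.mapMatrix_apply, Matrix.map_apply, Matrix.of_apply, Matrix.of_apply, coeff_opModP,
      Polynomial.coe_evalRingHom]
  rw [h1] at h
  refine (congrArg (· ∈ smallIdeal (ZMod p)) ?_).mp h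
  congr 1
  refine Finset.prod_congr rfl fun j _ => ?_
  rw [Polynomial.eval_comp]
  simp

variable {A l} in
-- Each exponent, counted with multiplicity, meets the window once and gives one factor `X`; every
-- other linear factor has the invertible constant term `j - l_q`. This is where the degree `n`
-- comes from.
theorem exists_prod_indicial_eq {s : Finset ℤ} (hs : ∀ q, l q ∈ s)
    (hA : ∀ q, ∀ j ∈ s, j ≠ l q → IsUnit ((j - l q : ℤ) : A)) :
    ∃ U : (Par A)[X], IsUnit (U.coeff 0) ∧
      ∏ j ∈ s, (indicial (Par A) l).comp (Polynomial.X + Polynomial.C (j : Par A)) =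
        Polynomial.X ^ n * U := by
  refine ⟨∏ q, ∏ j ∈ s.erase (l q), (Polynomial.X + Polynomial.C ((j - l q : ℤ) : Par A)), ?_, ?_⟩
  · rw [Polynomial.coeff_zero_eq_eval_zero, Polynomial.eval_prod, IsUnit.prod_univ_iff]
    intro q
    rw [Polynomial.eval_prod, IsUnit.prod_iff]
    intro j hj
    rw [Polynomial.eval_add, Polynomial.eval_X, Polynomial.eval_C, zero_add]
    have := (hA q j (Finset.mem_of_mem_erase hj) (Finset.ne_of_mem_erase hj)).map
      (algebraMap A (Par A))
    rwa [map_intCast] at this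
  · have h1 : ∀ j : ℤ, (indicial (Par A) l).comp (Polynomial.X + Polynomial.C (j : Par A)) =
        ∏ q, (Polynomial.X + Polynomial.C ((j - l q : ℤ) : Par A)) := by
      intro j
      rw [indicial, Polynomial.prod_comp]
      refine Finset.prod_congr rfl fun q _ => ?_
      rw [Polynomial.sub_comp, Polynomial.X_comp, Polynomial.C_comp, Int.cast_sub, map_sub]
      ring
    simp only [h1]
    rw [Finset.prod_comm]
    have h2 : ∀ q, ∏ j ∈ s, (Polynomial.X + Polynomial.C ((j - l q : ℤ) : Par A)) =
        Polynomial.X * ∏ j ∈ s.erase (l q), (Polynomial.X + Polynomial.C ((j - l q : ℤ) : Par A)) := by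
      intro q
      rw [← Finset.mul_prod_erase _ _ (hs q), sub_self, Int.cast_zero, map_zero, add_zero]
    simp only [h2, Finset.prod_mul_distrib]
    rw [Finset.prod_const, Finset.card_univ, Fintype.card_fin]

variable {A l} in
theorem exists_isPrep_detOver (K : ℕ) {M N : ℕ} (hs : ∀ q, -(M : ℤ) ≤ l q ∧ l q ≤ N)
    (hA : ∀ q, ∀ j : ℤ, -(M : ℤ) ≤ j → j ≤ N → j ≠ l q → IsUnit ((j - l q : ℤ) : A)) :
    ∃ w u v, IsPrep (smallIdeal A) K n (detOver A m l M N) w u v := by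
  obtain ⟨U, hU, hP⟩ := exists_prod_indicial_eq (A := A) (l := l)
    (s := Finset.Icc (-(M : ℤ)) (N : ℤ)) (fun q => Finset.mem_Icc.2 (hs q)) fun q j hj =>
      hA q j (Finset.mem_Icc.1 hj).1 (Finset.mem_Icc.1 hj).2
  have h := coeff_detOver_sub_mem A m l M N
  simp only [hP] at h
  obtain ⟨v, hv⟩ := hU.exists_right_inv
  refine exists_isPrep _ K (fun i hi => ?_) (v := v) ?_
  · have := h i
    rwa [Polynomial.coeff_X_pow_mul', if_neg hi.not_ge, sub_zero] at this
  · have := h n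
    rw [Polynomial.coeff_X_pow_mul', if_pos le_rfl, Nat.sub_self] at this
    rw [← hv, ← sub_mul]
    exact Ideal.mul_mem_right _ _ this

variable {A} in
theorem smallIdeal_le_comap {A' : Type} [CommRing A'] (φ : A →+* A') :
    smallIdeal A ≤ (smallIdeal A').comap (MvPolynomial.map φ) := by
  rw [smallIdeal, Ideal.span_le]
  rintro _ ⟨i, j, hij, rfl⟩
  rw [SetLike.mem_coe, Ideal.mem_comap, MvPolynomial.map_X]
  exact Ideal.subset_span ⟨i, j, hij, rfl⟩

variable {A l} in
theorem IsPrep.map_detOver {A' : Type} [CommRing A'] (φ : A →+* A') {K M N : ℕ} {w : (Par A)[X]}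
    {u : (Par A)⟦X⟧} {v : Par A} (h : IsPrep (smallIdeal A) K n (detOver A m l M N) w u v) :
    IsPrep (smallIdeal A') K n (detOver A' m l M N) (w.map (MvPolynomial.map φ))
      (PowerSeries.map (MvPolynomial.map φ) u) (MvPolynomial.map φ v) := by
  have := h.map (MvPolynomial.map φ) (smallIdeal_le_comap φ)
  rwa [PDet.map_detOver] at this

/-! ### Independence of the window -/

section Field

variable {k : Type} [Field k] {m} {l}

theorem IsPrep.isMonicLift {K M N : ℕ} {w : (Par k)[X]} {u : (Par k)⟦X⟧} {v : Par k}
    (h : IsPrep (smallIdeal k) K n (detOver k m l M N) w u v) :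
    IsMonicLift n (polyScale k m w) :=
  isMonicLift_polyScale m h.monic h.natDegree_eq h.low

theorem IsPrep.isFactor {K M N N' : ℕ} {w : (Par k)[X]} {u : (Par k)⟦X⟧} {v : Par k}
    (h : IsPrep (smallIdeal k) K n (detOver k m l M N) w u v) (hK : K ≠ 0)
    (hN : N' + 1 = (m + 1) * K) :
    IsFactor N' (windowDet k m l (shiftSymbol (t k) m) M N) (polyScale k m w) := by
  rw [← polyScale_detOver]
  exact isFactor_polyScale m hK hN h.inv h.congr

/-- Independence of the window, brought back from powers of `Y` to powers of `I`. In characteristic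
zero all denominators `r + 1` are invertible and distinct integers stay distinct, so windows of any
size are allowed. -/
theorem IsPrep.coeff_sub_mem [CharZero k] {c K J M N : ℕ} (hl : ∀ q, (l q).natAbs ≤ c)
    (hJ : c + 2 * ((m + 1) * ((m + 1) * K)) ≤ J) (hM : J ≤ M) (hN : J ≤ N)
    {w w' : (Par k)[X]} {u u' : (Par k)⟦X⟧} {v v' : Par k}
    (h : IsPrep (smallIdeal k) K n (detOver k m l M N) w u v)
    (h' : IsPrep (smallIdeal k) K n (detOver k m l J J) w' u' v') (i : ℕ) :
    w.coeff i - w'.coeff i ∈ smallIdeal k ^ K := by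
  rcases Nat.eq_zero_or_pos K with rfl | hK
  · simp
  have hmK : 0 < (m + 1) * K := Nat.mul_pos (by omega) hK
  obtain ⟨N', hN'⟩ : ∃ N', N' + 1 = (m + 1) * K := ⟨(m + 1) * K - 1, by omega⟩
  rw [← hN'] at hJ
  rw [mem_smallIdeal_pow_iff k m]
  intro κ hκ
  rw [map_sub, map_sub, ← coeff_coeff_polyScale, ← coeff_coeff_polyScale,
    coeff_eq_of_isFactor_windowDet (k := k) (c := c) (N := N') l (fun r _ => Nat.cast_ne_zero.2 (by omega))
      (shiftSymbol_eq_zero (t k) m) (by nlinarith) hM hN (fun i _ _ hi q h => ?_) h.isMonicLift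
      h'.isMonicLift (h.isFactor hK.ne' hN') (h'.isFactor hK.ne' hN') κ (by omega), sub_self]
  have := Int.cast_injective h
  have := hl q
  omega

end Field

end ModSmall

/-! ### Splitting monic polynomials -/

section Splitting

universe u

theorem exists_prod_X_sub_C {A : Type u} [CommRing A] [Nontrivial A] {w : A[X]} (hw : w.Monic)
    {n : ℕ} (hn : w.natDegree = n) :
    ∃ (S : Type u) (_ : CommRing S) (_ : Algebra A S), Function.Injective (algebraMap A S) ∧
      ∃ r : Fin n → S, w.map (algebraMap A S) = ∏ k, (Polynomial.X - Polynomial.C (r k)) := by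
  obtain ⟨S, _, _, _, _, _, hS⟩ := hw.exists_splits_map
  refine ⟨S, inferInstance, inferInstance, FaithfulSMul.algebraMap_injective A S, ?_⟩
  obtain ⟨μ, hμ⟩ := splits_iff_exists_multiset.1 hS
  rw [(hw.map _).leadingCoeff, map_one, one_mul] at hμ
  have hcard : μ.card = n := by
    rw [← hn, ← hw.natDegree_map (algebraMap A S), hμ, Polynomial.natDegree_multiset_prod_X_sub_C_eq_card]
  obtain ⟨L, rfl⟩ := Quotient.exists_rep μ
  obtain rfl : L.length = n := hcard
  refine ⟨L.get, ?_⟩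
  rw [hμ, ← List.prod_ofFn]
  change (Multiset.map _ (L : Multiset S)).prod = _
  rw [Multiset.map_coe, Multiset.prod_coe]
  congr 1
  conv_lhs => rw [← List.ofFn_get L, List.map_ofFn]
  rfl

variable {A : Type} [CommRing A] {n : ℕ} {w : A[X]}

theorem algebraMap_splittingRing (a : A) : algebraMap A (SplittingRing n w) a =
    Ideal.Quotient.mk (splittingIdeal n w) (MvPolynomial.C a) := rfl

/-- The universal ring maps to a faithful extension of `A` in which `w` splits, so nothing in `A` is
killed. -/
theorem injective_algebraMap_splittingRing (hw : w.Monic) (hn : w.natDegree = n) :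
    Function.Injective (algebraMap A (SplittingRing n w)) := by
  rcases subsingleton_or_nontrivial A with hs | hs
  · exact Function.injective_of_subsingleton _
  obtain ⟨S, _, _, hinj, r, hr⟩ := exists_prod_X_sub_C hw hn
  let φ : MvPolynomial (Fin n) A →+* S := (MvPolynomial.aeval r : _ →ₐ[A] S).toRingHom
  have hφC : φ.comp MvPolynomial.C = algebraMap A S := RingHom.ext fun a => MvPolynomial.aeval_C r a
  have hφX : ∀ k, φ (MvPolynomial.X k) = r k := fun k => MvPolynomial.aeval_X r k
  have hker : ∀ c ∈ splittingIdeal n w, φ c = 0 := by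
    intro c hc
    have : splittingIdeal n w ≤ RingHom.ker φ := by
      rw [splittingIdeal, Ideal.span_le]
      rintro _ ⟨j, -, rfl⟩
      rw [SetLike.mem_coe, RingHom.mem_ker, ← Polynomial.coeff_map, Polynomial.map_sub,
        Polynomial.map_map, hφC, hr, Polynomial.map_prod]
      simp only [Polynomial.map_sub, Polynomial.map_X, Polynomial.map_C, hφX, sub_self,
        Polynomial.coeff_zero]
    exact this hc
  refine Function.Injective.of_comp (f := Ideal.Quotient.lift _ φ hker) ?_
  have : (Ideal.Quotient.lift _ φ hker) ∘ (algebraMap A (SplittingRing n w)) = algebraMap A S := by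
    ext a
    rw [Function.comp_apply, algebraMap_splittingRing, Ideal.Quotient.lift_mk, ← hφC]
    rfl
  rw [this]
  exact hinj

theorem map_splittingRing (hw : w.Monic) (hn : w.natDegree = n) :
    w.map (algebraMap A (SplittingRing n w)) =
      ∏ k : Fin n, (Polynomial.X - Polynomial.C (root n w k)) := by
  have h1 : ∀ j, j < n → (w.map (algebraMap A (SplittingRing n w)) -
      ∏ k : Fin n, (Polynomial.X - Polynomial.C (root n w k))).coeff j = 0 := by
    intro j hj
    have hmem : (w.map (MvPolynomial.C : A →+* MvPolynomial (Fin n) A) -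
        ∏ k : Fin n, (Polynomial.X - Polynomial.C (MvPolynomial.X k))).coeff j ∈
          splittingIdeal n w := Ideal.subset_span ⟨j, hj, rfl⟩
    rw [← Ideal.Quotient.eq_zero_iff_mem, ← Polynomial.coeff_map, Polynomial.map_sub,
      Polynomial.map_map, Polynomial.map_prod] at hmem
    simp only [Polynomial.map_sub, Polynomial.map_X, Polynomial.map_C] at hmem
    exact hmem
  rcases subsingleton_or_nontrivial (SplittingRing n w) with hs | hs
  · exact Subsingleton.elim _ _
  have hm : (∏ k : Fin n, (Polynomial.X - Polynomial.C (root n w k))).Monic :=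
    Polynomial.monic_prod_of_monic _ _ fun _ _ => Polynomial.monic_X_sub_C _
  have hd : (∏ k : Fin n, (Polynomial.X - Polynomial.C (root n w k))).natDegree = n := by
    rw [Polynomial.natDegree_prod_of_monic _ _ fun _ _ => Polynomial.monic_X_sub_C _]
    simp
  have hm' := hw.map (algebraMap A (SplittingRing n w))
  have hd' : (w.map (algebraMap A (SplittingRing n w))).natDegree = n := by
    rw [hw.natDegree_map, hn]
  ext j
  rcases lt_trichotomy j n with h | h | h
  · exact sub_eq_zero.1 ((Polynomial.coeff_sub _ _ _).symm.trans (h1 j h))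
  · subst h
    have e1 := hm.coeff_natDegree
    have e2 := hm'.coeff_natDegree
    rw [hd] at e1
    rw [hd'] at e2
    rw [e1, e2]
  · rw [Polynomial.coeff_eq_zero_of_natDegree_lt (by omega),
      Polynomial.coeff_eq_zero_of_natDegree_lt (by omega)]

theorem eval_zero_of_map_eq_prod {A S : Type*} [CommRing A] [CommRing S] {n : ℕ} {w : A[X]}
    (φ : A →+* S) (r : Fin n → S)
    (h : w.map φ = ∏ k, (Polynomial.X - Polynomial.C (r k))) :
    φ ((-1) ^ n * w.eval 0) = ∏ k, r k := by
  have h1 := congrArg (Polynomial.eval 0) h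
  rw [Polynomial.eval_zero_map, Polynomial.eval_prod] at h1
  simp only [Polynomial.eval_sub, Polynomial.eval_X, Polynomial.eval_C, zero_sub] at h1
  rw [map_mul, h1, map_pow, map_neg, map_one, Finset.prod_neg, Finset.card_univ, Fintype.card_fin,
    ← mul_assoc, ← mul_pow]
  simp

theorem algebraMap_eval_zero_splittingRing (hw : w.Monic) (hn : w.natDegree = n) :
    algebraMap A (SplittingRing n w) ((-1) ^ n * w.eval 0) = ∏ k : Fin n, root n w k :=
  eval_zero_of_map_eq_prod _ _ (map_splittingRing hw hn)

/-- The product of the values at the elements of the prime field of a polynomial all of whose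
roots are nilpotent. -/
theorem prod_eval_zmod {B : Type*} [CommRing B] [Nontrivial B] {p : ℕ} [Fact p.Prime]
    [Algebra (ZMod p) B] {J : Ideal B} {K : ℕ} (hJ : J ^ K = ⊥) {n : ℕ} (hp : n * K < p)
    {w : B[X]} (hw : w.Monic) (hn : w.natDegree = n) (hI : ∀ i < n, w.coeff i ∈ J) :
    ∏ j : ZMod p, w.eval (algebraMap (ZMod p) B j) = (-1) ^ n * w.eval 0 := by
  obtain ⟨S, _, _, hinj, r, hr⟩ := exists_prod_X_sub_C hw hn
  apply hinj
  have : Nontrivial S := hinj.nontrivial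
  set ψ : ZMod p →+* S := (algebraMap B S).comp (algebraMap (ZMod p) B)
  -- A root satisfies `r ^ n = -∑_{i<n} w_i r ^ i` with `w_i` in `J`, so `r ^ (n * K) = 0`, and `n *
  -- K < p`.
  have hr0 : ∀ k, r k ^ p = 0 := by
    intro k
    have h1 : (w.map (algebraMap B S)).eval (r k) = 0 := by
      rw [hr, Polynomial.eval_prod]
      refine Finset.prod_eq_zero (Finset.mem_univ k) ?_
      simp
    have h2 : r k ^ n ∈ J.map (algebraMap B S) := by
      have hlead : w.coeff n = 1 := by rw [← hn]; exact hw
      rw [Polynomial.eval_eq_sum_range, hw.natDegree_map, hn, Finset.sum_range_succ,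
        Polynomial.coeff_map, hlead, map_one, one_mul, add_comm, ← eq_neg_iff_add_eq_zero] at h1
      rw [h1]
      refine neg_mem (Ideal.sum_mem _ fun i hi => Ideal.mul_mem_right _ _ ?_)
      rw [Polynomial.coeff_map]
      exact Ideal.mem_map_of_mem _ (hI i (Finset.mem_range.1 hi))
    have h3 := Ideal.pow_mem_pow h2 K
    rw [← Ideal.map_pow, hJ, Ideal.map_bot, Ideal.mem_bot, ← pow_mul] at h3
    rw [← Nat.sub_add_cancel hp.le, pow_add, h3, mul_zero]
  -- The factorization of `X ^ p - X` over the prime field, evaluated at `x`. For a root the `p`-th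
  -- power vanishes, and `(-1) ^ p = -1` in characteristic `p` leaves the root itself.
  have hprod : ∀ x : S, ∏ j : ZMod p, (ψ j - x) = (-1) ^ p * (x ^ p - x) := by
    intro x
    have hp1 : 1 < p := (Fact.out : p.Prime).one_lt
    have h0 : ∏ j : ZMod p, (Polynomial.X - Polynomial.C j) = Polynomial.X ^ p - Polynomial.X := by
      have hroots := FiniteField.roots_X_pow_card_sub_X (ZMod p)
      rw [ZMod.card] at hroots
      rw [← Polynomial.prod_multiset_X_sub_C_of_monic_of_roots_card_eq
        (p := (Polynomial.X ^ p - Polynomial.X : (ZMod p)[X])), hroots]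
      · rfl
      · refine Polynomial.monic_X_pow_sub ?_
        rw [Polynomial.degree_X]
        exact_mod_cast hp1
      · rw [hroots, FiniteField.X_pow_card_sub_X_natDegree_eq _ hp1]
        simp
    have h1 := congrArg (Polynomial.eval₂RingHom ψ x) h0
    rw [map_prod, map_sub, map_pow] at h1
    simp only [map_sub, Polynomial.coe_eval₂RingHom, Polynomial.eval₂_X, Polynomial.eval₂_C] at h1
    rw [← h1]
    have h2 := Finset.prod_neg (s := (Finset.univ : Finset (ZMod p))) fun j => x - ψ j
    simp only [neg_sub, Finset.card_univ, ZMod.card] at h2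
    exact h2
  have hneg : (-1 : S) ^ p = -1 := by
    have := congrArg ψ (ZMod.pow_card (-1 : ZMod p))
    rwa [map_pow, map_neg, map_one] at this
  rw [eval_zero_of_map_eq_prod _ r hr, map_prod]
  have h1 : ∀ j : ZMod p, algebraMap B S (w.eval (algebraMap (ZMod p) B j)) =
      ∏ k, (ψ j - r k) := by
    intro j
    rw [← Polynomial.eval₂_at_apply, ← Polynomial.eval_map, hr, Polynomial.eval_prod]
    simp [ψ]
  simp only [h1]
  rw [Finset.prod_comm]
  refine Finset.prod_congr rfl fun k _ => ?_
  rw [hprod, hr0, hneg]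
  ring

end Splitting

/-! ### The `p`-determinant in terms of a Weierstrass polynomial -/

section Congruence

theorem smallIdeal_pow_ne_top {A : Type} [CommRing A] [Nontrivial A] {K : ℕ} (hK : K ≠ 0) :
    smallIdeal A ^ K ≠ ⊤ := by
  rw [Ideal.ne_top_iff_one, mem_smallIdeal_pow_iff_coeff]
  intro h
  have := h 0 (by simpa [smallDegree] using Nat.pos_of_ne_zero hK)
  simp at this

variable {p : ℕ} [Fact p.Prime] {m n : ℕ} {l : Fin n → ℤ}

theorem map_evalRingHom_zero_shiftSeries (a : ZMod p) (w : (Par (ZMod p))[X]) :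
    PowerSeries.map (Polynomial.evalRingHom 0)
      (shiftSeries (algebraMap (ZMod p) (Par (ZMod p)) a) (polyScale (ZMod p) m w)) =
      smallScale (ZMod p) m (w.eval (algebraMap (ZMod p) (Par (ZMod p)) a)) := by
  set b := algebraMap (ZMod p) (Par (ZMod p)) a with hb
  have h : ((PowerSeries.map (Polynomial.evalRingHom 0)).comp
      ((shiftSeries b).comp (polyScale (ZMod p) m))) =
      (smallScale (ZMod p) m).comp (Polynomial.evalRingHom b) := by
    refine Polynomial.ringHom_ext (fun r => ?_) ?_
    · simp only [RingHom.comp_apply]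
      rw [polyScale_C, Polynomial.coe_evalRingHom b, Polynomial.eval_C]
      ext1 κ
      rw [PowerSeries.coeff_map, PowerSeries.coeff_map, PowerSeries.coeff_map, shiftHom_C,
        Polynomial.coe_evalRingHom, Polynomial.eval_C]
    · simp only [RingHom.comp_apply]
      rw [polyScale_X, Polynomial.coe_evalRingHom b, Polynomial.eval_X, PowerSeries.map_C,
        PowerSeries.map_C, shiftHom_X, Polynomial.coe_evalRingHom, Polynomial.eval_add,
        Polynomial.eval_X, Polynomial.eval_C, zero_add, hb, MvPolynomial.algebraMap_eq, smallScale_C]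
  exact RingHom.congr_fun h w

/-- The identity between the cyclic determinant and the product of translates, specialized to `ε =
0` and read modulo `I ^ K`. -/
theorem IsPrep.pDet_sub_prod_mem {c K J N : ℕ} (hl : ∀ q, (l q).natAbs ≤ c)
    (hN : N + 1 = (m + 1) * K) (hJN : c + 2 * ((m + 1) * N) ≤ J) (hJ : 2 * J + m + N < p)
    (hNm : N * m < p - 1) {w : (Par (ZMod p))[X]} {u : (Par (ZMod p))⟦X⟧} {v : Par (ZMod p)}
    (h : IsPrep (smallIdeal (ZMod p)) K n (detOver (ZMod p) m l J J) w u v) :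
    pDet p m l - ∏ j : ZMod p, w.eval (algebraMap (ZMod p) (Par (ZMod p)) j) ∈
      smallIdeal (ZMod p) ^ K := by
  have hK : K ≠ 0 := by
    rintro rfl
    omega
  rw [mem_smallIdeal_pow_iff (ZMod p) m]
  intro κ hκ
  have h1 : PowerSeries.coeff κ (PowerSeries.map (Polynomial.evalRingHom 0)
      (cyclicDet p m l (shiftSymbol (t (ZMod p)) m))) =
      PowerSeries.coeff κ (smallScale (ZMod p) m (pDet p m l)) := by
    rw [← sub_eq_zero, ← map_sub]
    exact PowerSeries.X_pow_dvd_iff.1 (X_pow_dvd_cyclicDet_sub m l) κ (by omega)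
  rw [map_sub, map_sub, ← h1, PowerSeries.coeff_map,
    coeff_cyclicDet_eq l (shiftSymbol_eq_zero _ m) (natDegree_shiftSymbol_le _ m) hl hJN hJ hNm
      h.isMonicLift (h.isFactor hK hN) κ (by omega), ← PowerSeries.coeff_map, translateProd,
    map_prod, map_prod (smallScale (ZMod p) m), sub_eq_zero]
  refine congrArg _ ?_
  exact Finset.prod_congr rfl fun j _ => map_evalRingHom_zero_shiftSeries j w

theorem IsPrep.pDet_sub_eval_mem {c K J N : ℕ} (hl : ∀ q, (l q).natAbs ≤ c)
    (hN : N + 1 = (m + 1) * K) (hJN : c + 2 * ((m + 1) * N) ≤ J) (hJ : 2 * J + m + N < p)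
    (hNm : N * m < p - 1) (hnK : n * K < p) {w : (Par (ZMod p))[X]} {u : (Par (ZMod p))⟦X⟧}
    {v : Par (ZMod p)} (h : IsPrep (smallIdeal (ZMod p)) K n (detOver (ZMod p) m l J J) w u v) :
    pDet p m l - (-1) ^ n * w.eval 0 ∈ smallIdeal (ZMod p) ^ K := by
  have hK : K ≠ 0 := by
    rintro rfl
    omega
  have h1 := h.pDet_sub_prod_mem hl hN hJN hJ hNm
  set φ := Ideal.Quotient.mk (smallIdeal (ZMod p) ^ K) with hφ
  have : Nontrivial (Par (ZMod p) ⧸ smallIdeal (ZMod p) ^ K) :=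
    Ideal.Quotient.nontrivial_iff.2 (smallIdeal_pow_ne_top hK)
  have hbot : ((smallIdeal (ZMod p)).map φ) ^ K = ⊥ := by
    rw [← Ideal.map_pow, Ideal.map_quotient_self]
  have h2 := prod_eval_zmod hbot hnK (h.monic.map φ)
    ((h.monic.natDegree_map φ).trans h.natDegree_eq) fun i hi => by
      rw [Polynomial.coeff_map]
      exact Ideal.mem_map_of_mem _ (h.low i hi)
  rw [← Ideal.Quotient.mk_eq_mk_iff_sub_mem] at h1 ⊢
  rw [h1, map_prod, map_mul, map_pow, map_neg, map_one, ← Polynomial.eval_zero_map, ← hφ, ← h2]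
  refine Finset.prod_congr rfl fun j _ => ?_
  rw [← Polynomial.eval₂_at_apply, ← Polynomial.eval_map]
  rfl

end Congruence

/-! ### Comparison of the residue fields at `0` and `p` -/

section Local

variable (p : ℕ)

/-- The integers prime to `p`. -/
def primeTo : Submonoid ℤ := (IsUnit.submonoid (ZMod p)).comap (Int.castRingHom (ZMod p))

/-- The localization of the integers at the integers prime to `p`. -/
abbrev PLocal : Type := Localization (primeTo p)

/-- The reduction modulo `p`. -/
def pLocalToZMod : PLocal p →+* ZMod p :=
  IsLocalization.lift (M := primeTo p) (g := Int.castRingHom (ZMod p)) fun s => s.2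

theorem pLocalToZMod_comp :
    (pLocalToZMod p).comp (algebraMap ℤ (PLocal p)) = Int.castRingHom (ZMod p) :=
  IsLocalization.lift_comp _

variable [Fact p.Prime]

theorem mem_primeTo {s : ℤ} : s ∈ primeTo p ↔ ¬ (p : ℤ) ∣ s := by
  change IsUnit ((s : ℤ) : ZMod p) ↔ _
  rw [isUnit_iff_ne_zero, ne_eq, ZMod.intCast_zmod_eq_zero_iff_dvd]

/-- The embedding into the rational numbers. -/
def pLocalToRat : PLocal p →+* ℚ :=
  IsLocalization.lift (M := primeTo p) (g := Int.castRingHom ℚ) fun s => by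
    rw [isUnit_iff_ne_zero, eq_intCast, Int.cast_ne_zero]
    intro h
    exact (mem_primeTo p).1 s.2 (h ▸ dvd_zero _)

theorem pLocalToRat_comp :
    (pLocalToRat p).comp (algebraMap ℤ (PLocal p)) = Int.castRingHom ℚ :=
  IsLocalization.lift_comp _

/-- A polynomial has finitely many coefficients, hence a common denominator; primality of `p` keeps
the denominator prime to `p`. -/
theorem exists_smul_eq_map (c : Par (PLocal p)) : ∃ (s : ℤ) (a : Par ℤ), ¬ (p : ℤ) ∣ s ∧
    (s : Par (PLocal p)) * c = MvPolynomial.map (algebraMap ℤ (PLocal p)) a := by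
  have hp : Prime (p : ℤ) := Nat.prime_iff_prime_int.1 Fact.out
  induction c using MvPolynomial.induction_on with
  | C x =>
    obtain ⟨a, s, rfl⟩ := IsLocalization.exists_mk'_eq (primeTo p) x
    refine ⟨s, MvPolynomial.C a, (mem_primeTo p).1 s.2, ?_⟩
    rw [MvPolynomial.map_C, ← map_intCast (MvPolynomial.C (σ := ℕ × ℕ) (R := PLocal p)),
      ← map_mul]
    congr 1
    rw [← eq_intCast (algebraMap ℤ (PLocal p))]
    exact IsLocalization.mk'_spec' (PLocal p) a s
  | add f g hf hg =>
    obtain ⟨s, a, hs, ha⟩ := hf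
    obtain ⟨s', a', hs', ha'⟩ := hg
    refine ⟨s * s', s' * a + s * a', fun h => (hp.dvd_or_dvd h).elim hs hs', ?_⟩
    rw [map_add, map_mul, map_mul, ← ha, ← ha', map_intCast, map_intCast]
    push_cast
    ring
  | mul_X f i hf =>
    obtain ⟨s, a, hs, ha⟩ := hf
    refine ⟨s, a * MvPolynomial.X i, hs, ?_⟩
    rw [map_mul, MvPolynomial.map_X, ← ha, mul_assoc]

theorem isUnit_pLocal {s : ℤ} (hs : s ≠ 0) (h : s.natAbs < p) : IsUnit ((s : ℤ) : PLocal p) := by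
  have hm : s ∈ primeTo p := by
    rw [mem_primeTo]
    intro hd
    have := Nat.le_of_dvd (Int.natAbs_pos.2 hs) (Int.natCast_dvd.1 hd)
    omega
  have := IsLocalization.map_units (PLocal p) ⟨s, hm⟩
  rwa [eq_intCast] at this

variable {p} {m n : ℕ} {l : Fin n → ℤ}

/-- The constant coefficient of a Weierstrass polynomial over the rational numbers lifts the
`p`-determinant. -/
theorem IsPrep.exists_congr_pDet {c K J N : ℕ} (hl : ∀ q, (l q).natAbs ≤ c)
    (hN : N + 1 = (m + 1) * K) (hJN : c + 2 * ((m + 1) * N) ≤ J) (hJ : 2 * J + m + N < p)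
    (hNm : N * m < p - 1) (hnK : n * K < p) {w : (Par ℚ)[X]} {u : (Par ℚ)⟦X⟧}
    {v : Par ℚ} (h : IsPrep (smallIdeal ℚ) K n (detOver ℚ m l J J) w u v) :
    ∃ (s : ℤ) (a : Par ℤ), ¬ (p : ℤ) ∣ s ∧
      (s : Par ℚ) * ((-1) ^ n * w.eval 0) - MvPolynomial.map (Int.castRingHom ℚ) a ∈
        smallIdeal ℚ ^ K ∧
      MvPolynomial.map (Int.castRingHom (ZMod p)) a - s • pDet p m l ∈
        smallIdeal (ZMod p) ^ K := by
  -- The nonzero differences `j - l_q` have absolute value at most `J + c < p`, so they are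
  -- invertible in the localization and the factorization is `p`-integral.
  obtain ⟨w', u', v', h'⟩ := exists_isPrep_detOver (A := PLocal p) m (l := l) K (M := J) (N := J)
    (fun q => by
      have := hl q
      omega) fun q j hj1 hj2 hj => by
      have := hl q
      exact isUnit_pLocal p (sub_ne_zero.2 hj) (by omega)
  obtain ⟨s, a, hs, ha⟩ := exists_smul_eq_map p ((-1) ^ n * w'.eval 0)
  refine ⟨s, a, hs, ?_, ?_⟩
  -- Over `ℚ` the image of the `p`-integral factorization must agree with the given one modulo `I ^
  -- K`.
  · have h1 := ((h'.map_detOver m (pLocalToRat p)).unique h 0).1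
    have h2 := congrArg (MvPolynomial.map (pLocalToRat p)) ha
    rw [MvPolynomial.map_map, pLocalToRat_comp, map_mul, map_mul, map_intCast, map_pow, map_neg,
      map_one] at h2
    rw [Polynomial.coeff_map, Polynomial.coeff_zero_eq_eval_zero,
      Polynomial.coeff_zero_eq_eval_zero] at h1
    rw [← h2, ← mul_sub, ← mul_sub, ← neg_sub]
    exact Ideal.mul_mem_left _ _ (Ideal.mul_mem_left _ _ (neg_mem h1))
  · have h1 := (h'.map_detOver m (pLocalToZMod p)).pDet_sub_eval_mem hl hN hJN hJ hNm hnK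
    have h2 := congrArg (MvPolynomial.map (pLocalToZMod p)) ha
    rw [MvPolynomial.map_map, pLocalToZMod_comp, map_mul, map_mul, map_intCast, map_pow, map_neg,
      map_one] at h2
    rw [Polynomial.eval_zero_map] at h1
    rw [← h2, zsmul_eq_mul, ← mul_sub, ← neg_sub]
    exact Ideal.mul_mem_left _ _ (neg_mem h1)

end Local

/-! ### The completed ring -/

section Completion

theorem red_algebraMap (K : ℕ) (c : Par ℚ) :
    red K (algebraMap (Par ℚ) Rhat c) = Ideal.Quotient.mk (smallIdeal ℚ ^ K) c :=
  (red K).commutes c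

theorem red_toRhat (K : ℕ) (a : Par ℤ) : red K (toRhat a) =
    Ideal.Quotient.mk (smallIdeal ℚ ^ K) (MvPolynomial.map (Int.castRingHom ℚ) a) :=
  red_algebraMap K _

theorem rhat_ext {x y : Rhat} (h : ∀ K, red K x = red K y) : x = y := AdicCompletion.ext_evalₐ h

theorem exists_red_eq {c : ℕ → Par ℚ} (hc : ∀ K, c (K + 1) - c K ∈ smallIdeal ℚ ^ K) :
    ∃ x : Rhat, ∀ K, red K x = Ideal.Quotient.mk (smallIdeal ℚ ^ K) (c K) := by
  refine ⟨AdicCompletion.mk (smallIdeal ℚ) (Par ℚ)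
    (AdicCompletion.AdicCauchySequence.mk _ _ c fun K => ?_), fun K => AdicCompletion.evalₐ_mk _ _ _⟩
  rw [SModEq.sub_mem, smul_eq_mul, Ideal.mul_top, ← neg_sub]
  exact neg_mem (hc K)

theorem exists_red_rep (x : Rhat) (K : ℕ) : ∃ c : Par ℚ, ∀ K' ≤ K,
    red K' x = Ideal.Quotient.mk (smallIdeal ℚ ^ K') c := by
  obtain ⟨f, rfl⟩ := AdicCompletion.mk_surjective (smallIdeal ℚ) (Par ℚ) x
  refine ⟨f K, fun K' hK => ?_⟩
  refine (AdicCompletion.evalₐ_mk _ _ _).trans ?_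
  rw [Ideal.Quotient.mk_eq_mk_iff_sub_mem]
  have := f.2 hK
  rwa [SModEq.sub_mem, smul_eq_mul, Ideal.mul_top] at this

theorem red_eq_of_le {x : Rhat} {c : Par ℚ} {K K' : ℕ} (hK : K' ≤ K)
    (h : red K x = Ideal.Quotient.mk (smallIdeal ℚ ^ K) c) :
    red K' x = Ideal.Quotient.mk (smallIdeal ℚ ^ K') c := by
  obtain ⟨d, hd⟩ := exists_red_rep x K
  rw [hd K le_rfl, Ideal.Quotient.mk_eq_mk_iff_sub_mem] at h
  rw [hd K' hK, Ideal.Quotient.mk_eq_mk_iff_sub_mem]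
  exact Ideal.pow_le_pow_right hK h

theorem mem_hatIdeal_iff {x : Rhat} {c : Par ℚ} {K : ℕ} (hK : K ≠ 0)
    (h : red K x = Ideal.Quotient.mk (smallIdeal ℚ ^ K) c) :
    x ∈ hatIdeal ↔ c ∈ smallIdeal ℚ := by
  rw [hatIdeal, RingHom.mem_ker]
  change red 1 x = 0 ↔ _
  rw [red_eq_of_le (Nat.one_le_iff_ne_zero.2 hK) h, Ideal.Quotient.eq_zero_iff_mem, pow_one]

/-- Modulo `I ^ K`, elements of `hatIdeal` land in the image of `I`, whose `K`-th power is zero.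
Only this inclusion is needed, not a description of the powers of `hatIdeal`. -/
theorem hatIdeal_hausdorff (x : Rhat) (h : ∀ s, x ∈ hatIdeal ^ s) : x = 0 := by
  refine rhat_ext fun K => ?_
  rw [map_zero]
  rcases Nat.eq_zero_or_pos K with rfl | hK
  · have : Subsingleton (Par ℚ ⧸ smallIdeal ℚ ^ 0) :=
      Ideal.Quotient.subsingleton_iff.2 ((pow_zero _).trans Ideal.one_eq_top)
    exact Subsingleton.elim _ _
  set φ := Ideal.Quotient.mk (smallIdeal ℚ ^ K)
  have h1 : hatIdeal ≤ ((smallIdeal ℚ).map φ).comap (red K).toRingHom := by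
    intro y hy
    obtain ⟨c, hc⟩ := exists_red_rep y K
    have h2 := (mem_hatIdeal_iff hK.ne' (hc K le_rfl)).1 hy
    rw [Ideal.mem_comap]
    change red K y ∈ _
    rw [hc K le_rfl]
    exact Ideal.mem_map_of_mem _ h2
  have h2 := Ideal.le_comap_pow _ _ (Ideal.pow_right_mono h1 K (h K))
  rwa [← Ideal.map_pow, Ideal.map_quotient_self, Ideal.mem_comap, Ideal.mem_bot] at h2

instance : Nontrivial Rhat := by
  refine ⟨⟨0, 1, fun h => ?_⟩⟩
  have h1 := congrArg (red 1) h
  rw [map_zero, map_one] at h1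
  have : Nontrivial (Par ℚ ⧸ smallIdeal ℚ ^ 1) :=
    Ideal.Quotient.nontrivial_iff.2 (smallIdeal_pow_ne_top one_ne_zero)
  exact zero_ne_one h1

end Completion

/-! ### Weierstrass polynomials over the completed ring -/

section Limit

variable {n : ℕ}

theorem exists_polynomial_limit {w : ℕ → (Par ℚ)[X]}
    (hlow : ∀ K, ∀ i < n, (w K).coeff i ∈ smallIdeal ℚ) (hlead : ∀ K, (w K).coeff n = 1)
    (hhigh : ∀ K i, n < i → (w K).coeff i = 0)
    (hw : ∀ K i, (w (K + 1)).coeff i - (w K).coeff i ∈ smallIdeal ℚ ^ K) :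
    ∃ W : Rhat[X], W.Monic ∧ W.natDegree = n ∧ (∀ i < n, W.coeff i ∈ hatIdeal) ∧
      ∀ K i, red K (W.coeff i) = Ideal.Quotient.mk (smallIdeal ℚ ^ K) ((w K).coeff i) := by
  choose x hx using fun i => exists_red_eq (c := fun K => (w K).coeff i) fun K => hw K i
  have hx1 : x n = 1 := by
    refine rhat_ext fun K => ?_
    rw [hx, hlead, map_one, map_one]
  set W : Rhat[X] := ∑ i ∈ Finset.range (n + 1), Polynomial.C (x i) * Polynomial.X ^ i
  have hW : ∀ i, W.coeff i = if i ≤ n then x i else 0 := by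
    intro i
    rw [Polynomial.finsetSum_coeff]
    simp only [Polynomial.coeff_C_mul_X_pow]
    rw [Finset.sum_ite_eq]
    simp only [Finset.mem_range, Nat.lt_succ_iff]
  have hdeg : W.natDegree ≤ n := Polynomial.natDegree_le_iff_coeff_eq_zero.2 fun i hi => by
    rw [hW, if_neg hi.not_ge]
  have hWn : W.coeff n = 1 := by rw [hW, if_pos le_rfl, hx1]
  refine ⟨W, Polynomial.monic_of_natDegree_le_of_coeff_eq_one n hdeg hWn,
    le_antisymm hdeg (Polynomial.le_natDegree_of_ne_zero (by rw [hWn]; exact one_ne_zero)),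
    fun i hi => ?_, fun K i => ?_⟩
  · rw [hW, if_pos hi.le]
    exact (mem_hatIdeal_iff one_ne_zero (hx i 1)).2 (hlow 1 i hi)
  · rw [hW]
    split_ifs with h
    · exact hx i K
    · rw [map_zero, hhigh K i (not_le.1 h), map_zero]

/-- By uniqueness the factorizations modulo the various `I ^ K` are compatible, so `w`, `u` and the
inverse of the constant term of `u` all pass to the limit. -/
theorem exists_weierstrass_rhat {q : (Par ℚ)[X]} (h : ∀ K, ∃ w u v,
    IsPrep (smallIdeal ℚ) K n q w u v) :
    ∃ W : Rhat[X], IsWeierstrassPolynomial n ((q.map (algebraMap (Par ℚ) Rhat) : Rhat[X])) W ∧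
      ∀ K, ∃ w u v, IsPrep (smallIdeal ℚ) K n q w u v ∧
        ∀ i, red K (W.coeff i) = Ideal.Quotient.mk (smallIdeal ℚ ^ K) (w.coeff i) := by
  choose w u v h using h
  have huniq : ∀ K i, (w (K + 1)).coeff i - (w K).coeff i ∈ smallIdeal ℚ ^ K ∧
      PowerSeries.coeff i (u (K + 1)) - PowerSeries.coeff i (u K) ∈ smallIdeal ℚ ^ K :=
    fun K => ((h (K + 1)).mono (Nat.le_succ K)).unique (h K)
  obtain ⟨W, hW1, hW2, hW3, hW4⟩ := exists_polynomial_limit (fun K => (h K).low)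
    (fun K => (h K).lead) (fun K => (h K).high) fun K i => (huniq K i).1
  choose x hx using fun i => exists_red_eq (c := fun K => PowerSeries.coeff i (u K))
    fun K => (huniq K i).2
  obtain ⟨y, hy⟩ := exists_red_eq (c := v) fun K => by
    have h1 := (huniq K 0).2
    have h2 := ((h (K + 1)).mono (Nat.le_succ K)).inv
    have h3 := (h K).inv
    -- Inverses of congruent elements are congruent: every term on the right has a factor in `I ^
    -- K`.
    have e : v (K + 1) - v K = v K * (PowerSeries.coeff 0 (u (K + 1)) * v (K + 1) - 1) -
        v (K + 1) * (PowerSeries.coeff 0 (u K) * v K - 1) -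
        v K * v (K + 1) * (PowerSeries.coeff 0 (u (K + 1)) - PowerSeries.coeff 0 (u K)) := by
      ring
    rw [e]
    exact sub_mem (sub_mem (Ideal.mul_mem_left _ _ h2) (Ideal.mul_mem_left _ _ h3))
      (Ideal.mul_mem_left _ _ h1)
  refine ⟨W, ⟨hW1, hW2, hW3, PowerSeries.mk x, ?_, ?_⟩, fun K => ⟨w K, u K, v K, h K, hW4 K⟩⟩
  · rw [PowerSeries.isUnit_iff_constantCoeff, ← PowerSeries.coeff_zero_eq_constantCoeff_apply,
      PowerSeries.coeff_mk]
    refine IsUnit.of_mul_eq_one y (rhat_ext fun K => ?_)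
    rw [map_mul, hx, hy, map_one, ← map_mul, ← map_one (Ideal.Quotient.mk (smallIdeal ℚ ^ K)),
      Ideal.Quotient.mk_eq_mk_iff_sub_mem]
    exact (h K).inv
  · refine PowerSeries.ext fun i => rhat_ext fun K => ?_
    have h1 := (h K).congr i
    rw [map_sub, ← Ideal.Quotient.mk_eq_mk_iff_sub_mem, Polynomial.coeff_coe, PowerSeries.coeff_mul,
      map_sum] at h1
    rw [Polynomial.coeff_coe, Polynomial.coeff_map, red_algebraMap, h1, PowerSeries.coeff_mul,
      map_sum]
    refine Finset.sum_congr rfl fun a _ => ?_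
    rw [map_mul, map_mul, Polynomial.coeff_coe, Polynomial.coeff_coe, hW4, PowerSeries.coeff_mk, hx]

theorem detBhat_eq (m : ℕ) (l : Fin n → ℤ) (M N : ℕ) : detBhat m l M N =
    (((detOver ℚ m l M N).map (algebraMap (Par ℚ) Rhat) : Rhat[X]) : Rhat⟦X⟧) := by
  rw [detBhat, detB_eq, toRhat, ← Polynomial.map_map, map_detOver]

theorem IsWeierstrassPolynomial.eq {q : Rhat⟦X⟧} {w w' : Rhat[X]}
    (h : IsWeierstrassPolynomial n q w) (h' : IsWeierstrassPolynomial n q w') : w = w' := by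
  obtain ⟨h1, h2, -, u, hu, hq⟩ := h
  obtain ⟨h1', h2', h3', u', -, hq'⟩ := h'
  exact (weierstrass_unique hatIdeal hatIdeal_hausdorff h1 h2 h1' h2' h3' hu (hq.symm.trans hq')).1

end Limit

/-! ### Lifts of the `p`-determinants -/

section Lift

theorem CongrMod.mono {p K K' : ℕ} {L : Rhat} {d : Par (ZMod p)} (h : CongrMod p K L d)
    (hK : K' ≤ K) : CongrMod p K' L d := by
  obtain ⟨s, a, hs, h1, h2⟩ := h
  refine ⟨s, a, hs, ?_, Ideal.pow_le_pow_right hK h2⟩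
  rw [red_toRhat] at h1 ⊢
  exact red_eq_of_le hK h1

/-- A rational number that is divisible by infinitely many prime numbers vanishes. -/
theorem rat_eq_zero_of_dvd {x : ℚ} {B : ℕ} (h : ∀ p : ℕ, p.Prime → B ≤ p →
    ∃ s y : ℤ, ¬ (p : ℤ) ∣ s ∧ (p : ℤ) ∣ y ∧ s * x = y) : x = 0 := by
  -- A prime larger than the numerator can divide it only if the numerator is zero.
  obtain ⟨p, hpB, hp⟩ := Nat.exists_infinite_primes (B + x.num.natAbs + 1)
  obtain ⟨s, y, hs, hy, hxy⟩ := h p hp (by omega)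
  have h1 : s * x.num = y * x.den := by
    have h2 : (s : ℚ) * x.num = y * x.den := by
      rw [← hxy, mul_assoc, Rat.mul_den_eq_num]
    exact_mod_cast h2
  have h2 : (p : ℤ) ∣ x.num :=
    ((Nat.prime_iff_prime_int.1 hp).dvd_or_dvd (h1 ▸ Dvd.dvd.mul_right hy _)).resolve_left hs
  rw [← Rat.num_eq_zero]
  by_contra h0
  have := Nat.le_of_dvd (Int.natAbs_pos.2 h0) (Int.natCast_dvd.1 h2)
  omega

theorem coeff_zsmul {A : Type} [CommRing A] (σ : ℕ × ℕ →₀ ℕ) (s : ℤ) (f : Par A) :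
    (s • f).coeff σ = s * f.coeff σ := by
  rw [zsmul_eq_mul, ← map_intCast (MvPolynomial.C (σ := ℕ × ℕ) (R := A)),
    MvPolynomial.coeff_C_mul]

/-- Fix a monomial of small degree below `K`. For all large `p` both lifts are visible modulo `I ^
K` and reduce to the same determinant, so, after multiplication by an integer prime to `p`, the
difference of their coefficients is an integer divisible by `p`. -/
theorem IsUniversalSeries.eq {n m : ℕ} {l : Fin n → ℤ} {L L' : Rhat}
    (h : IsUniversalSeries m l L) (h' : IsUniversalSeries m l L') : L = L' := by
  obtain ⟨C, hC, h⟩ := h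
  obtain ⟨C', hC', h'⟩ := h'
  refine rhat_ext fun K => ?_
  obtain ⟨c, hc⟩ := exists_red_rep L K
  obtain ⟨c', hc'⟩ := exists_red_rep L' K
  rw [hc K le_rfl, hc' K le_rfl, Ideal.Quotient.mk_eq_mk_iff_sub_mem,
    mem_smallIdeal_pow_iff_coeff]
  intro σ hσ
  have hceil : ∀ {C : ℝ}, 0 < C → ∀ p : ℕ, ⌈K / C⌉₊ ≤ p → K ≤ ⌈C * p⌉₊ := by
    intro C hC p hp
    have h1 : (K : ℝ) / C ≤ p := Nat.ceil_le.1 hp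
    have h2 : (K : ℝ) ≤ C * p := by rwa [div_le_iff₀' hC] at h1
    exact_mod_cast h2.trans (Nat.le_ceil _)
  refine rat_eq_zero_of_dvd (B := ⌈K / C⌉₊ + ⌈K / C'⌉₊) fun p hp hB => ?_
  have hpp := Nat.prime_iff_prime_int.1 hp
  obtain ⟨s, a, hs, h1, h2⟩ := (h p hp).mono (hceil hC p (by omega))
  obtain ⟨s', a', hs', h1', h2'⟩ := (h' p hp).mono (hceil hC' p (by omega))
  rw [red_toRhat, map_zsmul, hc K le_rfl, ← map_zsmul, Ideal.Quotient.mk_eq_mk_iff_sub_mem,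
    mem_smallIdeal_pow_iff_coeff] at h1
  rw [red_toRhat, map_zsmul, hc' K le_rfl, ← map_zsmul, Ideal.Quotient.mk_eq_mk_iff_sub_mem,
    mem_smallIdeal_pow_iff_coeff] at h1'
  rw [mem_smallIdeal_pow_iff_coeff] at h2 h2'
  have e1 := h1 σ hσ
  have e1' := h1' σ hσ
  have e2 := h2 σ hσ
  have e2' := h2' σ hσ
  simp only [MvPolynomial.coeff_sub, coeff_zsmul, MvPolynomial.coeff_map, eq_intCast]
    at e1 e1' e2 e2' ⊢
  refine ⟨s * s', s' * a.coeff σ - s * a'.coeff σ, fun h => (hpp.dvd_or_dvd h).elim hs hs', ?_, ?_⟩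
  · rw [← ZMod.intCast_zmod_eq_zero_iff_dvd]
    push_cast
    linear_combination (s' : ZMod p) * e2 - (s : ZMod p) * e2'
  · push_cast
    linear_combination (s' : ℚ) * e1 - (s : ℚ) * e1'

end Lift

/-! ### Window sizes, the limit polynomial and the constant in the congruences -/

section Main

variable (m : ℕ) {n : ℕ} (l : Fin n → ℤ)

/-- A bound for the exponents. -/
def expBound : ℕ := Finset.univ.sup fun q => (l q).natAbs

theorem natAbs_le_expBound (q : Fin n) : (l q).natAbs ≤ expBound l :=
  Finset.le_sup (f := fun q => (l q).natAbs) (Finset.mem_univ q)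

/-- The size of a window that determines the Weierstrass polynomial modulo `I ^ K`. -/
def windowSize (K : ℕ) : ℕ := expBound l + 2 * ((m + 1) * ((m + 1) * K))

theorem exists_isPrep_rat (K : ℕ) {M N : ℕ} (hM : expBound l ≤ M) (hN : expBound l ≤ N) :
    ∃ w u v, IsPrep (smallIdeal ℚ) K n (detOver ℚ m l M N) w u v :=
  exists_isPrep_detOver m K
    (fun q => by
      have := natAbs_le_expBound l q
      omega)
    fun _ _ _ _ hj => isUnit_iff_ne_zero.2 (Int.cast_ne_zero.2 (sub_ne_zero.2 hj))

theorem windowSize_mono {K K' : ℕ} (h : K ≤ K') : windowSize m l K ≤ windowSize m l K' := by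
  unfold windowSize
  gcongr

theorem expBound_le_windowSize (K : ℕ) : expBound l ≤ windowSize m l K := Nat.le_add_right _ _

/-- The windows grow with `K`; consecutive Weierstrass polynomials belong to different windows but
agree modulo `I ^ K`, as both windows contain the one sufficient for `K`. -/
theorem exists_limit : ∃ w : Rhat[X], w.Monic ∧ w.natDegree = n ∧ (∀ i < n, w.coeff i ∈ hatIdeal) ∧
    ∀ K, ∃ w' u v, IsPrep (smallIdeal ℚ) K n
      (detOver ℚ m l (windowSize m l K) (windowSize m l K)) w' u v ∧
      ∀ i, red K (w.coeff i) = Ideal.Quotient.mk (smallIdeal ℚ ^ K) (w'.coeff i) := by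
  choose w u v h using fun K => exists_isPrep_rat m l K (expBound_le_windowSize m l K)
    (expBound_le_windowSize m l K)
  obtain ⟨W, h1, h2, h3, h4⟩ := exists_polynomial_limit (fun K => (h K).low) (fun K => (h K).lead)
    (fun K => (h K).high) fun K => ((h (K + 1)).mono (Nat.le_succ K)).coeff_sub_mem
      (natAbs_le_expBound l) le_rfl (windowSize_mono m l (Nat.le_succ K))
      (windowSize_mono m l (Nat.le_succ K)) (h K)
  exact ⟨W, h1, h2, h3, fun K => ⟨w K, u K, v K, h K, h4 K⟩⟩

variable {m l}

/-- This covers the primes too small for the general argument. Modulo `I` the determinant is the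
product of the indicial polynomial over all residues: it vanishes modulo `p` if there is an
exponent, and it is the empty product `1` if `n = 0`. -/
theorem congrMod_one {L : Rhat} {p : ℕ} [Fact p.Prime]
    (h : if n = 0 then L = 1 else L ∈ hatIdeal) : CongrMod p 1 L (pDet p m l) := by
  have hp1 : ¬ (p : ℤ) ∣ 1 := fun h => (Nat.prime_iff_prime_int.1 Fact.out).not_isUnit
    (isUnit_of_dvd_one h)
  have hdet := pDet_sub_mem m l p
  by_cases hn : n = 0
  · subst hn
    rw [if_pos rfl] at h
    refine ⟨1, 1, hp1, by rw [h, one_smul, map_one, map_one, map_one], ?_⟩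
    rw [one_smul, map_one, pow_one, ← neg_sub]
    simpa [indicial] using neg_mem hdet
  · rw [if_neg hn] at h
    refine ⟨1, 0, hp1, ?_, ?_⟩
    · rw [one_smul, map_zero, map_zero]
      exact h
    · rw [one_smul, map_zero, pow_one, zero_sub]
      refine neg_mem ?_
      have q : Fin n := ⟨0, Nat.pos_of_ne_zero hn⟩
      have h0 : ∏ j : Fin p, (indicial (Par (ZMod p)) l).eval ((j : ℕ) : Par (ZMod p)) = 0 := by
        refine Finset.prod_eq_zero (Finset.mem_univ ⟨((l q : ZMod p)).val, ZMod.val_lt _⟩) ?_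
        rw [indicial, Polynomial.eval_prod]
        refine Finset.prod_eq_zero (Finset.mem_univ q) ?_
        rw [Polynomial.eval_sub, Polynomial.eval_X, Polynomial.eval_C, sub_eq_zero]
        have := congrArg (algebraMap (ZMod p) (Par (ZMod p))) (ZMod.natCast_zmod_val (l q : ZMod p))
        rwa [map_natCast, map_intCast] at this
      rwa [h0, sub_zero] at hdet

theorem isUniversalSeries_limit {w : Rhat[X]} (hw : w.Monic) (hn : w.natDegree = n)
    (hI : ∀ i < n, w.coeff i ∈ hatIdeal)
    (h : ∀ K, ∃ w' u v, IsPrep (smallIdeal ℚ) K n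
      (detOver ℚ m l (windowSize m l K) (windowSize m l K)) w' u v ∧
      ∀ i, red K (w.coeff i) = Ideal.Quotient.mk (smallIdeal ℚ ^ K) (w'.coeff i)) :
    IsUniversalSeries m l ((-1) ^ n * w.eval 0) := by
  -- `Q * K < p` must imply `2 * J + m + N < p`, `N * m < p - 1` and `n * K < p` for `J = windowSize
  -- m l K` and `N = (m + 1) * K - 1`; `Q` collects the coefficients of `K` in these bounds.
  set Q : ℕ := 2 * expBound l + 4 * (m + 1) ^ 2 + m + (m + 1) + (m + 1) * m + n + 2 with hQ
  refine ⟨1 / (2 * Q), by positivity, fun p hp => ?_⟩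
  have : Fact p.Prime := ⟨hp⟩
  have hppos : (0 : ℝ) < p := by exact_mod_cast hp.pos
  have hQpos : (0 : ℝ) < Q := by positivity
  set K := ⌈1 / (2 * (Q : ℝ)) * p⌉₊ with hK
  have hKpos : 0 < K := Nat.ceil_pos.2 (by positivity)
  rcases (Nat.succ_le_of_lt hKpos).eq_or_lt with hK1 | hK1
  · rw [← hK1]
    refine congrMod_one ?_
    split_ifs with h0
    · subst h0
      rw [hw.natDegree_eq_zero.1 hn]
      simp
    · rw [← Polynomial.coeff_zero_eq_eval_zero]
      exact Ideal.mul_mem_left _ _ (hI 0 (Nat.pos_of_ne_zero h0))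
  -- For `K ≥ 2`, rounding up costs at most a factor of two: `K / 2 ≤ K - 1 < p / (2 * Q)`. This
  -- accounts for the `2` in the constant, and `K = 1` had to be treated separately.
  have hQK : Q * K < p := by
    have h1 : (K : ℝ) < 1 / (2 * (Q : ℝ)) * p + 1 := Nat.ceil_lt_add_one (by positivity)
    have h2 : (2 : ℝ) ≤ K := by exact_mod_cast hK1
    have h3 : (K : ℝ) / 2 < 1 / (2 * (Q : ℝ)) * p := by linarith
    have h4 : (Q : ℝ) * K < p := by
      have := mul_lt_mul_of_pos_left h3 (by positivity : (0 : ℝ) < 2 * Q)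
      have e1 : 2 * (Q : ℝ) * (K / 2) = Q * K := by ring
      have e2 : 2 * (Q : ℝ) * (1 / (2 * Q) * p) = p := by field_simp
      rwa [e1, e2] at this
    exact_mod_cast h4
  obtain ⟨w', u, v, h', hw'⟩ := h K
  obtain ⟨N, hN⟩ : ∃ N, N + 1 = (m + 1) * K := ⟨(m + 1) * K - 1, by
    have : 0 < (m + 1) * K := by positivity
    omega⟩
  have hsize : windowSize m l K = expBound l + 2 * ((m + 1) * (N + 1)) := by rw [windowSize, hN]
  have hb1 : expBound l ≤ expBound l * K := Nat.le_mul_of_pos_right _ hKpos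
  have hb2 : m ≤ m * K := Nat.le_mul_of_pos_right _ hKpos
  have e1 : Q * K = 2 * (expBound l * K) + 4 * ((m + 1) * ((m + 1) * K)) + m * K + (m + 1) * K +
      (m + 1) * K * m + n * K + 2 * K := by
    rw [hQ]
    ring
  rw [← hN] at e1
  have e2 : (N + 1) * m = N * m + m := by ring
  obtain ⟨s, a, hs, ha, hd⟩ := h'.exists_congr_pDet (p := p) (natAbs_le_expBound l) hN
    (by rw [hsize]; nlinarith) (by rw [hsize]; omega) (by omega) (by omega)
  refine ⟨s, a, hs, ?_, hd⟩
  have hw0 : red K (w.eval 0) = Ideal.Quotient.mk (smallIdeal ℚ ^ K) (w'.eval 0) := by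
    rw [← Polynomial.coeff_zero_eq_eval_zero, ← Polynomial.coeff_zero_eq_eval_zero, hw']
  rw [red_toRhat, zsmul_eq_mul, map_mul, map_mul, map_intCast, map_pow, map_neg, map_one, hw0,
    ← (Ideal.Quotient.mk_eq_mk_iff_sub_mem _ _).2 ha, map_mul, map_mul, map_intCast, map_pow,
    map_neg, map_one]

end Main

end
end PDet

theorem theorem4 (n m : ℕ) (l : Fin n → ℤ) (hl : Monotone l) :
    ∃ (W : ℕ → ℕ → Polynomial PDet.Rhat) (w : Polynomial PDet.Rhat) (L : PDet.Rhat),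
      -- for large `M` and `N`, `W M N` is the Weierstrass polynomial of `det B_{-M,N}(ε)`
      (∃ M₀ : ℕ, ∀ M N : ℕ, M₀ ≤ M → M₀ ≤ N → ∀ v : Polynomial PDet.Rhat,
        PDet.IsWeierstrassPolynomial n (PDet.detBhat m l M N) v ↔ v = W M N) ∧
      -- `w` is the `I`-adic limit of these polynomials
      PDet.IsAdicLimit W w ∧
      -- `L` is the universal series `L(D)`
      (∀ L' : PDet.Rhat, PDet.IsUniversalSeries m l L' ↔ L' = L) ∧
      -- `L(D) = (-1)ⁿ w(0)`
      L = (-1) ^ n * w.eval 0 ∧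
      -- `L(D)` is the product of the roots of `w` in the extension of `Rhat` where `w` splits
      Function.Injective (algebraMap PDet.Rhat (PDet.SplittingRing n w)) ∧
      w.map (algebraMap PDet.Rhat (PDet.SplittingRing n w)) =
        ∏ k : Fin n, (Polynomial.X - Polynomial.C (PDet.root n w k)) ∧
      algebraMap PDet.Rhat (PDet.SplittingRing n w) L = ∏ k : Fin n, PDet.root n w k := by
  have hW : ∀ M N : ℕ, ∃ W : Polynomial PDet.Rhat, PDet.expBound l ≤ M → PDet.expBound l ≤ N →
      PDet.IsWeierstrassPolynomial n (PDet.detBhat m l M N) W ∧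
      ∀ K, ∃ w u v, PDet.IsPrep (PDet.smallIdeal ℚ) K n (PDet.detOver ℚ m l M N) w u v ∧
        ∀ i, PDet.red K (W.coeff i) = Ideal.Quotient.mk (PDet.smallIdeal ℚ ^ K) (w.coeff i) := by
    intro M N
    by_cases h : PDet.expBound l ≤ M ∧ PDet.expBound l ≤ N
    · obtain ⟨W, hW⟩ := PDet.exists_weierstrass_rhat fun K => PDet.exists_isPrep_rat m l K h.1 h.2
      rw [← PDet.detBhat_eq] at hW
      exact ⟨W, fun _ _ => hW⟩
    -- A window smaller than `expBound l` may miss an exponent; the value there plays no role.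
    · exact ⟨0, fun h1 h2 => absurd ⟨h1, h2⟩ h⟩
  choose W hW using hW
  obtain ⟨w, hmonic, hdeg, hI, hw⟩ := PDet.exists_limit m l
  have hL := PDet.isUniversalSeries_limit hmonic hdeg hI hw
  refine ⟨W, w, (-1) ^ n * w.eval 0, ⟨PDet.expBound l, fun M N hM hN v =>
    ⟨fun hv => hv.eq (hW M N hM hN).1, fun hv => hv ▸ (hW M N hM hN).1⟩⟩, fun K => ?_,
    fun L' => ⟨fun h => h.eq hL, fun h => h ▸ hL⟩, rfl,
    PDet.injective_algebraMap_splittingRing hmonic hdeg, PDet.map_splittingRing hmonic hdeg,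
    PDet.algebraMap_eval_zero_splittingRing hmonic hdeg⟩
  -- From this size on, every window gives, modulo `I ^ K`, the polynomial of the symmetric window
  -- by which `w` is represented at level `K`.
  refine ⟨PDet.windowSize m l K, fun M N hM hN i => ?_⟩
  have hc := PDet.expBound_le_windowSize m l K
  obtain ⟨w₁, u₁, v₁, h₁, h₁'⟩ := (hW M N (hc.trans hM) (hc.trans hN)).2 K
  obtain ⟨w₂, u₂, v₂, h₂, h₂'⟩ := hw K
  rw [h₁', h₂', Ideal.Quotient.mk_eq_mk_iff_sub_mem]
  exact h₁.coeff_sub_mem (PDet.natAbs_le_expBound l) le_rfl hM hN h₂ i
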